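/- **Theorem 4.2.** Let $\alpha\in(0,2)\setminus\{1\}$ and let $(X_t)_{t\in\mathbb Z}$ be a strictly stationary sequence of $\mathbb R^d$-valued random vectors ($|\cdot|$ is the Euclidean norm) which is regularly varying with index $\alpha$: for every $k\ge1$ the vector $Z=(X_1,\dots,X_k)$ admits a probability measure $\sigma_k$ on the unit sphere such that, for all $u>0$, $\mathbb P(|Z|>ux,\,Z/|Z|\in\cdot)/\mathbb P(|Z|>x)$ converges weakly to $u^{-\alpha}\sigma_k$ as $x\to\infty$. Let $(\Theta_t)_{t\in\mathbb Z}$ be its spectral tail process, i.e. for every $k\ge0$ the law of $|X_0|^{-1}(X_{-k},\dots,X_k)$ conditionally on $|X_0|>x$ converges weakly to the law of $(\Theta_{-k},\dots,\Theta_k)$ as $x\to\infty$. Let $(a_n)$ satisfy $n\,\mathbb P(|X_0|>a_n)\to1$, let $(m_n)$ be integers with $m_n\to\infty$ and $m_n=o(n)$, and put $k_n=\lfloor n/m_n\rfloor$. Write $S_n=\sum_{t=1}^nX_t$ and, for $\varepsilon>0$ and $j\ge 1$, $$\underline S_j=\sum_{t=1}^jX_t\mathbf 1_{\{|X_t|>\varepsilon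 a_n\}},\qquad \overline S_j=\sum_{t=1}^jX_t\mathbf 1_{\{|X_t|\le\varepsilon a_n\}}.$$ Assume: 1. (mixing) for all sufficiently small $\varepsilon>0$ and all $s\in\mathbb R^d$, $\ \mathbb E e^{is'\underline S_n/a_n}-\big(\mathbb E e^{is'\underline S_{m_n}/a_n}\big)^{k_n}\to0$ as $n\to\infty$; 2. (anti-clustering) for all $\delta>0$, $\ \lim_{k\to\infty}\limsup_{n\to\infty}\mathbb P\big(\max_{k\le i\le m_n}|X_i|>\delta a_n\,\big|\,|X_0|>\delta a_n\big)=0$; 3. if $\alpha\in(1,2)$, in addition $\mathbb E X_0=0$, $\ \sum_{j\ge1}\mathbb E|\Theta_j|<\infty$, and $\lim_{\varepsilon\downarrow0}\limsup_{n\to\infty}\mathbb P\big(a_n^{-1}|\overline S_n-\mathbb E\overline S_n|>\delta\big)=0$ for all $\delta>0$. Then $\sum_{j\ge0}\Theta_j$ converges absolutely a.s., and $a_n^{-1}S_n$ converges in distribution to an $\alpha$-stable random vector $\xi_\alpha$ with characteristic function $\mathbb E e^{is'\xi_\alpha}=e^{\psi(s)}$, $$\psi(s)=\int_0^\infty\mathbb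 E\Big(e^{iys'\sum_{j=0}^\infty\Theta_j}-e^{iys'\sum_{j=1}^\infty\Theta_j}-iys'A\Big)\,d(-y^{-\alpha}),\qquad s\in\mathbb R^d,$$ where $A=0$ if $\alpha\in(0,1)$, $A=\Theta_0$ if $\alpha\in(1,2)$, $d(-y^{-\alpha})=\alpha y^{-\alpha-1}\,dy$, and the expectation and the integral exist in the Lebesgue sense. Here $\alpha$-stable means: for independent copies $\xi,\xi'$ of $\xi_\alpha$ and all $b,c>0$ there is $v\in\mathbb R^d$ such that $b\xi+c\xi'$ has the law of $(b^\alpha+c^\alpha)^{1/\alpha}\xi+v$ (degenerate laws are included). -/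

import Mathlib

open MeasureTheory ProbabilityTheory Filter Topology Set
open scoped ENNReal BoundedContinuousFunction InnerProductSpace

namespace HeavyTail

/-- A random vector `Z` with values in a normed space is regularly varying with index `α`:
there is a probability measure `σ` on the unit sphere (the spectral measure) such that, for every
`u > 0`, the finite measures `P(|Z| > u x, Z / |Z| ∈ ·) / P(|Z| > x)` converge weakly to
`u ^ (-α) σ` as `x → ∞`. -/
def IsRegVarVector {Ω V : Type*} [MeasurableSpace Ω] [NormedAddCommGroup V] [NormedSpace ℝ V]
    [MeasurableSpace V] (P : Measure Ω) (Z : Ω → V) (α : ℝ) : Prop :=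
  ∃ σ : ProbabilityMeasure V, (σ : Measure V) (Metric.sphere (0 : V) 1)ᶜ = 0 ∧
    ∀ u : ℝ, 0 < u → ∀ f : V →ᵇ ℝ,
      Tendsto (fun x : ℝ =>
          (∫ ω in {ω | u * x < ‖Z ω‖}, f (‖Z ω‖⁻¹ • Z ω) ∂P) / P.real {ω | x < ‖Z ω‖})
        atTop (𝓝 (u ^ (-α) * ∫ v, f v ∂(σ : Measure V)))

variable {Ω Ω' : Type*} [MeasurableSpace Ω] [MeasurableSpace Ω'] {d : ℕ}

/-- Strict stationarity: the law of the whole sequence is invariant under all time shifts. -/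
def IsStrictlyStationary (P : Measure Ω) (X : ℤ → Ω → EuclideanSpace ℝ (Fin d)) : Prop :=
  ∀ h : ℤ, P.map (fun ω t => X (t + h) ω) = P.map (fun ω t => X t ω)

/-- The lagged vector `(X_1, …, X_k)`, as a vector of `(ℝ^d)^k` with the Euclidean norm. -/
noncomputable def lagged (X : ℤ → Ω → EuclideanSpace ℝ (Fin d)) (k : ℕ) (ω : Ω) :
    PiLp 2 (fun _ : Fin k => EuclideanSpace ℝ (Fin d)) :=
  WithLp.toLp 2 (fun i : Fin k => X ((i : ℕ) + 1 : ℤ) ω)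

/-- The sequence `X` is regularly varying with index `α`: every lagged vector
`(X_1, …, X_k)`, `k ≥ 1`, is. -/
def IsRegVarSequence (P : Measure Ω) (X : ℤ → Ω → EuclideanSpace ℝ (Fin d)) (α : ℝ) : Prop :=
  ∀ k : ℕ, 1 ≤ k → IsRegVarVector P (lagged X k) α

/-- `Θ` (possibly on another probability space) is a spectral tail process of `X`: for all `k`,
the conditional law of `|X_0|⁻¹ (X_{-k}, …, X_k)` given `|X_0| > x` converges weakly
to the law of `(Θ_{-k}, …, Θ_k)` as `x → ∞`. -/
def IsSpectralTailProcess (P : Measure Ω) (X : ℤ → Ω → EuclideanSpace ℝ (Fin d))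
    (P' : Measure Ω') (Θ : ℤ → Ω' → EuclideanSpace ℝ (Fin d)) : Prop :=
  ∀ (k : ℕ) (f : (Finset.Icc (-(k : ℤ)) (k : ℤ) → EuclideanSpace ℝ (Fin d)) →ᵇ ℝ),
    Tendsto (fun x : ℝ =>
        ∫ ω, f (fun t => ‖X 0 ω‖⁻¹ • X t ω) ∂(ProbabilityTheory.cond P {ω | x < ‖X 0 ω‖}))
      atTop (𝓝 (∫ ω, f (fun t => Θ t ω) ∂P'))

/-- `x 1_{|x| > c}`. -/
noncomputable def upperTrunc (c : ℝ) (x : EuclideanSpace ℝ (Fin d)) : EuclideanSpace ℝ (Fin d) :=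
  if c < ‖x‖ then x else 0

/-- `x 1_{|x| ≤ c}`. -/
noncomputable def lowerTrunc (c : ℝ) (x : EuclideanSpace ℝ (Fin d)) : EuclideanSpace ℝ (Fin d) :=
  if ‖x‖ ≤ c then x else 0

/-- `S_n = X_1 + ⋯ + X_n`. -/
noncomputable def partialSum (X : ℤ → Ω → EuclideanSpace ℝ (Fin d)) (n : ℕ) (ω : Ω) :
    EuclideanSpace ℝ (Fin d) :=
  ∑ t ∈ Finset.Icc 1 n, X (t : ℤ) ω

/-- `∑_{t=1}^j X_t 1_{|X_t| > c}`. -/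
noncomputable def upperSum (X : ℤ → Ω → EuclideanSpace ℝ (Fin d)) (c : ℝ) (j : ℕ) (ω : Ω) :
    EuclideanSpace ℝ (Fin d) :=
  ∑ t ∈ Finset.Icc 1 j, upperTrunc c (X (t : ℤ) ω)

/-- `∑_{t=1}^j X_t 1_{|X_t| ≤ c}`. -/
noncomputable def lowerSum (X : ℤ → Ω → EuclideanSpace ℝ (Fin d)) (c : ℝ) (j : ℕ) (ω : Ω) :
    EuclideanSpace ℝ (Fin d) :=
  ∑ t ∈ Finset.Icc 1 j, lowerTrunc c (X (t : ℤ) ω)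

/-- The mixing condition: for all sufficiently small truncation levels `ε > 0` and all `s`, with
`k_n = ⌊n / m_n⌋`, both sums being truncated at `ε a_n`. -/
def MixingCondition (P : Measure Ω) (X : ℤ → Ω → EuclideanSpace ℝ (Fin d))
    (a : ℕ → ℝ) (m : ℕ → ℕ) : Prop :=
  ∀ᶠ ε : ℝ in 𝓝[>] 0, ∀ s : EuclideanSpace ℝ (Fin d),
    Tendsto (fun n : ℕ =>
        (∫ ω, Complex.exp (Complex.I * (⟪s, upperSum X (ε * a n) n ω⟫_ℝ / a n : ℝ)) ∂P)
          - (∫ ω, Complex.exp (Complex.I * (⟪s, upperSum X (ε * a n) (m n) ω⟫_ℝ / a n : ℝ)) ∂P)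
              ^ (n / m n))
      atTop (𝓝 0)

/-- The anti-clustering condition at `a_n`, over blocks of length `m_n`: for all `δ > 0`,
`lim_k limsup_n P(max_{k ≤ i ≤ m_n} |X_i| > δ a_n ∣ |X_0| > δ a_n) = 0`. -/
def AntiClustering (P : Measure Ω) (X : ℤ → Ω → EuclideanSpace ℝ (Fin d))
    (a : ℕ → ℝ) (m : ℕ → ℕ) : Prop :=
  ∀ δ : ℝ, 0 < δ →
    Tendsto (fun k : ℕ => limsup (fun n : ℕ =>
        (ProbabilityTheory.cond P {ω | δ * a n < ‖X 0 ω‖})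
          {ω | ∃ i ∈ Finset.Icc k (m n), δ * a n < ‖X (i : ℤ) ω‖}) atTop)
      atTop (𝓝 (0 : ℝ≥0∞))

/-- The vanishing-small-values condition. -/
def VanishingSmallValues (P : Measure Ω) (X : ℤ → Ω → EuclideanSpace ℝ (Fin d))
    (a : ℕ → ℝ) : Prop :=
  ∀ δ : ℝ, 0 < δ →
    Tendsto (fun ε : ℝ => limsup (fun n : ℕ =>
        P {ω | δ < (a n)⁻¹ * ‖lowerSum X (ε * a n) n ω - ∫ ω', lowerSum X (ε * a n) n ω' ∂P‖})
          atTop)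
      (𝓝[>] 0) (𝓝 (0 : ℝ≥0∞))

/-- The measure `d(-y^{-α}) = α y^{-α-1} dy` on `(0, ∞)`. -/
noncomputable def powMeasure (α : ℝ) : Measure ℝ :=
  (volume.restrict (Ioi (0 : ℝ))).withDensity fun y => ENNReal.ofReal (α * y ^ (-α - 1))

/-- `exp(i y s'∑_{j ≥ 0} Θ_j) - exp(i y s'∑_{j ≥ 1} Θ_j) - i y s'A`, where `A = 0` if `α < 1` and
`A = Θ_0` otherwise. -/
noncomputable def stableIntegrand (α : ℝ) (Θ : ℤ → Ω' → EuclideanSpace ℝ (Fin d))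
    (s : EuclideanSpace ℝ (Fin d)) (y : ℝ) (ω : Ω') : ℂ :=
  Complex.exp (Complex.I * (y * ⟪s, ∑' j : ℕ, Θ (j : ℤ) ω⟫_ℝ : ℝ))
    - Complex.exp (Complex.I * (y * ⟪s, ∑' j : ℕ, Θ ((j : ℤ) + 1) ω⟫_ℝ : ℝ))
    - Complex.I * (y * ⟪s, (if α < 1 then 0 else Θ 0 ω)⟫_ℝ : ℝ)

/-- A law `ν` on `ℝ^d` is `α`-stable: for independent `ξ, ξ'` with law `ν` and `b, c > 0`,
`b ξ + c ξ'` has the law of `(b^α + c^α)^{1/α} ξ + v` for some vector `v`. -/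
def IsAlphaStable (α : ℝ) (ν : Measure (EuclideanSpace ℝ (Fin d))) : Prop :=
  ∀ b c : ℝ, 0 < b → 0 < c → ∃ v : EuclideanSpace ℝ (Fin d),
    Measure.conv (ν.map fun x => b • x) (ν.map fun x => c • x)
      = ν.map fun x => (b ^ α + c ^ α) ^ (1 / α) • x + v

end HeavyTail

/-! Write `φ_j` for the characteristic function at `s / a_n` of the sum of the first `j` terms
truncated from below at `ε a_n`. By stationarity the increment `φ_{j+1} - φ_j` is the expectation of
a "jump": the exponential of the sum over times `0, …, j` minus that over times `1, …, j`. A jump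
vanishes unless `|X_0| > ε a_n`, and anti-clustering says that, given this event, exceedances at
lags from `k` up to `m_n` are unlikely once `k` is large. Telescoping over a block therefore shows
that `k_n (φ_{m_n} - 1)` is close to `n` times the expected jump over a fixed window of `k` lags
(`AntiClustering.eventually_block_approx`).

For fixed `ε` and `k` this quantity converges. Regular variation of the radius and the spectral tail
process combine into vague convergence of `n P((X_t / a_n) ∈ ·)` to the law of `(y Θ_t)` with `y`
integrated against `d(-y^{-α})` (`tendsto_polar`, `tendsto_vague`). Test functions must be
continuous, so the sharp truncation is first replaced by a continuous one, whose width shrinks with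
`k` fast enough for the error to vanish. Mixing and `c^n ≈ exp(n (c - 1))` then turn the block
asymptotics into an exponential limit.

Finally `k → ∞` and `ε → 0` inside the exponent, by dominated convergence: the integrand is bounded
by a multiple of `y^{q+1}` near 0 and of `y^q` at infinity, with `q = 0` for `α < 1` and `q = 1` for
`α > 1` (`norm_stabInt_le`). For `q = 1` the compensator provides the second-order decay at 0; it
arises because `E X_0 = 0` makes the mean of the small values the negative of that of the large
ones. Small values are negligible by Karamata's bound when `α < 1` and by assumption when `α > 1`.
Summability of `Θ` is assumed in mean for `α > 1`; for `α < 1` it follows from a counting argument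
comparing large clusters with the total mass of a block (`measure_sum_le`).

Lévy's continuity theorem gives the limit law, and the scaling of `d(-y^{-α})` makes its exponent
homogeneous of degree `α`, hence the law stable. -/

namespace HeavyTail

/-! ### Shift invariance of integrals and probabilities. -/

section Stationarity

variable {Ω : Type*} [MeasurableSpace Ω] {d : ℕ} {P : Measure Ω}
  {X : ℤ → Ω → EuclideanSpace ℝ (Fin d)}

lemma IsStrictlyStationary.integral_shift (hstat : IsStrictlyStationary P X)
    (hX : ∀ t, Measurable (X t)) {G : Type*} [NormedAddCommGroup G] [NormedSpace ℝ G]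
    [MeasurableSpace G] [BorelSpace G] [SecondCountableTopology G]
    (h : ℤ) {F : (ℤ → EuclideanSpace ℝ (Fin d)) → G} (hF : Measurable F) :
    ∫ ω, F (fun t => X (t + h) ω) ∂P = ∫ ω, F (fun t => X t ω) ∂P := by
  have h1 : Measurable fun ω t => X (t + h) ω := measurable_pi_lambda _ fun t => hX _
  have h2 : Measurable fun ω t => X t ω := measurable_pi_lambda _ fun t => hX _
  rw [← integral_map (φ := fun ω t => X (t + h) ω) h1.aemeasurable hF.aestronglyMeasurable,
    hstat h, integral_map h2.aemeasurable hF.aestronglyMeasurable]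

lemma IsStrictlyStationary.measureReal_shift (hstat : IsStrictlyStationary P X)
    (hX : ∀ t, Measurable (X t)) (h : ℤ) {A : Set (ℤ → EuclideanSpace ℝ (Fin d))}
    (hA : MeasurableSet A) :
    P.real {ω | (fun t => X (t + h) ω) ∈ A} = P.real {ω | (fun t => X t ω) ∈ A} := by
  have h1 : Measurable fun ω t => X (t + h) ω := measurable_pi_lambda _ fun t => hX _
  have h2 : Measurable fun ω t => X t ω := measurable_pi_lambda _ fun t => hX _
  have e1 := Measure.map_apply h1 hA (μ := P)
  have e2 := Measure.map_apply h2 hA (μ := P)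
  rw [hstat h, e2] at e1
  simp only [Measure.real]
  exact congrArg ENNReal.toReal e1.symm

end Stationarity

/-! ### Regularly varying tails and the normalizing sequence. -/

section Tail

variable {Ω V : Type*} [MeasurableSpace Ω] [NormedAddCommGroup V]

/-- The tail function `x ↦ P(|Z| > x)`. -/
noncomputable def tail (P : Measure Ω) (Z : Ω → V) (x : ℝ) : ℝ := P.real {ω | x < ‖Z ω‖}

/-- The tail of `|Z|` is positive and regularly varying with index `-α`. -/
structure IsRegVarTail (P : Measure Ω) (Z : Ω → V) (α : ℝ) : Prop where
  pos : ∀ x, 0 < tail P Z x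
  tendsto_div : ∀ u : ℝ, 0 < u →
    Tendsto (fun x => tail P Z (u * x) / tail P Z x) atTop (𝓝 (u ^ (-α)))

variable {P : Measure Ω} {Z : Ω → V} {α : ℝ}

lemma tail_nonneg (x : ℝ) : 0 ≤ tail P Z x := measureReal_nonneg

variable [IsProbabilityMeasure P]

lemma tail_antitone : Antitone (tail P Z) := fun _ _ hxy =>
  measureReal_mono fun _ h => lt_of_le_of_lt hxy h

lemma IsRegVarTail.of_tendsto
    (h : ∀ u : ℝ, 0 < u →
      Tendsto (fun x => tail P Z (u * x) / tail P Z x) atTop (𝓝 (u ^ (-α)))) :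
    IsRegVarTail P Z α := by
  refine ⟨fun x => ?_, h⟩
  by_contra hx
  have h0 : ∀ y, x ≤ y → tail P Z y = 0 := fun y hy =>
    le_antisymm ((tail_antitone hy).trans (not_lt.mp hx)) (tail_nonneg y)
  -- If the tail vanished at some level, the ratio for `u = 1` would eventually be `0 / 0 = 0`
  -- instead of tending to 1.
  have h1 := h 1 one_pos
  simp only [one_mul, Real.one_rpow] at h1
  have h2 : Tendsto (fun x => tail P Z x / tail P Z x) atTop (𝓝 0) := by
    refine tendsto_const_nhds.congr' ?_
    filter_upwards [eventually_ge_atTop x] with y hy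
    simp [h0 y hy]
  exact one_ne_zero (tendsto_nhds_unique h1 h2)

namespace IsRegVarTail

variable (hG : IsRegVarTail P Z α) {a : ℕ → ℝ}
  (ha : Tendsto (fun n : ℕ => (n : ℝ) * tail P Z (a n)) atTop (𝓝 1))
include hG ha

/-- The tail at `a n` tends to 0 while the tail at any fixed level is positive, so by monotonicity
`a n` must pass every level. -/
lemma tendsto_normalization : Tendsto a atTop atTop := by
  have h0 : Tendsto (fun n => tail P Z (a n)) atTop (𝓝 0) := by
    have := ha.mul (tendsto_inv_atTop_nhds_zero_nat (𝕜 := ℝ))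
    rw [mul_zero] at this
    refine this.congr' ?_
    filter_upwards [eventually_gt_atTop 0] with n hn
    have : (n : ℝ) ≠ 0 := by positivity
    field_simp
  refine tendsto_atTop.mpr fun M => ?_
  filter_upwards [h0.eventually_lt_const (hG.pos M)] with n hn
  by_contra h
  exact absurd (tail_antitone (P := P) (Z := Z) (not_le.mp h).le) (not_le.mpr hn)

lemma tendsto_mul_tail {u : ℝ} (hu : 0 < u) :
    Tendsto (fun n : ℕ => (n : ℝ) * tail P Z (u * a n)) atTop (𝓝 (u ^ (-α))) := by
  have h := ha.mul ((hG.tendsto_div u hu).comp (hG.tendsto_normalization ha))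
  rw [one_mul] at h
  refine h.congr fun n => ?_
  have := (hG.pos (a n)).ne'
  simp only [Function.comp]
  field_simp

end IsRegVarTail

/-! ### Karamata's bounds for truncated first moments. -/

section Karamata

variable [MeasurableSpace V] [BorelSpace V] (hZ : Measurable Z) (hG : IsRegVarTail P Z α)
include hZ hG

/-- Karamata's bound for truncated means, `α < 1`. -/
lemma IsRegVarTail.exists_lower_bound (hα1 : α < 1) :
    ∃ C : ℝ, 0 ≤ C ∧ ∀ᶠ x in atTop, ∫ ω in {ω | ‖Z ω‖ ≤ x}, ‖Z ω‖ ∂P ≤ C * (x * tail P Z x) := by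
  set I : ℝ → ℝ := fun x => ∫ ω in {ω | ‖Z ω‖ ≤ x}, ‖Z ω‖ ∂P with hI
  have hms : ∀ x, MeasurableSet {ω | ‖Z ω‖ ≤ x} := fun x => measurableSet_le hZ.norm measurable_const
  have hms' : ∀ x, MeasurableSet {ω | x < ‖Z ω‖} := fun x => measurableSet_lt measurable_const hZ.norm
  have hint : ∀ x, IntegrableOn (fun ω => ‖Z ω‖) {ω | ‖Z ω‖ ≤ x} P := fun x => by
    refine Measure.integrableOn_of_bounded (measure_ne_top _ _) hZ.norm.aestronglyMeasurable
      (M := x) ?_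
    filter_upwards [ae_restrict_mem (hms x)] with ω hω
    simpa using hω
  have hIx : ∀ x, 0 ≤ x → I x ≤ x := fun x hx => by
    calc I x ≤ ∫ ω in {ω | ‖Z ω‖ ≤ x}, x ∂P :=
          setIntegral_mono_on (hint x) (integrable_const _) (hms x) fun ω hω => hω
      _ = P.real {ω | ‖Z ω‖ ≤ x} * x := by simp
      _ ≤ 1 * x := by gcongr; exact measureReal_le_one
      _ = x := one_mul x
  have hstep : ∀ x, 0 ≤ x → I x ≤ I (x / 2) + x * tail P Z (x / 2) := fun x hx => by
    have hd : {ω | ‖Z ω‖ ≤ x} = {ω | ‖Z ω‖ ≤ x / 2} ∪ {ω | x / 2 < ‖Z ω‖ ∧ ‖Z ω‖ ≤ x} := by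
      ext ω
      simp only [mem_ofPred_eq, mem_union]
      constructor
      · intro h
        rcases le_or_gt ‖Z ω‖ (x / 2) with h' | h'
        · exact Or.inl h'
        · exact Or.inr ⟨h', h⟩
      · rintro (h | h)
        · linarith
        · exact h.2
    have hms2 : MeasurableSet {ω | x / 2 < ‖Z ω‖ ∧ ‖Z ω‖ ≤ x} := (hms' _).inter (hms x)
    have hdisj : Disjoint {ω | ‖Z ω‖ ≤ x / 2} {ω | x / 2 < ‖Z ω‖ ∧ ‖Z ω‖ ≤ x} :=
      disjoint_left.mpr fun ω h1 h2 => absurd h1 (not_le.mpr h2.1)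
    have hi2 : IntegrableOn (fun ω => ‖Z ω‖) {ω | x / 2 < ‖Z ω‖ ∧ ‖Z ω‖ ≤ x} P :=
      (hint x).mono_set fun ω h => h.2
    simp only [hI]
    rw [hd, setIntegral_union hdisj hms2 (hint _) hi2]
    gcongr
    calc _ ≤ ∫ ω in {ω | x / 2 < ‖Z ω‖ ∧ ‖Z ω‖ ≤ x}, x ∂P :=
          setIntegral_mono_on hi2 (integrable_const _) hms2 fun ω hω => hω.2
      _ = x * P.real {ω | x / 2 < ‖Z ω‖ ∧ ‖Z ω‖ ≤ x} := by simp [mul_comm]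
      _ ≤ x * tail P Z (x / 2) := by
          gcongr
          exact measureReal_mono fun ω h => h.1
  -- Since `α < 1`, halving the level multiplies the tail by about `2 ^ α < 2`. Any `q` in between
  -- makes the recursion `hstep` a contraction with factor `q / 2`.
  obtain ⟨q, hq1, hq2⟩ : ∃ q : ℝ, (1 / 2 : ℝ) ^ (-α) < q ∧ q < 2 := by
    refine exists_between ?_
    rw [one_div, Real.inv_rpow (by norm_num), Real.rpow_neg (by norm_num), inv_inv]
    calc (2 : ℝ) ^ α < 2 ^ (1 : ℝ) := Real.rpow_lt_rpow_of_exponent_lt (by norm_num) hα1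
      _ = 2 := Real.rpow_one 2
  have hq0 : 0 < q := lt_trans (by positivity) hq1
  obtain ⟨x0, hx0⟩ := eventually_atTop.mp
    (((hG.tendsto_div (1 / 2) (by norm_num)).eventually_lt_const hq1).and (eventually_gt_atTop 0))
  have hx0p : 0 < x0 := (hx0 x0 le_rfl).2
  have hq : ∀ x, x0 ≤ x → tail P Z (x / 2) ≤ q * tail P Z x := fun x hx => by
    have := (hx0 x hx).1
    rw [div_lt_iff₀ (hG.pos x)] at this
    rw [show x / 2 = 1 / 2 * x by ring]
    exact this.le
  -- The first entry makes `C` stable under the recursion (`hC1`); the second covers the base range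
  -- `[x0 / 2, x0]`, where the trivial bound `I x ≤ x0` is used.
  set C : ℝ := max (q / (1 - q / 2)) (x0 / (x0 / 2 * tail P Z x0)) with hC
  have hC0 : 0 ≤ C := le_max_of_le_right (div_nonneg hx0p.le (by
    have := tail_nonneg (P := P) (Z := Z) x0
    positivity))
  have hC1 : C * (q / 2) + q ≤ C := by
    have : q / (1 - q / 2) ≤ C := le_max_left _ _
    rw [div_le_iff₀ (by linarith)] at this
    linarith
  -- The range starts at `x0 / 2` so that halving a point above `x0` stays inside it.
  have key : ∀ k : ℕ, ∀ x, x0 / 2 ≤ x → x ≤ x0 * 2 ^ k → I x ≤ C * (x * tail P Z x) := by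
    intro k
    induction k with
    | zero =>
      intro x hx1 hx2
      simp only [pow_zero, mul_one] at hx2
      calc I x ≤ x := hIx x (by linarith)
        _ ≤ x0 := hx2
        _ = x0 / (x0 / 2 * tail P Z x0) * (x0 / 2 * tail P Z x0) := by
          have := (hG.pos x0).ne'
          field_simp
        _ ≤ C * (x * tail P Z x) := by
          have := tail_antitone (P := P) (Z := Z) hx2
          have := tail_nonneg (P := P) (Z := Z) x0
          have : 0 ≤ x := by linarith
          gcongr
          exact le_max_right _ _
    | succ k ih =>
      intro x hx1 hx2
      rcases le_or_gt x x0 with h | h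
      · exact ih x hx1 (h.trans (le_mul_of_one_le_right hx0p.le (one_le_pow₀ (by norm_num))))
      · have hx : 0 ≤ x := by linarith
        have h1 := ih (x / 2) (by linarith) (by rw [pow_succ] at hx2; linarith)
        have h2 := hq x h.le
        have h3 := tail_nonneg (P := P) (Z := Z) x
        calc I x ≤ I (x / 2) + x * tail P Z (x / 2) := hstep x hx
          _ ≤ C * (x / 2 * tail P Z (x / 2)) + x * tail P Z (x / 2) := by gcongr
          _ ≤ C * (x / 2 * (q * tail P Z x)) + x * (q * tail P Z x) := by gcongr
          _ = (C * (q / 2) + q) * (x * tail P Z x) := by ring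
          _ ≤ C * (x * tail P Z x) := by gcongr
  refine ⟨C, hC0, ?_⟩
  filter_upwards [eventually_ge_atTop x0] with x hx
  obtain ⟨k, hk⟩ := pow_unbounded_of_one_lt (x / x0) (one_lt_two (α := ℝ))
  refine key k x (by linarith) ?_
  rw [div_lt_iff₀ hx0p] at hk
  linarith

/-- Karamata's bound for tail means, `α > 1`. -/
lemma IsRegVarTail.exists_upper_lbound (hα1 : 1 < α) :
    ∃ C : ℝ, 0 ≤ C ∧ ∀ᶠ x in atTop,
      ∫⁻ ω in {ω | x < ‖Z ω‖}, ENNReal.ofReal ‖Z ω‖ ∂P ≤ ENNReal.ofReal (C * (x * tail P Z x)) := by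
  have hms' : ∀ x, MeasurableSet {ω | x < ‖Z ω‖} := fun x => measurableSet_lt measurable_const hZ.norm
  -- Here doubling the level multiplies the tail by about `2 ^ (-α) < 1 / 2`, so the dyadic shells
  -- above `x` contribute a geometric series of ratio `2 * q < 1`.
  obtain ⟨q, hq1, hq2⟩ : ∃ q : ℝ, (2 : ℝ) ^ (-α) < q ∧ q < 1 / 2 := by
    refine exists_between ?_
    calc (2 : ℝ) ^ (-α) < 2 ^ (-1 : ℝ) := Real.rpow_lt_rpow_of_exponent_lt (by norm_num) (by linarith)
      _ = 1 / 2 := by rw [Real.rpow_neg_one]; norm_num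
  have hq0 : 0 < q := lt_trans (by positivity) hq1
  obtain ⟨x0, hx0⟩ := eventually_atTop.mp
    (((hG.tendsto_div 2 (by norm_num)).eventually_lt_const hq1).and (eventually_gt_atTop 0))
  have hq : ∀ x, x0 ≤ x → tail P Z (2 * x) ≤ q * tail P Z x := fun x hx => by
    have := (hx0 x hx).1
    rw [div_lt_iff₀ (hG.pos x)] at this
    exact this.le
  have hqk : ∀ k : ℕ, ∀ x, x0 ≤ x → tail P Z (2 ^ k * x) ≤ q ^ k * tail P Z x := by
    intro k
    induction k with
    | zero => intro x _; simp
    | succ k ih =>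
      intro x hx
      have hxp := (hx0 x hx).2
      have h1 := ih (2 * x) (by linarith)
      have h2 := hq x hx
      calc tail P Z (2 ^ (k + 1) * x) = tail P Z (2 ^ k * (2 * x)) := by ring_nf
        _ ≤ q ^ k * tail P Z (2 * x) := h1
        _ ≤ q ^ k * (q * tail P Z x) := by gcongr
        _ = _ := by ring
  have hs : Summable fun k : ℕ => (2 * q) ^ k :=
    summable_geometric_of_lt_one (by linarith) (by linarith)
  refine ⟨2 * ∑' k : ℕ, (2 * q) ^ k, by positivity, ?_⟩
  filter_upwards [eventually_ge_atTop x0] with x hx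
  have hxp := (hx0 x hx).2
  have hpt : ∀ ω, ({ω | x < ‖Z ω‖}.indicator (fun ω => ENNReal.ofReal ‖Z ω‖) ω) ≤
      ∑' k : ℕ, {ω | 2 ^ k * x < ‖Z ω‖}.indicator
        (fun _ => ENNReal.ofReal (2 ^ (k + 1) * x)) ω := by
    intro ω
    by_cases h : x < ‖Z ω‖
    · have hex : ∃ k : ℕ, ‖Z ω‖ ≤ 2 ^ (k + 1) * x := by
        obtain ⟨k, hk⟩ := pow_unbounded_of_one_lt (‖Z ω‖ / x) (one_lt_two (α := ℝ))
        rw [div_lt_iff₀ hxp] at hk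
        exact ⟨k, by rw [pow_succ]; nlinarith [norm_nonneg (Z ω)]⟩
      classical
      have hk1 := Nat.find_spec hex
      have hk2 : 2 ^ (Nat.find hex) * x < ‖Z ω‖ := by
        rcases Nat.eq_zero_or_pos (Nat.find hex) with h0 | h0
        · rw [h0]; simpa using h
        · have := Nat.find_min hex (Nat.pred_lt h0.ne')
          rw [show (Nat.find hex).pred + 1 = Nat.find hex from Nat.succ_pred_eq_of_pos h0] at this
          exact not_le.mp this
      refine le_trans ?_ (ENNReal.le_tsum (Nat.find hex))
      rw [indicator_of_mem (by exact h), indicator_of_mem (by exact hk2)]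
      exact ENNReal.ofReal_le_ofReal hk1
    · rw [indicator_of_notMem (by exact h)]
      exact zero_le
  rw [← lintegral_indicator (hms' x)]
  calc _ ≤ ∫⁻ ω, ∑' k : ℕ, {ω | 2 ^ k * x < ‖Z ω‖}.indicator
        (fun _ => ENNReal.ofReal (2 ^ (k + 1) * x)) ω ∂P := lintegral_mono hpt
    _ = ∑' k : ℕ, ENNReal.ofReal (2 ^ (k + 1) * x) * P {ω | 2 ^ k * x < ‖Z ω‖} := by
        rw [lintegral_tsum fun k => (measurable_const.indicator (hms' _)).aemeasurable]
        congr with k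
        rw [lintegral_indicator_const (hms' _)]
    _ ≤ ∑' k : ℕ, ENNReal.ofReal (2 * (x * tail P Z x) * (2 * q) ^ k) := by
        refine ENNReal.tsum_le_tsum fun k => ?_
        have e : P {ω | 2 ^ k * x < ‖Z ω‖} = ENNReal.ofReal (tail P Z (2 ^ k * x)) := by
          rw [tail, Measure.real, ENNReal.ofReal_toReal (measure_ne_top _ _)]
        rw [e, ← ENNReal.ofReal_mul (by positivity)]
        refine ENNReal.ofReal_le_ofReal ?_
        calc 2 ^ (k + 1) * x * tail P Z (2 ^ k * x) ≤ 2 ^ (k + 1) * x * (q ^ k * tail P Z x) := by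
              gcongr
              exact hqk k x hx
          _ = _ := by rw [mul_pow]; ring
    _ = ENNReal.ofReal (2 * (∑' k : ℕ, (2 * q) ^ k) * (x * tail P Z x)) := by
        have h3 := tail_nonneg (P := P) (Z := Z) x
        rw [← ENNReal.ofReal_tsum_of_nonneg (fun k => by positivity) (hs.mul_left _), tsum_mul_left]
        congr 1
        ring

lemma IsRegVarTail.integrable (hα1 : 1 < α) : Integrable (fun ω => ‖Z ω‖) P := by
  obtain ⟨C, -, hC⟩ := hG.exists_upper_lbound hZ hα1
  obtain ⟨x, hx, hx0⟩ := (hC.and (eventually_ge_atTop 0)).exists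
  refine ⟨hZ.norm.aestronglyMeasurable, ?_⟩
  rw [hasFiniteIntegral_iff_norm]
  have hpt : ∀ ω, ENNReal.ofReal ‖‖Z ω‖‖ ≤
      {ω | x < ‖Z ω‖}.indicator (fun ω => ENNReal.ofReal ‖Z ω‖) ω + ENNReal.ofReal x := by
    intro ω
    rw [norm_norm]
    by_cases h : x < ‖Z ω‖
    · rw [indicator_of_mem (by exact h)]; exact le_self_add
    · rw [indicator_of_notMem (by exact h), zero_add]
      exact ENNReal.ofReal_le_ofReal (not_lt.mp h)
  refine (lintegral_mono hpt).trans_lt ?_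
  rw [lintegral_add_right _ measurable_const,
    lintegral_indicator (measurableSet_lt measurable_const hZ.norm)]
  refine ENNReal.add_lt_top.mpr ⟨hx.trans_lt ENNReal.ofReal_lt_top, by simp⟩

/-- Bochner form of the tail bound; the version for `∫⁻` had to come first because it is the source
of the integrability. -/
lemma IsRegVarTail.exists_upper_bound (hα1 : 1 < α) :
    ∃ C : ℝ, 0 ≤ C ∧ ∀ᶠ x in atTop,
      ∫ ω in {ω | x < ‖Z ω‖}, ‖Z ω‖ ∂P ≤ C * (x * tail P Z x) := by
  obtain ⟨C, hC0, hC⟩ := hG.exists_upper_lbound hZ hα1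
  refine ⟨C, hC0, ?_⟩
  filter_upwards [hC, eventually_ge_atTop 0] with x hx hx0
  have h3 := tail_nonneg (P := P) (Z := Z) x
  rw [integral_eq_lintegral_of_nonneg_ae (ae_of_all _ fun _ => norm_nonneg _)
    hZ.norm.aestronglyMeasurable]
  exact ENNReal.toReal_le_of_le_ofReal (by positivity) hx

/-- `n E(|Z| 1{|Z| ≤ ε a_n}) / a_n` is at most of order `ε ^ (1 - α)` for `α < 1`. -/
lemma IsRegVarTail.exists_lower_bound_scaled (hα1 : α < 1) {a : ℕ → ℝ}
    (ha : Tendsto (fun n : ℕ => (n : ℝ) * tail P Z (a n)) atTop (𝓝 1)) :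
    ∃ C : ℝ, 0 ≤ C ∧ ∀ ε : ℝ, 0 < ε → ∀ᶠ n : ℕ in atTop,
      n * ((a n)⁻¹ * ∫ ω in {ω | ‖Z ω‖ ≤ ε * a n}, ‖Z ω‖ ∂P) ≤ C * ε ^ (1 - α) := by
  obtain ⟨C, hC0, hC⟩ := hG.exists_lower_bound hZ hα1
  refine ⟨C * 2, by positivity, fun ε hε => ?_⟩
  have hat := hG.tendsto_normalization ha
  have h2 : ε ^ (-α) < 2 * ε ^ (-α) := by
    have : 0 < ε ^ (-α) := by positivity
    linarith
  filter_upwards [(hat.const_mul_atTop hε).eventually hC, hat.eventually_gt_atTop 0,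
    (hG.tendsto_mul_tail ha hε).eventually_lt_const h2] with n h1 h3 h4
  calc n * ((a n)⁻¹ * ∫ ω in {ω | ‖Z ω‖ ≤ ε * a n}, ‖Z ω‖ ∂P)
      ≤ n * ((a n)⁻¹ * (C * (ε * a n * tail P Z (ε * a n)))) := by gcongr
    _ = C * ε * (n * tail P Z (ε * a n)) := by field_simp
    _ ≤ C * ε * (2 * ε ^ (-α)) := by gcongr
    _ = C * 2 * ε ^ (1 - α) := by
      rw [sub_eq_add_neg, Real.rpow_add hε, Real.rpow_one]; ring

/-- `n E(|Z| 1{|Z| > M a_n}) / a_n` is at most of order `M ^ (1 - α)` for `α > 1`. -/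
lemma IsRegVarTail.exists_upper_bound_scaled (hα1 : 1 < α) {a : ℕ → ℝ}
    (ha : Tendsto (fun n : ℕ => (n : ℝ) * tail P Z (a n)) atTop (𝓝 1)) :
    ∃ C : ℝ, 0 ≤ C ∧ ∀ ε : ℝ, 0 < ε → ∀ᶠ n : ℕ in atTop,
      n * ((a n)⁻¹ * ∫ ω in {ω | ε * a n < ‖Z ω‖}, ‖Z ω‖ ∂P) ≤ C * ε ^ (1 - α) := by
  obtain ⟨C, hC0, hC⟩ := hG.exists_upper_bound hZ hα1
  refine ⟨C * 2, by positivity, fun ε hε => ?_⟩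
  have hat := hG.tendsto_normalization ha
  have h2 : ε ^ (-α) < 2 * ε ^ (-α) := by
    have : 0 < ε ^ (-α) := by positivity
    linarith
  filter_upwards [(hat.const_mul_atTop hε).eventually hC, hat.eventually_gt_atTop 0,
    (hG.tendsto_mul_tail ha hε).eventually_lt_const h2] with n h1 h3 h4
  calc n * ((a n)⁻¹ * ∫ ω in {ω | ε * a n < ‖Z ω‖}, ‖Z ω‖ ∂P)
      ≤ n * ((a n)⁻¹ * (C * (ε * a n * tail P Z (ε * a n)))) := by gcongr
    _ = C * ε * (n * tail P Z (ε * a n)) := by field_simp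
    _ ≤ C * ε * (2 * ε ^ (-α)) := by gcongr
    _ = C * 2 * ε ^ (1 - α) := by
      rw [sub_eq_add_neg, Real.rpow_add hε, Real.rpow_one]; ring

end Karamata

end Tail

/-! ### The tail of a single coordinate. -/

section TailOfSequence

variable {Ω : Type*} [MeasurableSpace Ω] {d : ℕ} {P : Measure Ω}
  {X : ℤ → Ω → EuclideanSpace ℝ (Fin d)} {α : ℝ}

lemma IsStrictlyStationary.tail_eq (hstat : IsStrictlyStationary P X)
    (hX : ∀ t, Measurable (X t)) (h : ℤ) (x : ℝ) : tail P (X h) x = tail P (X 0) x := by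
  have hA : MeasurableSet {z : ℤ → EuclideanSpace ℝ (Fin d) | x < ‖z 0‖} :=
    measurableSet_lt measurable_const (measurable_pi_apply 0).norm
  simpa [tail] using hstat.measureReal_shift hX h hA

variable [IsProbabilityMeasure P]

/-- Only the radial part of the hypothesis at `k = 1` enters: testing against the constant 1 removes
the spectral measure, and stationarity replaces `X 1` by `X 0`. -/
lemma IsRegVarSequence.isRegVarTail (hRV : IsRegVarSequence P X α)
    (hstat : IsStrictlyStationary P X) (hX : ∀ t, Measurable (X t)) :
    IsRegVarTail P (X 0) α := by
  refine .of_tendsto fun u hu => ?_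
  obtain ⟨σ, -, h⟩ := hRV 1 le_rfl
  have h1 := h u hu (BoundedContinuousFunction.const _ 1)
  have e : ∀ ω, ‖lagged X 1 ω‖ = ‖X 1 ω‖ := fun ω => by
    simp [lagged, PiLp.norm_eq_of_L2]
  simp only [e, BoundedContinuousFunction.const_apply, integral_const, smul_eq_mul, mul_one,
    measureReal_restrict_apply_univ, probReal_univ] at h1
  refine h1.congr fun x => ?_
  change tail P (X 1) (u * x) / tail P (X 1) x = _
  rw [hstat.tail_eq hX 1, hstat.tail_eq hX 1]

end TailOfSequence

/-! ### The measure `d(-y^{-α})`: values, scaling, dominating functions. -/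

section PowMeasure

variable {α : ℝ}

instance : SFinite (powMeasure α) := by unfold powMeasure; infer_instance

lemma powMeasure_Ioi (hα : 0 < α) {u : ℝ} (hu : 0 < u) :
    powMeasure α (Ioi u) = ENNReal.ofReal (u ^ (-α)) := by
  rw [powMeasure, withDensity_apply _ measurableSet_Ioi,
    Measure.restrict_restrict measurableSet_Ioi,
    inter_eq_left.mpr (Ioi_subset_Ioi hu.le),
    ← ofReal_integral_eq_lintegral_ofReal]
  · rw [integral_const_mul, integral_Ioi_rpow_of_lt (by linarith) hu]
    congr 1
    rw [show -α - 1 + 1 = -α by ring]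
    field_simp
  · exact (integrableOn_Ioi_rpow_of_lt (by linarith) hu).const_mul α
  · filter_upwards [ae_restrict_mem measurableSet_Ioi] with y hy
    have : 0 < y := hu.trans hy
    simp only [Pi.zero_apply]
    positivity

lemma powMeasure_real_Ioi (hα : 0 < α) {u : ℝ} (hu : 0 < u) :
    (powMeasure α).real (Ioi u) = u ^ (-α) := by
  rw [Measure.real, powMeasure_Ioi hα hu, ENNReal.toReal_ofReal (by positivity)]

lemma ae_powMeasure_pos : ∀ᵐ y ∂(powMeasure α), 0 < y :=
  (withDensity_absolutelyContinuous _ _).ae_le (ae_restrict_mem measurableSet_Ioi)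

lemma measurable_powMeasure_density :
    Measurable fun y : ℝ => (α * y ^ (-α - 1)).toNNReal := by fun_prop

lemma integral_powMeasure {G : Type*} [NormedAddCommGroup G] [NormedSpace ℝ G] (hα : 0 < α)
    (f : ℝ → G) :
    ∫ y, f y ∂(powMeasure α) = ∫ y in Ioi (0 : ℝ), (α * y ^ (-α - 1)) • f y := by
  have h := integral_withDensity_eq_integral_smul (μ := volume.restrict (Ioi (0 : ℝ)))
    (measurable_powMeasure_density (α := α)) f
  refine Eq.trans h (setIntegral_congr_fun measurableSet_Ioi fun y hy => ?_)
  have hy : 0 < y := hy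
  simp only [NNReal.smul_def]
  rw [Real.coe_toNNReal _ (by positivity)]

lemma integrable_powMeasure_iff {G : Type*} [NormedAddCommGroup G] [NormedSpace ℝ G] (hα : 0 < α)
    {f : ℝ → G} :
    Integrable f (powMeasure α) ↔
      IntegrableOn (fun y => (α * y ^ (-α - 1)) • f y) (Ioi (0 : ℝ)) := by
  have h := integrable_withDensity_iff_integrable_smul (μ := volume.restrict (Ioi (0 : ℝ)))
    (measurable_powMeasure_density (α := α)) (g := f)
  refine Iff.trans h (integrableOn_congr_fun (fun y hy => ?_) measurableSet_Ioi)
  have hy : 0 < y := hy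
  simp only [NNReal.smul_def]
  rw [Real.coe_toNNReal _ (by positivity)]

/-- The density is homogeneous of degree `-α - 1`. This scaling is what makes the limit law stable.
-/
lemma integral_powMeasure_comp_mul {G : Type*} [NormedAddCommGroup G] [NormedSpace ℝ G]
    (hα : 0 < α) (f : ℝ → G) {b : ℝ} (hb : 0 < b) :
    ∫ y, f (b * y) ∂(powMeasure α) = b ^ α • ∫ y, f y ∂(powMeasure α) := by
  rw [integral_powMeasure hα, integral_powMeasure hα]
  have h := integral_comp_mul_left_Ioi (fun y => (α * y ^ (-α - 1)) • f y) 0 hb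
  rw [mul_zero] at h
  have e : b ^ α = b ^ (α + 1) * b⁻¹ := by
    rw [Real.rpow_add hb, Real.rpow_one]; field_simp
  rw [e, mul_smul, ← h, ← integral_smul]
  refine setIntegral_congr_fun measurableSet_Ioi fun y hy => ?_
  have hy : 0 < y := hy
  simp only [smul_smul]
  congr 1
  rw [Real.mul_rpow hb.le hy.le]
  have : b ^ (α + 1) * b ^ (-α - 1) = 1 := by
    rw [← Real.rpow_add hb]; simp
  linear_combination (- α * y ^ (-α - 1)) * this

/-- The dominating function `y ^ (q + 1)` on `(0, 1]`, `y ^ q` on `(1, ∞)`. -/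
noncomputable def powDom (q : ℕ) (y : ℝ) : ℝ := if y ≤ 1 then y ^ (q + 1) else y ^ q

/-- Against the density the two powers become `y ^ (q - α)` on `(0, 1]` and `y ^ (q - α - 1)`
beyond, integrable precisely for `q < α < q + 1`. Hence order 0 for `α < 1` and order 1 for `α > 1`.
-/
lemma integrable_powDom (hα : 0 < α) {q : ℕ} (h1 : (q : ℝ) < α) (h2 : α < q + 1) :
    Integrable (powDom q) (powMeasure α) := by
  rw [integrable_powMeasure_iff hα, ← Ioc_union_Ioi_eq_Ioi (zero_le_one (α := ℝ))]
  refine IntegrableOn.union ?_ ?_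
  · have h : IntegrableOn (fun y : ℝ => α * y ^ (q - α : ℝ)) (Ioc 0 1) := by
      refine Integrable.const_mul ?_ _
      exact (intervalIntegral.intervalIntegrable_rpow' (by linarith)).1
    refine h.congr_fun (fun y hy => ?_) measurableSet_Ioc
    have hy0 := hy.1
    simp only [powDom, if_pos hy.2, smul_eq_mul]
    rw [← Real.rpow_natCast y (q + 1), mul_assoc, ← Real.rpow_add hy0]
    push_cast
    ring_nf
  · have h : IntegrableOn (fun y : ℝ => α * y ^ (q - α - 1 : ℝ)) (Ioi 1) :=
      (integrableOn_Ioi_rpow_of_lt (by linarith) one_pos).const_mul α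
    refine h.congr_fun (fun y hy => ?_) measurableSet_Ioi
    have hy0 : 0 < y := lt_trans one_pos hy
    simp only [powDom, if_neg (not_le.mpr (show 1 < y from hy)), smul_eq_mul]
    rw [← Real.rpow_natCast y q, mul_assoc, ← Real.rpow_add hy0]
    ring_nf

lemma powMeasure_Ioi_ne_zero (hα : 0 < α) {u : ℝ} (hu : 0 < u) : powMeasure α (Ioi u) ≠ 0 := by
  rw [powMeasure_Ioi hα hu]
  have : 0 < u ^ (-α) := by positivity
  simpa using this

lemma powMeasure_Ioi_ne_top (hα : 0 < α) {u : ℝ} (hu : 0 < u) : powMeasure α (Ioi u) ≠ ∞ := by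
  rw [powMeasure_Ioi hα hu]
  exact ENNReal.ofReal_ne_top

end PowMeasure

lemma integral_cond_eq {Ω G : Type*} [MeasurableSpace Ω] [NormedAddCommGroup G] [NormedSpace ℝ G]
    (P : Measure Ω) (A : Set Ω) (f : Ω → G) :
    ∫ ω, f ω ∂(ProbabilityTheory.cond P A) = (P.real A)⁻¹ • ∫ ω in A, f ω ∂P := by
  rw [ProbabilityTheory.cond, integral_smul_measure, ENNReal.toReal_inv, Measure.real]

/-! ### Joint convergence of the radius and the spectral components. -/

section TailProcess

variable {Ω Ω' : Type*} [MeasurableSpace Ω] [MeasurableSpace Ω'] {d : ℕ}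
  {P : Measure Ω} [IsProbabilityMeasure P] {P' : Measure Ω'} [IsProbabilityMeasure P']
  {X : ℤ → Ω → EuclideanSpace ℝ (Fin d)} {Θ : ℤ → Ω' → EuclideanSpace ℝ (Fin d)} {α : ℝ}

lemma tail_eq_zero_iff_measure {V : Type*} [NormedAddCommGroup V] {Z : Ω → V} (x : ℝ) :
    P {ω | x < ‖Z ω‖} = ENNReal.ofReal (tail P Z x) := by
  rw [tail, Measure.real, ENNReal.ofReal_toReal (measure_ne_top _ _)]

/-- Joint weak convergence of `|X_0| / b_n` and `X / |X_0|` given `|X_0| > ε b_n`. -/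
lemma IsSpectralTailProcess.tendsto_polar (hspec : IsSpectralTailProcess P X P' Θ)
    (hX : ∀ t, Measurable (X t)) (hΘ : ∀ t, Measurable (Θ t)) (hα : 0 < α)
    (hG : IsRegVarTail P (X 0) α) {b : ℕ → ℝ} (hb : Tendsto b atTop atTop) (k : ℕ)
    {ε : ℝ} (hε : 0 < ε)
    (f : ℝ × (Finset.Icc (-(k : ℤ)) (k : ℤ) → EuclideanSpace ℝ (Fin d)) →ᵇ ℝ) :
    Tendsto (fun n : ℕ => (tail P (X 0) (ε * b n))⁻¹ *
        ∫ ω in {ω | ε * b n < ‖X 0 ω‖}, f ((b n)⁻¹ * ‖X 0 ω‖, fun t => ‖X 0 ω‖⁻¹ • X t ω) ∂P)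
      atTop (𝓝 ((ε ^ (-α))⁻¹ *
        ∫ y in Ioi ε, ∫ ω, f (y, fun t => Θ t ω) ∂P' ∂(powMeasure α))) := by
  set T := Finset.Icc (-(k : ℤ)) (k : ℤ) → EuclideanSpace ℝ (Fin d)
  have hmsA : ∀ x, MeasurableSet {ω | x < ‖X 0 ω‖} := fun x =>
    measurableSet_lt measurable_const (hX 0).norm
  have hA0 : ∀ x, P {ω | x < ‖X 0 ω‖} ≠ 0 := fun x => by
    rw [tail_eq_zero_iff_measure]; simpa using hG.pos x
  have hc : ∀ x, IsProbabilityMeasure (ProbabilityTheory.cond P {ω | x < ‖X 0 ω‖}) := fun x =>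
    cond_isProbabilityMeasure (hA0 x)
  have hθ : Measurable fun ω => (fun t => ‖X 0 ω‖⁻¹ • X t ω : T) :=
    measurable_pi_lambda _ fun t => (hX 0).norm.inv.smul (hX t)
  have hΘm : Measurable fun ω => (fun t => Θ t ω : T) := measurable_pi_lambda _ fun t => hΘ t
  have hpm : ∀ n, Measurable fun ω => ((b n)⁻¹ * ‖X 0 ω‖, (fun t => ‖X 0 ω‖⁻¹ • X t ω : T)) :=
    fun n => ((hX 0).norm.const_mul _).prodMk hθ
  -- laws of the spectral components
  let σ : ℝ → ProbabilityMeasure T := fun x =>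
    ⟨(ProbabilityTheory.cond P {ω | x < ‖X 0 ω‖}).map fun ω => (fun t => ‖X 0 ω‖⁻¹ • X t ω : T),
      Measure.isProbabilityMeasure_map hθ.aemeasurable⟩
  let σ' : ProbabilityMeasure T := ⟨P'.map fun ω => (fun t => Θ t ω : T),
    Measure.isProbabilityMeasure_map hΘm.aemeasurable⟩
  have hσ : Tendsto σ atTop (𝓝 σ') := by
    rw [ProbabilityMeasure.tendsto_iff_forall_integral_tendsto]
    intro g
    have h := hspec k g
    simp only [σ, σ', ProbabilityMeasure.coe_mk]
    rw [integral_map hΘm.aemeasurable g.continuous.aestronglyMeasurable]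
    refine h.congr fun x => ?_
    rw [integral_map hθ.aemeasurable g.continuous.aestronglyMeasurable]
  -- joint laws
  let μ : ℕ → ProbabilityMeasure (ℝ × T) := fun n =>
    ⟨(ProbabilityTheory.cond P {ω | ε * b n < ‖X 0 ω‖}).map
      fun ω => ((b n)⁻¹ * ‖X 0 ω‖, (fun t => ‖X 0 ω‖⁻¹ • X t ω : T)),
      Measure.isProbabilityMeasure_map (hpm n).aemeasurable⟩
  have hcp : IsProbabilityMeasure (ProbabilityTheory.cond (powMeasure α) (Ioi ε)) :=
    cond_isProbabilityMeasure_of_finite (powMeasure_Ioi_ne_zero hα hε) (powMeasure_Ioi_ne_top hα hε)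
  let ν : ProbabilityMeasure (ℝ × T) :=
    ⟨(ProbabilityTheory.cond (powMeasure α) (Ioi ε)).prod (σ' : Measure T), inferInstance⟩
  -- The candidate limit is a product: a Pareto law on `(ε, ∞)` times the law of the spectral tail
  -- process.
  have hνval : ∀ (u : ℝ) (B : Set T), (ν : Measure (ℝ × T)).real (Ioi u ×ˢ B)
      = (max u ε) ^ (-α) / ε ^ (-α) * (σ' : Measure T).real B := by
    intro u B
    have e : (ProbabilityTheory.cond (powMeasure α) (Ioi ε)).real (Ioi u)
        = (max u ε) ^ (-α) / ε ^ (-α) := by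
      rw [Measure.real, cond_apply measurableSet_Ioi, Ioi_inter_Ioi, ENNReal.toReal_mul,
        ENNReal.toReal_inv]
      change ((powMeasure α).real _)⁻¹ * (powMeasure α).real _ = _
      have h2 : ε ⊔ u = max u ε := max_comm _ _
      rw [h2, powMeasure_real_Ioi hα hε, powMeasure_real_Ioi hα (lt_max_of_lt_right hε)]
      ring
    rw [← e]
    exact measureReal_prod_prod (μ := ProbabilityTheory.cond (powMeasure α) (Ioi ε)) _ _
  -- Exceeding both `u b_n` and `ε b_n` means exceeding `v b_n` with `v = max u ε`. The probability
  -- of the rectangle thus factors into a ratio of tails and a spectral probability conditioned at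
  -- level `v b_n`, and each factor converges; asymptotic independence comes for free.
  have hlim : ∀ (u : ℝ) (B : Set T), MeasurableSet B → (σ' : Measure T) (frontier B) = 0 →
      Tendsto (fun n => (μ n : Measure (ℝ × T)).real (Ioi u ×ˢ B)) atTop
        (𝓝 ((ν : Measure (ℝ × T)).real (Ioi u ×ˢ B))) := by
    intro u B hB hfr
    set v := max u ε with hv
    have hvp : 0 < v := lt_max_of_lt_right hε
    have hvb : Tendsto (fun n => v * b n) atTop atTop := hb.const_mul_atTop hvp
    have h1 : Tendsto (fun n => (σ (v * b n) : Measure T).real B) atTop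
        (𝓝 ((σ' : Measure T).real B)) := by
      have := ProbabilityMeasure.tendsto_measure_of_null_frontier_of_tendsto' (hσ.comp hvb) hfr
      exact (ENNReal.tendsto_toReal (measure_ne_top _ _)).comp this
    have h2 : Tendsto (fun n => tail P (X 0) (v * b n) / tail P (X 0) (ε * b n)) atTop
        (𝓝 (v ^ (-α) / ε ^ (-α))) := by
      have := ((hG.tendsto_div v hvp).comp hb).div ((hG.tendsto_div ε hε).comp hb) (by positivity)
      refine this.congr fun n => ?_
      have h1 := (hG.pos (b n)).ne'
      have h2 := (hG.pos (ε * b n)).ne'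
      simp only [Pi.div_apply, Function.comp]
      field_simp
    rw [hνval]
    refine (h2.mul h1).congr' ?_
    filter_upwards [hb.eventually_gt_atTop 0] with n hn
    have e1 : (σ (v * b n) : Measure T).real B = (tail P (X 0) (v * b n))⁻¹ *
        P.real ({ω | v * b n < ‖X 0 ω‖} ∩
          (fun ω => (fun t => ‖X 0 ω‖⁻¹ • X t ω : T)) ⁻¹' B) := by
      simp only [σ, ProbabilityMeasure.coe_mk, Measure.real]
      rw [Measure.map_apply hθ hB, cond_apply (hmsA _), ENNReal.toReal_mul, ENNReal.toReal_inv]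
      rfl
    have e2 : (μ n : Measure (ℝ × T)).real (Ioi u ×ˢ B) = (tail P (X 0) (ε * b n))⁻¹ *
        P.real ({ω | v * b n < ‖X 0 ω‖} ∩
          (fun ω => (fun t => ‖X 0 ω‖⁻¹ • X t ω : T)) ⁻¹' B) := by
      simp only [μ, ProbabilityMeasure.coe_mk, Measure.real]
      rw [Measure.map_apply (hpm n) (measurableSet_Ioi.prod hB), cond_apply (hmsA _),
        ENNReal.toReal_mul, ENNReal.toReal_inv]
      have : {ω | ε * b n < ‖X 0 ω‖} ∩
          (fun ω => ((b n)⁻¹ * ‖X 0 ω‖, (fun t => ‖X 0 ω‖⁻¹ • X t ω : T))) ⁻¹' (Ioi u ×ˢ B)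
          = {ω | v * b n < ‖X 0 ω‖} ∩
          (fun ω => (fun t => ‖X 0 ω‖⁻¹ • X t ω : T)) ⁻¹' B := by
        ext ω
        simp only [mem_inter_iff, mem_ofPred_eq, mem_preimage, mem_prod, mem_Ioi, hv,
          ← lt_div_iff₀ hn, max_lt_iff, inv_mul_eq_div]
        tauto
      rw [this]
      rfl
    rw [e1, e2]
    have h1 := (hG.pos (v * b n)).ne'
    field_simp
  have hμ : Tendsto μ atTop (𝓝 ν) := by
    -- Bounded intervals, obtained as differences of the half-lines above, times continuity sets of
    -- `σ'` form a π-system containing small neighbourhoods of every point, which suffices for weak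
    -- convergence.
    let S : Set (Set (ℝ × T)) := {s | ∃ (u v : ℝ) (B : Set T), MeasurableSet B ∧
      (σ' : Measure T) (frontier B) = 0 ∧ s = Ioc u v ×ˢ B}
    have hS : IsPiSystem S := by
      rintro _ ⟨u, v, B, hB, hB', rfl⟩ _ ⟨u', v', B', hC, hC', rfl⟩ -
      exact ⟨max u u', min v v', B ∩ B', hB.inter hC, null_frontier_inter hB' hC', by
        rw [prod_inter_prod, Ioc_inter_Ioc]⟩
    refine hS.tendsto_probabilityMeasure_of_tendsto_of_mem ?_ ?_ ?_
    · rintro _ ⟨u, v, B, hB, hB', rfl⟩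
      exact measurableSet_Ioc.prod hB
    · rintro U hU ⟨y, z⟩ hyz
      obtain ⟨r, hr, hrU⟩ := Metric.isOpen_iff.mp hU (y, z) hyz
      obtain ⟨r', hr', hfr⟩ := exists_null_frontier_thickening (σ' : Measure T) {z} hr
      refine ⟨_, ⟨y - r / 2, y + r / 2, Metric.thickening r' {z},
        Metric.isOpen_thickening.measurableSet, hfr, rfl⟩, ?_, ?_⟩
      · refine prod_mem_nhds (Ioc_mem_nhds (by linarith) (by linarith)) ?_
        exact Metric.isOpen_thickening.mem_nhds (by simpa using hr'.1)
      · rintro ⟨y', z'⟩ ⟨h1, h2⟩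
        apply hrU
        rw [Metric.mem_ball, Prod.dist_eq, max_lt_iff]
        simp only [Metric.thickening_singleton, Metric.mem_ball, mem_Ioc] at h1 h2
        refine ⟨?_, h2.trans hr'.2⟩
        rw [Real.dist_eq, abs_lt]
        constructor <;> linarith [h1.1, h1.2]
    · rintro _ ⟨u, v, B, hB, hB', rfl⟩
      rcases lt_or_ge v u with huv | huv
      · rw [Ioc_eq_empty (by linarith)]
        simp
      have hdiff : ∀ (ρ : ProbabilityMeasure (ℝ × T)),
          ((ρ (Ioc u v ×ˢ B) : NNReal) : ℝ) = (ρ : Measure (ℝ × T)).real (Ioi u ×ˢ B)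
            - (ρ : Measure (ℝ × T)).real (Ioi v ×ˢ B) := by
        intro ρ
        rw [← measureReal_sdiff (prod_mono (Ioi_subset_Ioi huv) le_rfl)
          (measurableSet_Ioi.prod hB)]
        have : (Ioi u ×ˢ B) \ (Ioi v ×ˢ B) = Ioc u v ×ˢ B := by
          ext ⟨y, z⟩
          simp only [Set.mem_sdiff, mem_prod, mem_Ioi, mem_Ioc, not_and]
          constructor
          · rintro ⟨⟨h1, h2⟩, h3⟩
            exact ⟨⟨h1, by_contra fun h => h3 (not_le.mp h) h2⟩, h2⟩
          · rintro ⟨⟨h1, h2⟩, h3⟩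
            exact ⟨⟨h1, h3⟩, fun h => absurd h (not_lt.mpr h2)⟩
        rw [this]
        rfl
      rw [← NNReal.tendsto_coe]
      simp only [hdiff]
      exact (hlim u B hB hB').sub (hlim v B hB hB')
  rw [ProbabilityMeasure.tendsto_iff_forall_integral_tendsto] at hμ
  have h := hμ f
  have e1 : ∀ n, ∫ p, f p ∂(μ n : Measure (ℝ × T)) = (tail P (X 0) (ε * b n))⁻¹ *
      ∫ ω in {ω | ε * b n < ‖X 0 ω‖}, f ((b n)⁻¹ * ‖X 0 ω‖, fun t => ‖X 0 ω‖⁻¹ • X t ω) ∂P := by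
    intro n
    simp only [μ, ProbabilityMeasure.coe_mk]
    rw [integral_map (hpm n).aemeasurable f.continuous.aestronglyMeasurable, integral_cond_eq]
    rfl
  have e2 : ∫ p, f p ∂(ν : Measure (ℝ × T)) = (ε ^ (-α))⁻¹ *
      ∫ y in Ioi ε, ∫ ω, f (y, fun t => Θ t ω) ∂P' ∂(powMeasure α) := by
    simp only [ν, σ', ProbabilityMeasure.coe_mk]
    rw [integral_prod _ (f.integrable _), integral_cond_eq, powMeasure_real_Ioi hα hε, smul_eq_mul]
    congr 2
    ext y
    rw [integral_map hΘm.aemeasurable]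
    exact (f.continuous.comp (by fun_prop : Continuous fun z : T => (y, z))).aestronglyMeasurable
  simp only [e1, e2] at h
  exact h

end TailProcess

/-- A limit can be computed through approximations that are uniformly good in the limit. -/
lemma tendsto_of_approx {ι G : Type*} [NormedAddCommGroup G] {l : Filter ι} [l.NeBot]
    {φ : ℕ → G} {b : ι → ℕ → G} {L : ι → G} {z : G}
    (h1 : ∀ η : ℝ, 0 < η → ∀ᶠ i in l, ∀ᶠ n in atTop, ‖φ n - b i n‖ ≤ η)
    (h2 : ∀ᶠ i in l, Tendsto (b i) atTop (𝓝 (L i))) (h3 : Tendsto L l (𝓝 z)) :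
    Tendsto φ atTop (𝓝 z) := by
  rw [Metric.tendsto_atTop']
  intro η hη
  have h3' : ∀ᶠ i in l, ‖L i - z‖ < η / 3 := by
    have := (Metric.tendsto_nhds.mp h3) (η / 3) (by positivity)
    simpa only [dist_eq_norm] using this
  obtain ⟨i, hi1, hi2, hi3⟩ := ((h1 (η / 3) (by positivity)).and (h2.and h3')).exists
  have h2' : ∀ᶠ n in atTop, ‖b i n - L i‖ < η / 3 := by
    have := (Metric.tendsto_nhds.mp hi2) (η / 3) (by positivity)
    simpa only [dist_eq_norm] using this
  obtain ⟨N, hN⟩ := eventually_atTop.mp (hi1.and h2')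
  refine ⟨N, fun n hn => ?_⟩
  obtain ⟨ha, hb⟩ := hN n hn.le
  rw [dist_eq_norm]
  calc ‖φ n - z‖ = ‖(φ n - b i n) + (b i n - L i) + (L i - z)‖ := by congr 1; abel
    _ ≤ ‖φ n - b i n‖ + ‖b i n - L i‖ + ‖L i - z‖ := norm_add₃_le
    _ < η := by linarith

/-! ### Vague convergence to the tail process. -/

section TailProcess

variable {Ω Ω' : Type*} [MeasurableSpace Ω] [MeasurableSpace Ω'] {d : ℕ}
  {P : Measure Ω} [IsProbabilityMeasure P] {P' : Measure Ω'} [IsProbabilityMeasure P']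
  {X : ℤ → Ω → EuclideanSpace ℝ (Fin d)} {Θ : ℤ → Ω' → EuclideanSpace ℝ (Fin d)} {α : ℝ}

omit [IsProbabilityMeasure P] in
-- Before the limit the rescaled vector at time 0 lies exactly on the unit sphere once `x ≥ 0`, so a
-- bounded continuous function measuring the distance to the sphere has integral 0, and this passes
-- to the limit.
lemma IsSpectralTailProcess.norm_zero_eq_one (hspec : IsSpectralTailProcess P X P' Θ)
    (hΘ : ∀ t, Measurable (Θ t)) :
    ∀ᵐ ω ∂P', ‖Θ 0 ω‖ = 1 := by
  obtain ⟨k, h0⟩ : ∃ k : ℕ, (0 : ℤ) ∈ Finset.Icc (-(k : ℤ)) (k : ℤ) := ⟨0, by simp⟩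
  let g : (Finset.Icc (-(k : ℤ)) (k : ℤ) → EuclideanSpace ℝ (Fin d)) → ℝ :=
    fun z => min |‖z ⟨0, h0⟩‖ - 1| 1
  have hg0 : ∀ z, 0 ≤ g z := fun z => le_min (abs_nonneg _) zero_le_one
  let f := BoundedContinuousFunction.ofNormedAddCommGroup g (by fun_prop) 1 (fun z => by
    rw [Real.norm_of_nonneg (hg0 z)]; exact min_le_right _ _)
  have h := hspec k f
  have hz : ∀ᶠ x : ℝ in atTop, ∫ ω, f (fun t => ‖X 0 ω‖⁻¹ • X t ω)
      ∂(ProbabilityTheory.cond P {ω | x < ‖X 0 ω‖}) = 0 := by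
    filter_upwards [eventually_ge_atTop 0] with x hx
    rw [integral_cond_eq]
    have h1 : ∀ ω ∈ {ω | x < ‖X 0 ω‖}, f (fun t => ‖X 0 ω‖⁻¹ • X t ω) = 0 := by
      intro ω hω
      have hω : x < ‖X 0 ω‖ := hω
      have : ‖X 0 ω‖ ≠ 0 := (lt_of_le_of_lt hx hω).ne'
      change min |‖‖X 0 ω‖⁻¹ • X 0 ω‖ - 1| 1 = 0
      rw [norm_smul, norm_inv, norm_norm, inv_mul_cancel₀ this]
      simp
    rw [setIntegral_eq_zero_of_forall_eq_zero h1, smul_zero]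
  have hint := tendsto_nhds_unique (h.congr' hz) tendsto_const_nhds
  have hint' : ∫ ω, min |‖Θ 0 ω‖ - 1| 1 ∂P' = 0 := hint
  have h00 := hΘ 0
  have hGm : Measurable fun ω => min |‖Θ 0 ω‖ - 1| 1 := by fun_prop
  have hGi : Integrable (fun ω => min |‖Θ 0 ω‖ - 1| 1) P' := by
    refine Integrable.of_bound hGm.aestronglyMeasurable 1 (ae_of_all _ fun ω => ?_)
    rw [Real.norm_of_nonneg (le_min (abs_nonneg _) zero_le_one)]
    exact min_le_right _ _
  rw [integral_eq_zero_iff_of_nonneg (fun ω => le_min (abs_nonneg _) zero_le_one) hGi] at hint'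
  filter_upwards [hint'] with ω hω
  have hω : min |‖Θ 0 ω‖ - 1| 1 = 0 := hω
  have h2 : |‖Θ 0 ω‖ - 1| = 0 := by
    rcases min_choice |‖Θ 0 ω‖ - 1| 1 with h | h <;> rw [h] at hω
    · exact hω
    · exact absurd hω one_ne_zero
  linarith [abs_eq_zero.mp h2]

/-- Vague convergence of the rescaled forward process to the tail process: test functions of
finitely many coordinates that vanish when the first coordinate is small. -/
theorem IsSpectralTailProcess.tendsto_vague (hspec : IsSpectralTailProcess P X P' Θ)
    (hX : ∀ t, Measurable (X t)) (hΘ : ∀ t, Measurable (Θ t)) (hα : 0 < α)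
    (hG : IsRegVarTail P (X 0) α) {a : ℕ → ℝ}
    (ha : Tendsto (fun n : ℕ => (n : ℝ) * tail P (X 0) (a n)) atTop (𝓝 1))
    {ε : ℝ} (hε : 0 < ε) (k : ℕ) {F : (ℕ → EuclideanSpace ℝ (Fin d)) → ℝ} (hF : Continuous F)
    {B : ℝ} (hB : ∀ x, |F x| ≤ B) (hdep : ∀ x y, (∀ t ≤ k, x t = y t) → F x = F y)
    (hvan : ∀ x, ‖x 0‖ ≤ ε → F x = 0) :
    Tendsto (fun n : ℕ => n * ∫ ω, F (fun t => (a n)⁻¹ • X t ω) ∂P) atTop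
      (𝓝 (∫ y, ∫ ω, F (fun t => y • Θ t ω) ∂P' ∂(powMeasure α))) := by
  have hat := hG.tendsto_normalization ha
  have hmem : ∀ t : ℕ, t ≤ k → (t : ℤ) ∈ Finset.Icc (-(k : ℤ)) (k : ℤ) := fun t ht => by
    rw [Finset.mem_Icc]; omega
  -- Multiplies radius and direction back together and pads with zeros, which is harmless because
  -- `F` only sees the coordinates up to `k`.
  let ext : ℝ × (Finset.Icc (-(k : ℤ)) (k : ℤ) → EuclideanSpace ℝ (Fin d)) →
      ℕ → EuclideanSpace ℝ (Fin d) :=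
    fun p t => if h : t ≤ k then p.1 • p.2 ⟨t, hmem t h⟩ else 0
  have hext : Continuous ext := by
    refine continuous_pi fun t => ?_
    by_cases h : t ≤ k
    · simp only [ext, dif_pos h]; fun_prop
    · simp only [ext, dif_neg h]; fun_prop
  let f := BoundedContinuousFunction.ofNormedAddCommGroup (F ∘ ext) (hF.comp hext) B
    (fun z => hB _)
  have h := (hspec.tendsto_polar hX hΘ hα hG hat k hε f).mul (hG.tendsto_mul_tail ha hε)
  have e1 : ∀ᶠ n : ℕ in atTop, (tail P (X 0) (ε * a n))⁻¹ * (∫ ω in {ω | ε * a n < ‖X 0 ω‖},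
      f ((a n)⁻¹ * ‖X 0 ω‖, fun t => ‖X 0 ω‖⁻¹ • X t ω) ∂P) * (n * tail P (X 0) (ε * a n))
      = n * ∫ ω, F (fun t => (a n)⁻¹ • X t ω) ∂P := by
    filter_upwards [hat.eventually_gt_atTop 0] with n hn
    have h1 : ∫ ω in {ω | ε * a n < ‖X 0 ω‖},
        f ((a n)⁻¹ * ‖X 0 ω‖, fun t => ‖X 0 ω‖⁻¹ • X t ω) ∂P
        = ∫ ω in {ω | ε * a n < ‖X 0 ω‖}, F (fun t => (a n)⁻¹ • X t ω) ∂P := by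
      refine setIntegral_congr_fun (measurableSet_lt measurable_const (hX 0).norm) fun ω hω => ?_
      have hω : ε * a n < ‖X 0 ω‖ := hω
      have hpos : ‖X 0 ω‖ ≠ 0 := (lt_trans (by positivity) hω).ne'
      refine hdep _ _ fun t ht => ?_
      simp only [ext, dif_pos ht, smul_smul]
      rw [mul_assoc, mul_inv_cancel₀ hpos, mul_one]
    have h2 : ∫ ω in {ω | ε * a n < ‖X 0 ω‖}, F (fun t => (a n)⁻¹ • X t ω) ∂P
        = ∫ ω, F (fun t => (a n)⁻¹ • X t ω) ∂P := by
      refine setIntegral_eq_integral_of_forall_compl_eq_zero fun ω hω => hvan _ ?_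
      have hω : ‖X 0 ω‖ ≤ ε * a n := not_lt.mp hω
      simp only [Nat.cast_zero, norm_smul, norm_inv, Real.norm_eq_abs, abs_of_pos hn]
      rw [inv_mul_le_iff₀ hn]
      linarith
    rw [h1, h2]
    have := (hG.pos (ε * a n)).ne'
    field_simp
  have e2 : (ε ^ (-α))⁻¹ * (∫ y in Ioi ε, ∫ ω, f (y, fun t => Θ t ω) ∂P' ∂(powMeasure α))
      * ε ^ (-α) = ∫ y, ∫ ω, F (fun t => y • Θ t ω) ∂P' ∂(powMeasure α) := by
    have h1 : ∀ y, ∫ ω, f (y, fun t => Θ t ω) ∂P' = ∫ ω, F (fun t => y • Θ t ω) ∂P' := by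
      intro y
      refine integral_congr_ae (ae_of_all _ fun ω => hdep _ _ fun t ht => ?_)
      simp only [ext, dif_pos ht]
    have h2 : (∫ y in Ioi ε, ∫ ω, F (fun t => y • Θ t ω) ∂P' ∂(powMeasure α))
        = ∫ y, ∫ ω, F (fun t => y • Θ t ω) ∂P' ∂(powMeasure α) := by
      refine setIntegral_eq_integral_of_ae_compl_eq_zero ?_
      filter_upwards [ae_powMeasure_pos] with y hy0 hy
      have hy : y ≤ ε := not_lt.mp hy
      refine integral_eq_zero_of_ae ?_
      filter_upwards [hspec.norm_zero_eq_one hΘ] with ω hω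
      refine hvan _ ?_
      simp only [Nat.cast_zero, norm_smul, hω, mul_one, Real.norm_eq_abs, abs_of_pos hy0]
      exact hy
    simp only [h1, h2]
    have : ε ^ (-α) ≠ 0 := by positivity
    field_simp
  rw [e2] at h
  exact h.congr' e1

/-- Complex-valued version of `tendsto_vague`. -/
theorem IsSpectralTailProcess.tendsto_vague_complex (hspec : IsSpectralTailProcess P X P' Θ)
    (hX : ∀ t, Measurable (X t)) (hΘ : ∀ t, Measurable (Θ t)) (hα : 0 < α)
    (hG : IsRegVarTail P (X 0) α) {a : ℕ → ℝ}
    (ha : Tendsto (fun n : ℕ => (n : ℝ) * tail P (X 0) (a n)) atTop (𝓝 1))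
    {ε : ℝ} (hε : 0 < ε) (k : ℕ) {F : (ℕ → EuclideanSpace ℝ (Fin d)) → ℂ} (hF : Continuous F)
    {B : ℝ} (hB : ∀ x, ‖F x‖ ≤ B) (hdep : ∀ x y, (∀ t ≤ k, x t = y t) → F x = F y)
    (hvan : ∀ x, ‖x 0‖ ≤ ε → F x = 0) :
    Tendsto (fun n : ℕ => n * ∫ ω, F (fun t => (a n)⁻¹ • X t ω) ∂P) atTop
      (𝓝 (∫ y, ∫ ω, F (fun t => y • Θ t ω) ∂P' ∂(powMeasure α))) := by
  have hre := hspec.tendsto_vague hX hΘ hα hG ha hε k (F := fun x => (F x).re)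
    (Complex.continuous_re.comp hF) (fun x => (Complex.abs_re_le_norm _).trans (hB x))
    (fun x y h => by rw [hdep x y h]) (fun x h => by rw [hvan x h, Complex.zero_re])
  have him := hspec.tendsto_vague hX hΘ hα hG ha hε k (F := fun x => (F x).im)
    (Complex.continuous_im.comp hF) (fun x => (Complex.abs_im_le_norm _).trans (hB x))
    (fun x y h => by rw [hdep x y h]) (fun x h => by rw [hvan x h, Complex.zero_im])
  have hiX : ∀ n, Integrable (fun ω => F (fun t => (a n)⁻¹ • X t ω)) P := fun n =>
    Integrable.of_bound (hF.measurable.comp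
      (measurable_pi_lambda (fun ω (t : ℕ) => (a n)⁻¹ • X t ω)
        fun t => (hX t).const_smul ((a n)⁻¹))).aestronglyMeasurable B
      (ae_of_all _ fun ω => hB _)
  have hmj : Measurable fun p : ℝ × Ω' => F (fun t => p.1 • Θ t p.2) :=
    hF.measurable.comp (measurable_pi_lambda _ fun t => measurable_fst.smul
      ((hΘ t).comp measurable_snd))
  have hiΘ : ∀ y, Integrable (fun ω => F (fun t => y • Θ t ω)) P' := fun y =>
    Integrable.of_bound (hmj.comp (measurable_const.prodMk measurable_id)).aestronglyMeasurable B
      (ae_of_all _ fun ω => hB _)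
  have hfin : IsFiniteMeasure ((powMeasure α).restrict (Ioi ε)) :=
    ⟨by rw [Measure.restrict_apply_univ]; exact (powMeasure_Ioi_ne_top hα hε).lt_top⟩
  have hout : Integrable (fun y => ∫ ω, F (fun t => y • Θ t ω) ∂P') (powMeasure α) := by
    have h1 : IntegrableOn (fun y => ∫ ω, F (fun t => y • Θ t ω) ∂P') (Ioi ε) (powMeasure α) := by
      refine Integrable.of_bound
        (hmj.stronglyMeasurable.integral_prod_right').aestronglyMeasurable B
        (ae_of_all _ fun y => ?_)
      refine (norm_integral_le_of_norm_le_const (ae_of_all _ fun ω => hB _)).trans ?_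
      simp
    refine h1.integrable_of_ae_notMem_eq_zero ?_
    filter_upwards [ae_powMeasure_pos] with y hy0 hy
    have hy : y ≤ ε := not_lt.mp hy
    refine integral_eq_zero_of_ae ?_
    filter_upwards [hspec.norm_zero_eq_one hΘ] with ω hω
    refine hvan _ ?_
    simp only [Nat.cast_zero, norm_smul, hω, mul_one, Real.norm_eq_abs, abs_of_pos hy0]
    exact hy
  have e1 : ∀ n : ℕ, (n : ℂ) * ∫ ω, F (fun t => (a n)⁻¹ • X t ω) ∂P
      = ((n * ∫ ω, (F (fun t => (a n)⁻¹ • X t ω)).re ∂P : ℝ) : ℂ)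
        + ((n * ∫ ω, (F (fun t => (a n)⁻¹ • X t ω)).im ∂P : ℝ) : ℂ) * Complex.I := by
    intro n
    have h1 : ∫ ω, (F (fun t => (a n)⁻¹ • X t ω)).re ∂P
        = (∫ ω, F (fun t => (a n)⁻¹ • X t ω) ∂P).re := integral_re (hiX n)
    have h2 : ∫ ω, (F (fun t => (a n)⁻¹ • X t ω)).im ∂P
        = (∫ ω, F (fun t => (a n)⁻¹ • X t ω) ∂P).im := integral_im (hiX n)
    rw [h1, h2]
    apply Complex.ext <;> simp
  have e2 : ∫ y, ∫ ω, F (fun t => y • Θ t ω) ∂P' ∂(powMeasure α)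
      = ((∫ y, ∫ ω, (F (fun t => y • Θ t ω)).re ∂P' ∂(powMeasure α) : ℝ) : ℂ)
        + ((∫ y, ∫ ω, (F (fun t => y • Θ t ω)).im ∂P' ∂(powMeasure α) : ℝ) : ℂ) * Complex.I := by
    have h1 : ∫ y, ∫ ω, (F (fun t => y • Θ t ω)).re ∂P' ∂(powMeasure α)
        = (∫ y, ∫ ω, F (fun t => y • Θ t ω) ∂P' ∂(powMeasure α)).re := by
      refine Eq.trans ?_ (integral_re hout)
      exact integral_congr_ae (ae_of_all _ fun y => integral_re (hiΘ y))
    have h2 : ∫ y, ∫ ω, (F (fun t => y • Θ t ω)).im ∂P' ∂(powMeasure α)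
        = (∫ y, ∫ ω, F (fun t => y • Θ t ω) ∂P' ∂(powMeasure α)).im := by
      refine Eq.trans ?_ (integral_im hout)
      exact integral_congr_ae (ae_of_all _ fun y => integral_im (hiΘ y))
    rw [h1, h2, Complex.re_add_im]
  rw [e2]
  simp only [e1]
  exact ((Complex.continuous_ofReal.tendsto _).comp hre).add
    (((Complex.continuous_ofReal.tendsto _).comp him).mul_const _)

/-- The function that is `0` on `(-∞, 0]`, `1` on `[1, ∞)`, and linear in between. -/
noncomputable def ramp (r : ℝ) : ℝ := max 0 (min 1 r)

@[fun_prop]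
lemma continuous_ramp : Continuous ramp := by unfold ramp; fun_prop

lemma ramp_nonneg (r : ℝ) : 0 ≤ ramp r := le_max_left _ _

lemma ramp_le_one (r : ℝ) : ramp r ≤ 1 := max_le zero_le_one (min_le_left _ _)

lemma ramp_of_nonpos {r : ℝ} (h : r ≤ 0) : ramp r = 0 := by
  rw [ramp, min_eq_right (h.trans zero_le_one), max_eq_left h]

lemma ramp_of_one_le {r : ℝ} (h : 1 ≤ r) : ramp r = 1 := by
  rw [ramp, min_eq_left h, max_eq_right zero_le_one]

/-- For `α > 1` the test functions of one variable may grow linearly. -/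
theorem IsSpectralTailProcess.tendsto_vague_linear (hspec : IsSpectralTailProcess P X P' Θ)
    (hX : ∀ t, Measurable (X t)) (hΘ : ∀ t, Measurable (Θ t)) (hα : 1 < α) (hα2 : α < 2)
    (hG : IsRegVarTail P (X 0) α) {a : ℕ → ℝ}
    (ha : Tendsto (fun n : ℕ => (n : ℝ) * tail P (X 0) (a n)) atTop (𝓝 1))
    {ε : ℝ} (hε : 0 < ε) {g : EuclideanSpace ℝ (Fin d) → ℝ} (hg : Continuous g)
    {c : ℝ} (hc : ∀ x, |g x| ≤ c * ‖x‖) (hvan : ∀ x, ‖x‖ ≤ ε → g x = 0) :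
    Tendsto (fun n : ℕ => n * ∫ ω, g ((a n)⁻¹ • X 0 ω) ∂P) atTop
      (𝓝 (∫ y, ∫ ω, g (y • Θ 0 ω) ∂P' ∂(powMeasure α))) := by
  have hat := hG.tendsto_normalization ha
  obtain ⟨C, hC0, hC⟩ := hG.exists_upper_bound_scaled (hX 0) hα ha
  have hc0 : 0 ≤ |c| := abs_nonneg c
  have hc' : ∀ x, |g x| ≤ |c| * ‖x‖ := fun x =>
    (hc x).trans (mul_le_mul_of_nonneg_right (le_abs_self c) (norm_nonneg x))
  -- A continuous cut-off between norms `M` and `M + 1` makes the test function bounded. The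
  -- discarded part lives on `|X_0| > M a_n` and, by Karamata, is at most a constant times `M ^ (1 -
  -- α)` for large `n`, the constant being free of `M`.
  let gM : ℝ → EuclideanSpace ℝ (Fin d) → ℝ := fun M x => ramp (M + 1 - ‖x‖) * g x
  have hgMc : ∀ M, Continuous (gM M) := fun M => by fun_prop
  have hgMb : ∀ M, ∀ x, |gM M x| ≤ |g x| := fun M x => by
    simp only [gM, abs_mul, abs_of_nonneg (ramp_nonneg _)]
    exact mul_le_of_le_one_left (abs_nonneg _) (ramp_le_one _)
  have hint0 : Integrable (fun ω => ‖X 0 ω‖) P := hG.integrable (hX 0) hα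
  have hiX : ∀ n, Integrable (fun ω => g ((a n)⁻¹ • X 0 ω)) P := fun n => by
    refine (hint0.const_mul (|c| * |(a n)⁻¹|)).mono'
      (hg.measurable.comp ((hX 0).const_smul ((a n)⁻¹))).aestronglyMeasurable (ae_of_all _ fun ω => ?_)
    refine (hc' _).trans_eq ?_
    rw [norm_smul, Real.norm_eq_abs, mul_assoc]
  have hiXM : ∀ M n, Integrable (fun ω => gM M ((a n)⁻¹ • X 0 ω)) P := fun M n =>
    (hiX n).norm.mono' ((hgMc M).measurable.comp ((hX 0).const_smul ((a n)⁻¹))).aestronglyMeasurable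
      (ae_of_all _ fun ω => hgMb M _)
  refine tendsto_of_approx (l := (atTop : Filter ℝ))
    (b := fun M n => n * ∫ ω, gM M ((a n)⁻¹ • X 0 ω) ∂P)
    (L := fun M => ∫ y, ∫ ω, gM M (y • Θ 0 ω) ∂P' ∂(powMeasure α)) ?_ ?_ ?_
  · intro η hη
    have hlim : Tendsto (fun M : ℝ => |c| * (C * M ^ (1 - α))) atTop (𝓝 0) := by
      have := (tendsto_rpow_neg_atTop (show 0 < α - 1 by linarith)).const_mul C |>.const_mul |c|
      simpa using this
    filter_upwards [hlim.eventually_lt_const hη, eventually_gt_atTop 0] with M hM hM0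
    filter_upwards [hC M hM0, hat.eventually_gt_atTop 0] with n hn han
    have hms : MeasurableSet {ω | M * a n < ‖X 0 ω‖} :=
      measurableSet_lt measurable_const (hX 0).norm
    rw [← mul_sub, ← integral_sub (hiX n) (hiXM M n), norm_mul, Real.norm_natCast]
    have h1 : ‖∫ ω, (g ((a n)⁻¹ • X 0 ω) - gM M ((a n)⁻¹ • X 0 ω)) ∂P‖
        ≤ |c| * ((a n)⁻¹ * ∫ ω in {ω | M * a n < ‖X 0 ω‖}, ‖X 0 ω‖ ∂P) := by
      rw [← integral_const_mul, ← integral_const_mul, ← integral_indicator hms]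
      refine norm_integral_le_of_norm_le
        (((hint0.const_mul _).const_mul _).indicator hms) (ae_of_all _ fun ω => ?_)
      by_cases h : M * a n < ‖X 0 ω‖
      · rw [indicator_of_mem (by exact h)]
        have : g ((a n)⁻¹ • X 0 ω) - gM M ((a n)⁻¹ • X 0 ω)
            = (1 - ramp (M + 1 - ‖(a n)⁻¹ • X 0 ω‖)) * g ((a n)⁻¹ • X 0 ω) := by
          simp only [gM]; ring
        rw [this, norm_mul, Real.norm_of_nonneg (by linarith [ramp_le_one (M + 1 - ‖(a n)⁻¹ • X 0 ω‖)])]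
        calc _ ≤ 1 * |g ((a n)⁻¹ • X 0 ω)| := by
              gcongr
              · linarith [ramp_nonneg (M + 1 - ‖(a n)⁻¹ • X 0 ω‖)]
              · rfl
          _ ≤ |c| * ‖(a n)⁻¹ • X 0 ω‖ := by rw [one_mul]; exact hc' _
          _ = _ := by rw [norm_smul, norm_inv, Real.norm_of_nonneg han.le]
      · rw [indicator_of_notMem (by exact h)]
        have : ‖(a n)⁻¹ • X 0 ω‖ ≤ M := by
          rw [norm_smul, norm_inv, Real.norm_of_nonneg han.le, inv_mul_le_iff₀ han, mul_comm]
          exact not_lt.mp h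
        simp only [gM]
        rw [ramp_of_one_le (by linarith)]
        simp
    calc _ ≤ n * (|c| * ((a n)⁻¹ * ∫ ω in {ω | M * a n < ‖X 0 ω‖}, ‖X 0 ω‖ ∂P)) := by gcongr
      _ = |c| * (n * ((a n)⁻¹ * ∫ ω in {ω | M * a n < ‖X 0 ω‖}, ‖X 0 ω‖ ∂P)) := by ring
      _ ≤ |c| * (C * M ^ (1 - α)) := by gcongr
      _ ≤ η := hM.le
  · filter_upwards [eventually_ge_atTop 0] with M hM
    refine hspec.tendsto_vague hX hΘ (by linarith) hG ha hε 0 (F := fun x => gM M (x 0))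
      ((hgMc M).comp (continuous_apply 0)) (B := |c| * (M + 1)) (fun x => ?_)
      (fun x y h => by rw [h 0 le_rfl]) (fun x h => by simp only [gM, hvan _ h, mul_zero])
    by_cases h : ‖x 0‖ ≤ M + 1
    · exact (hgMb M _).trans ((hc' _).trans (by gcongr))
    · simp only [gM]
      rw [ramp_of_nonpos (by linarith), zero_mul, abs_zero]
      positivity
  · have hΘ1 := hspec.norm_zero_eq_one hΘ
    have hmj : ∀ M, Measurable fun p : ℝ × Ω' => gM M (p.1 • Θ 0 p.2) := fun M =>
      (hgMc M).measurable.comp (measurable_fst.smul ((hΘ 0).comp measurable_snd))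
    have hgt : ∀ x, Tendsto (fun M => gM M x) atTop (𝓝 (g x)) := fun x => by
      refine tendsto_const_nhds.congr' ?_
      filter_upwards [eventually_ge_atTop ‖x‖] with M hM
      simp only [gM]
      rw [ramp_of_one_le (by linarith), one_mul]
    -- Near 0 the dominating function is `y ^ 2`, smaller than the linear growth of `g`; since `g`
    -- vanishes for `y ≤ ε`, a factor `ε⁻¹` makes up for it.
    have hdom : Integrable (fun y => |c| * (1 + ε⁻¹) * powDom 1 y) (powMeasure α) :=
      (integrable_powDom (by linarith) (by simpa using hα) (by norm_num; linarith)).const_mul _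
    have hb1 : ∀ M y, 0 < y → ∀ᵐ ω ∂P', ‖gM M (y • Θ 0 ω)‖ ≤ |c| * (1 + ε⁻¹) * powDom 1 y := by
      intro M y hy
      filter_upwards [hΘ1] with ω hω
      have hn : ‖y • Θ 0 ω‖ = y := by rw [norm_smul, hω, mul_one, Real.norm_of_nonneg hy.le]
      have hinv : 0 < ε⁻¹ := by positivity
      have hpd : 0 ≤ powDom 1 y := by unfold powDom; split_ifs <;> positivity
      by_cases h : y ≤ ε
      · simp only [gM]
        rw [hvan _ (by rw [hn]; exact h), mul_zero, norm_zero]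
        positivity
      · refine ((hgMb M _).trans (hc' _)).trans ?_
        rw [hn, mul_assoc]
        refine mul_le_mul_of_nonneg_left ?_ hc0
        unfold powDom
        split_ifs with h1
        · have : 1 ≤ ε⁻¹ * y := by rw [inv_mul_eq_div, one_le_div hε]; exact (not_le.mp h).le
          simp only [Nat.reduceAdd]
          nlinarith
        · rw [pow_one]; nlinarith
    refine tendsto_integral_filter_of_dominated_convergence _ ?_ ?_ hdom ?_
    · exact Eventually.of_forall fun M =>
        ((hmj M).stronglyMeasurable.integral_prod_right').aestronglyMeasurable
    · refine Eventually.of_forall fun M => ?_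
      filter_upwards [ae_powMeasure_pos] with y hy
      exact (norm_integral_le_of_norm_le_const (hb1 M y hy)).trans_eq (by simp)
    · filter_upwards [ae_powMeasure_pos] with y hy
      refine tendsto_integral_filter_of_dominated_convergence _ ?_
        (Eventually.of_forall fun M => hb1 M y hy) (integrable_const _)
        (ae_of_all _ fun ω => hgt _)
      exact Eventually.of_forall fun M =>
        ((hmj M).comp (measurable_const.prodMk measurable_id)).aestronglyMeasurable

end TailProcess

/-- The character `r ↦ e^{ir}`. -/
noncomputable def cexpI (r : ℝ) : ℂ := Complex.exp (Complex.I * (r : ℝ))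

@[simp]
lemma norm_cexpI (r : ℝ) : ‖cexpI r‖ = 1 := by
  rw [cexpI, mul_comm, Complex.norm_exp_ofReal_mul_I]

@[simp]
lemma cexpI_zero : cexpI 0 = 1 := by simp [cexpI]

lemma cexpI_add (x y : ℝ) : cexpI (x + y) = cexpI x * cexpI y := by
  simp only [cexpI]
  rw [← Complex.exp_add]
  push_cast
  ring_nf

@[fun_prop]
lemma continuous_cexpI : Continuous cexpI := by unfold cexpI; fun_prop

lemma norm_cexpI_sub_one_le (x : ℝ) : ‖cexpI x - 1‖ ≤ |x| :=
  Real.norm_exp_I_mul_ofReal_sub_one_le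

lemma norm_cexpI_sub_le_two (x y : ℝ) : ‖cexpI x - cexpI y‖ ≤ 2 :=
  (norm_sub_le _ _).trans (by simp; norm_num)

/-! ### Telescoping the characteristic function of a block. -/

section Blocks

variable {Ω : Type*} [MeasurableSpace Ω] {d : ℕ} {P : Measure Ω}
  {X : ℤ → Ω → EuclideanSpace ℝ (Fin d)}
  {φ φ' : EuclideanSpace ℝ (Fin d) → EuclideanSpace ℝ (Fin d)} {s : EuclideanSpace ℝ (Fin d)}

/-- `exp(i s'∑_{0 ≤ t ≤ k} φ(x_t)) - exp(i s'∑_{1 ≤ t ≤ k} φ(x_t))`. -/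
noncomputable def jump (φ : EuclideanSpace ℝ (Fin d) → EuclideanSpace ℝ (Fin d))
    (s : EuclideanSpace ℝ (Fin d)) (k : ℕ) (x : ℕ → EuclideanSpace ℝ (Fin d)) : ℂ :=
  cexpI ⟪s, ∑ t ∈ Finset.range (k + 1), φ (x t)⟫_ℝ
    - cexpI ⟪s, ∑ t ∈ Finset.range k, φ (x (t + 1))⟫_ℝ

lemma norm_jump_le_two (k : ℕ) (x : ℕ → EuclideanSpace ℝ (Fin d)) : ‖jump φ s k x‖ ≤ 2 :=
  norm_cexpI_sub_le_two _ _

lemma jump_eq_zero {k : ℕ} {x : ℕ → EuclideanSpace ℝ (Fin d)} (h : φ (x 0) = 0) :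
    jump φ s k x = 0 := by
  rw [jump, Finset.sum_range_succ', h, add_zero, sub_self]

lemma jump_eq_mul (k : ℕ) (x : ℕ → EuclideanSpace ℝ (Fin d)) :
    jump φ s k x = cexpI ⟪s, ∑ t ∈ Finset.range k, φ (x (t + 1))⟫_ℝ
      * (cexpI ⟪s, φ (x 0)⟫_ℝ - 1) := by
  rw [jump, Finset.sum_range_succ', inner_add_right, cexpI_add]
  ring

lemma jump_congr {k : ℕ} {x : ℕ → EuclideanSpace ℝ (Fin d)} (h : ∀ t ≤ k, φ (x t) = φ' (x t)) :
    jump φ s k x = jump φ' s k x := by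
  rw [jump, jump, Finset.sum_congr rfl fun t ht => h t (Nat.lt_succ_iff.mp (Finset.mem_range.mp ht)),
    Finset.sum_congr rfl fun t ht => h (t + 1) (Finset.mem_range.mp ht)]

lemma continuous_jump (hφ : Continuous φ) (k : ℕ) : Continuous (jump φ s k) := by
  unfold jump
  fun_prop

lemma measurable_jump (hφ : Measurable φ) (k : ℕ) : Measurable (jump φ s k) := by
  have h1 : Measurable fun x : ℕ → EuclideanSpace ℝ (Fin d) =>
      ∑ t ∈ Finset.range (k + 1), φ (x t) :=
    Finset.measurable_sum _ fun t _ => hφ.comp (measurable_pi_apply t)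
  have h2 : Measurable fun x : ℕ → EuclideanSpace ℝ (Fin d) =>
      ∑ t ∈ Finset.range k, φ (x (t + 1)) :=
    Finset.measurable_sum _ fun t _ => hφ.comp (measurable_pi_apply (t + 1))
  exact (continuous_cexpI.measurable.comp (measurable_const.inner h1)).sub
    (continuous_cexpI.measurable.comp (measurable_const.inner h2))

variable [IsProbabilityMeasure P]

lemma integrable_jump (hX : ∀ t, Measurable (X t)) (hφ : Measurable φ) (k : ℕ) :
    Integrable (fun ω => jump φ s k (fun t => X t ω)) P :=
  Integrable.of_bound ((measurable_jump hφ k).comp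
    (measurable_pi_lambda (fun ω (t : ℕ) => X t ω) fun t => hX t)).aestronglyMeasurable 2
    (ae_of_all _ fun _ => norm_jump_le_two _ _)

lemma measurable_cexpI_sum (hφ : Measurable φ) (k : ℕ) (h : ℤ) :
    Measurable fun z : ℤ → EuclideanSpace ℝ (Fin d) =>
      cexpI ⟪s, ∑ t ∈ Finset.range k, φ (z (t + h))⟫_ℝ :=
  continuous_cexpI.measurable.comp (measurable_const.inner
    (Finset.measurable_sum _ fun _ _ => hφ.comp (measurable_pi_apply _)))

/-- Telescoping: the increments of the block characteristic functions. -/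
lemma IsStrictlyStationary.integral_jump (hstat : IsStrictlyStationary P X)
    (hX : ∀ t, Measurable (X t)) (hφ : Measurable φ) (k : ℕ) :
    ∫ ω, jump φ s k (fun t => X t ω) ∂P
      = ∫ ω, cexpI ⟪s, ∑ t ∈ Finset.range (k + 1), φ (X (t + 1) ω)⟫_ℝ ∂P
        - ∫ ω, cexpI ⟪s, ∑ t ∈ Finset.range k, φ (X (t + 1) ω)⟫_ℝ ∂P := by
  have hm : Measurable fun ω t => X t ω := measurable_pi_lambda _ fun t => hX t
  have h := hstat.integral_shift hX 1 (measurable_cexpI_sum (s := s) hφ (k + 1) 0)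
  simp only [add_zero] at h
  rw [h, ← integral_sub]
  · simp only [jump, Nat.cast_add, Nat.cast_one]
  · refine Integrable.of_bound (AEStronglyMeasurable.congr ((measurable_cexpI_sum (s := s) hφ
      (k + 1) 0).comp hm).aestronglyMeasurable (ae_of_all _ fun ω => ?_)) 1
      (ae_of_all _ fun _ => (norm_cexpI _).le)
    simp only [Function.comp, add_zero]
  · exact Integrable.of_bound ((measurable_cexpI_sum (s := s) hφ k 1).comp hm).aestronglyMeasurable 1
      (ae_of_all _ fun _ => (norm_cexpI _).le)

/-- After telescoping, each of the `m` increments is compared with the jump over `k` lags. Both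
vanish unless `|X_0| > c`; for the at most `k` indices `j < k` this alone is used, while for `j ≥ k`
the two agree unless there is another exceedance at a lag between `k + 1` and `m`. The 4 bounds the
difference of two jumps of norm at most 2. -/
lemma IsStrictlyStationary.norm_block_sub_le (hstat : IsStrictlyStationary P X)
    (hX : ∀ t, Measurable (X t)) (hφ : Measurable φ) {c : ℝ} (hc : ∀ x, ‖x‖ ≤ c → φ x = 0)
    (k m : ℕ) :
    ‖∫ ω, cexpI ⟪s, ∑ t ∈ Finset.range m, φ (X (t + 1) ω)⟫_ℝ ∂P - 1
        - m * ∫ ω, jump φ s k (fun t => X t ω) ∂P‖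
      ≤ 4 * (k * tail P (X 0) c + m * P.real {ω | c < ‖X 0 ω‖ ∧
          ∃ i ∈ Finset.Icc (k + 1) m, c < ‖X (i : ℤ) ω‖}) := by
  set p := P.real {ω | c < ‖X 0 ω‖ ∧ ∃ i ∈ Finset.Icc (k + 1) m, c < ‖X (i : ℤ) ω‖} with hp
  have hp0 : 0 ≤ p := measureReal_nonneg
  have ht0 := tail_nonneg (P := P) (Z := X 0) c
  have hmsA : MeasurableSet {ω | c < ‖X 0 ω‖} := measurableSet_lt measurable_const (hX 0).norm
  have hmsB : MeasurableSet
      {ω | c < ‖X 0 ω‖ ∧ ∃ i ∈ Finset.Icc (k + 1) m, c < ‖X (i : ℤ) ω‖} := by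
    have : {ω | c < ‖X 0 ω‖ ∧ ∃ i ∈ Finset.Icc (k + 1) m, c < ‖X (i : ℤ) ω‖}
        = {ω | c < ‖X 0 ω‖} ∩ ⋃ i ∈ Finset.Icc (k + 1) m, {ω | c < ‖X (i : ℤ) ω‖} := by
      ext ω; simp
    rw [this]
    exact hmsA.inter (Finset.measurableSet_biUnion _ fun i _ =>
      measurableSet_lt measurable_const (hX _).norm)
  have hdiff : ∀ j, ‖∫ ω, jump φ s j (fun t => X t ω) ∂P - ∫ ω, jump φ s k (fun t => X t ω) ∂P‖
      = ‖∫ ω, (jump φ s j (fun t => X t ω) - jump φ s k (fun t => X t ω)) ∂P‖ := fun j => by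
    rw [integral_sub (integrable_jump hX hφ j) (integrable_jump hX hφ k)]
  have hind : ∀ {A : Set Ω}, MeasurableSet A → ∀ j,
      (∀ ω ∉ A, jump φ s j (fun t => X t ω) - jump φ s k (fun t => X t ω) = 0) →
      ‖∫ ω, jump φ s j (fun t => X t ω) ∂P - ∫ ω, jump φ s k (fun t => X t ω) ∂P‖
        ≤ 4 * P.real A := by
    intro A hA j h0
    rw [hdiff]
    have h1 : ∫ ω, A.indicator (fun _ => (4 : ℝ)) ω ∂P = 4 * P.real A := by
      rw [integral_indicator_const _ hA, smul_eq_mul, mul_comm]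
    rw [← h1]
    refine norm_integral_le_of_norm_le ((integrable_const _).indicator hA) (ae_of_all _ fun ω => ?_)
    by_cases h : ω ∈ A
    · rw [indicator_of_mem h]
      refine (norm_sub_le _ _).trans ?_
      have h2 := norm_jump_le_two (φ := φ) (s := s) j (fun t => X t ω)
      have h3 := norm_jump_le_two (φ := φ) (s := s) k (fun t => X t ω)
      linarith
    · rw [indicator_of_notMem h, h0 ω h, norm_zero]
  have hsmall : ∀ j, ‖∫ ω, jump φ s j (fun t => X t ω) ∂P - ∫ ω, jump φ s k (fun t => X t ω) ∂P‖
      ≤ 4 * tail P (X 0) c := fun j => by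
    refine hind hmsA j fun ω hω => ?_
    have h0 : φ (X ((0 : ℕ) : ℤ) ω) = 0 := hc _ (not_lt.mp hω)
    rw [jump_eq_zero h0, jump_eq_zero h0, sub_zero]
  have hlarge : ∀ j, k ≤ j → j < m →
      ‖∫ ω, jump φ s j (fun t => X t ω) ∂P - ∫ ω, jump φ s k (fun t => X t ω) ∂P‖
        ≤ 4 * p := fun j hkj hjm => by
    refine hind hmsB j fun ω hω => ?_
    by_cases h : c < ‖X 0 ω‖
    · have hz : ∀ i : ℕ, k + 1 ≤ i → i ≤ m → φ (X (i : ℤ) ω) = 0 := fun i h1 h2 =>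
        hc _ (not_lt.mp fun h3 => hω ⟨h, i, Finset.mem_Icc.mpr ⟨h1, h2⟩, h3⟩)
      have e1 : ∑ t ∈ Finset.range (k + 1), φ (X (t : ℤ) ω)
          = ∑ t ∈ Finset.range (j + 1), φ (X (t : ℤ) ω) :=
        Finset.sum_subset (Finset.range_mono (by omega)) fun i h1 h2 => by
          simp only [Finset.mem_range] at h1 h2
          exact hz i (by omega) (by omega)
      have e2 : ∑ t ∈ Finset.range k, φ (X ((t + 1 : ℕ) : ℤ) ω)
          = ∑ t ∈ Finset.range j, φ (X ((t + 1 : ℕ) : ℤ) ω) :=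
        Finset.sum_subset (Finset.range_mono hkj) fun i h1 h2 => by
          simp only [Finset.mem_range] at h1 h2
          exact hz (i + 1) (by omega) (by omega)
      simp only [jump]
      rw [e1, e2, sub_self]
    · have h0 : φ (X ((0 : ℕ) : ℤ) ω) = 0 := hc _ (not_lt.mp h)
      rw [jump_eq_zero h0, jump_eq_zero h0, sub_zero]
  have htel : ∫ ω, cexpI ⟪s, ∑ t ∈ Finset.range m, φ (X (t + 1) ω)⟫_ℝ ∂P - 1
      = ∑ j ∈ Finset.range m, ∫ ω, jump φ s j (fun t => X t ω) ∂P := by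
    simp only [hstat.integral_jump hX hφ]
    rw [Finset.sum_range_sub
      (fun j => ∫ ω, cexpI ⟪s, ∑ t ∈ Finset.range j, φ (X (t + 1) ω)⟫_ℝ ∂P)]
    simp
  have hcst : (m : ℂ) * ∫ ω, jump φ s k (fun t => X t ω) ∂P
      = ∑ j ∈ Finset.range m, ∫ ω, jump φ s k (fun t => X t ω) ∂P := by simp
  rw [htel, hcst, ← Finset.sum_sub_distrib]
  calc _ ≤ ∑ j ∈ Finset.range m, ((if j < k then 4 * tail P (X 0) c else 0) + 4 * p) := by
        refine norm_sum_le_of_le _ fun j hj => ?_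
        split_ifs with h
        · exact (hsmall j).trans (by linarith)
        · rw [zero_add]
          exact hlarge j (not_lt.mp h) (Finset.mem_range.mp hj)
    _ = (({j ∈ Finset.range m | j < k}).card : ℝ) * (4 * tail P (X 0) c) + m * (4 * p) := by
        rw [Finset.sum_add_distrib, ← Finset.sum_filter]
        simp
    _ ≤ k * (4 * tail P (X 0) c) + m * (4 * p) := by
        have : ({j ∈ Finset.range m | j < k}).card ≤ k := by
          refine (Finset.card_le_card (t := Finset.range k) fun j hj => ?_).trans_eq
            (Finset.card_range k)
          exact Finset.mem_range.mpr (Finset.mem_filter.mp hj).2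
        gcongr
    _ = _ := by ring

/-- The jumps coincide unless one of the `k + 1` variables involved falls in the shell where `φ` and
`φ'` may differ; a union bound gives a difference of tails. It serves to exchange the sharp
truncation for the continuous one. -/
lemma IsStrictlyStationary.norm_integral_jump_sub_le (hstat : IsStrictlyStationary P X)
    (hX : ∀ t, Measurable (X t)) (hφ : Measurable φ) (hφ' : Measurable φ') {c c' : ℝ}
    (hcc : c ≤ c') (h : ∀ x, ¬ (c < ‖x‖ ∧ ‖x‖ ≤ c') → φ x = φ' x) (k : ℕ) :
    ‖∫ ω, jump φ s k (fun t => X t ω) ∂P - ∫ ω, jump φ' s k (fun t => X t ω) ∂P‖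
      ≤ 4 * ((k + 1) * (tail P (X 0) c - tail P (X 0) c')) := by
  have hms : ∀ (t : ℤ) x, MeasurableSet {ω | x < ‖X t ω‖} := fun t x =>
    measurableSet_lt measurable_const (hX t).norm
  have hval : ∀ t : ℤ, P.real {ω | c < ‖X t ω‖ ∧ ‖X t ω‖ ≤ c'}
      = tail P (X 0) c - tail P (X 0) c' := fun t => by
    rw [← hstat.tail_eq hX t, ← hstat.tail_eq hX t, tail, tail, ← measureReal_sdiff _ (hms t c')]
    · congr 1; ext ω; simp
    · exact fun ω hω => lt_of_le_of_lt hcc hω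
  set A : Set Ω := ⋃ t ∈ Finset.range (k + 1), {ω | c < ‖X (t : ℤ) ω‖ ∧ ‖X (t : ℤ) ω‖ ≤ c'} with hA
  have hAm : MeasurableSet A := Finset.measurableSet_biUnion _ fun t _ =>
    (hms _ _).inter (measurableSet_le (hX _).norm measurable_const)
  have hPA : P.real A ≤ (k + 1) * (tail P (X 0) c - tail P (X 0) c') := by
    refine (measureReal_biUnion_finset_le _ _).trans_eq ?_
    simp [hval, mul_sub]
  rw [← integral_sub (integrable_jump hX hφ k) (integrable_jump hX hφ' k)]
  have h1 : ∫ ω, A.indicator (fun _ => (4 : ℝ)) ω ∂P = 4 * P.real A := by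
    rw [integral_indicator_const _ hAm, smul_eq_mul, mul_comm]
  refine le_trans ?_ (h1.le.trans (by gcongr))
  refine norm_integral_le_of_norm_le ((integrable_const _).indicator hAm) (ae_of_all _ fun ω => ?_)
  by_cases hω : ω ∈ A
  · rw [indicator_of_mem hω]
    refine (norm_sub_le _ _).trans ?_
    have h2 := norm_jump_le_two (φ := φ) (s := s) k (fun t => X t ω)
    have h3 := norm_jump_le_two (φ := φ') (s := s) k (fun t => X t ω)
    linarith
  · rw [indicator_of_notMem hω, jump_congr (φ' := φ'), sub_self, norm_zero]
    intro t ht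
    refine h _ fun hct => hω ?_
    exact mem_biUnion (Finset.mem_coe.mpr (Finset.mem_range.mpr (Nat.lt_succ_of_le ht))) hct

end Blocks

/-! ### Continuous truncation. -/

section SoftTrunc

variable {d : ℕ}

/-- A continuous version of `x ↦ x 1{|x| > ε}`. -/
noncomputable def softTrunc (ε κ : ℝ) (x : EuclideanSpace ℝ (Fin d)) : EuclideanSpace ℝ (Fin d) :=
  ramp ((‖x‖ - ε) * κ) • x

@[fun_prop]
lemma continuous_softTrunc (ε κ : ℝ) : Continuous (softTrunc (d := d) ε κ) := by
  unfold softTrunc; fun_prop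

lemma norm_softTrunc_le (ε κ : ℝ) (x : EuclideanSpace ℝ (Fin d)) : ‖softTrunc ε κ x‖ ≤ ‖x‖ := by
  rw [softTrunc, norm_smul, Real.norm_of_nonneg (ramp_nonneg _)]
  exact mul_le_of_le_one_left (norm_nonneg _) (ramp_le_one _)

lemma softTrunc_eq_zero {ε κ : ℝ} (hκ : 0 ≤ κ) {x : EuclideanSpace ℝ (Fin d)} (h : ‖x‖ ≤ ε) :
    softTrunc ε κ x = 0 := by
  rw [softTrunc, ramp_of_nonpos (mul_nonpos_of_nonpos_of_nonneg (by linarith) hκ), zero_smul]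

lemma softTrunc_eq_self {ε κ : ℝ} (hκ : 0 < κ) {x : EuclideanSpace ℝ (Fin d)}
    (h : ε + κ⁻¹ ≤ ‖x‖) : softTrunc ε κ x = x := by
  rw [softTrunc, ramp_of_one_le, one_smul]
  have : κ⁻¹ * κ ≤ (‖x‖ - ε) * κ := by gcongr; linarith
  rwa [inv_mul_cancel₀ hκ.ne'] at this

lemma measurable_upperTrunc (c : ℝ) : Measurable (upperTrunc (d := d) c) :=
  Measurable.ite (measurableSet_lt measurable_const measurable_norm) measurable_id measurable_const

lemma measurable_lowerTrunc (c : ℝ) : Measurable (lowerTrunc (d := d) c) :=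
  Measurable.ite (measurableSet_le measurable_norm measurable_const) measurable_id measurable_const

lemma upperTrunc_eq_softTrunc {ε κ : ℝ} (hκ : 0 < κ) {x : EuclideanSpace ℝ (Fin d)}
    (h : ¬ (ε < ‖x‖ ∧ ‖x‖ ≤ ε + κ⁻¹)) : upperTrunc ε x = softTrunc ε κ x := by
  by_cases h1 : ε < ‖x‖
  · have h2 : ε + κ⁻¹ < ‖x‖ := by by_contra h3; exact h ⟨h1, not_lt.mp h3⟩
    rw [upperTrunc, if_pos h1, softTrunc_eq_self hκ h2.le]
  · rw [upperTrunc, if_neg h1, softTrunc_eq_zero hκ.le (not_lt.mp h1)]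

lemma upperTrunc_smul {a : ℝ} (ha : 0 < a) (ε : ℝ) (x : EuclideanSpace ℝ (Fin d)) :
    upperTrunc ε (a⁻¹ • x) = a⁻¹ • upperTrunc (ε * a) x := by
  have : ε < ‖a⁻¹ • x‖ ↔ ε * a < ‖x‖ := by
    rw [norm_smul, norm_inv, Real.norm_of_nonneg ha.le, inv_mul_eq_div, lt_div_iff₀ ha]
  simp only [upperTrunc, this]
  split_ifs <;> simp

end SoftTrunc

/-! ### Asymptotics of one block. -/

section BlockLimit

variable {Ω : Type*} [MeasurableSpace Ω] {d : ℕ} {P : Measure Ω} [IsProbabilityMeasure P]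
  {X : ℤ → Ω → EuclideanSpace ℝ (Fin d)} {α : ℝ} {a : ℕ → ℝ} {m : ℕ → ℕ}

omit [IsProbabilityMeasure P] in
-- The iterated limit superior read at a fixed tolerance, with the conditioning cleared by
-- multiplying with the tail.
lemma AntiClustering.eventually_le (hanti : AntiClustering P X a m) (hX : ∀ t, Measurable (X t))
    (hG : IsRegVarTail P (X 0) α) {ε η : ℝ} (hε : 0 < ε) (hη : 0 < η) :
    ∀ᶠ k : ℕ in atTop, ∀ᶠ n : ℕ in atTop,
      P.real {ω | ε * a n < ‖X 0 ω‖ ∧ ∃ i ∈ Finset.Icc k (m n), ε * a n < ‖X (i : ℤ) ω‖}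
        ≤ η * tail P (X 0) (ε * a n) := by
  filter_upwards [(hanti ε hε).eventually_lt_const (ENNReal.ofReal_pos.mpr hη)] with k hk
  filter_upwards [eventually_lt_of_limsup_lt hk] with n hn
  have hms : MeasurableSet {ω | ε * a n < ‖X 0 ω‖} := measurableSet_lt measurable_const (hX 0).norm
  rw [cond_apply hms] at hn
  have h1 := ENNReal.toReal_mono ENNReal.ofReal_ne_top hn.le
  rw [ENNReal.toReal_mul, ENNReal.toReal_inv, ENNReal.toReal_ofReal hη.le] at h1
  change (tail P (X 0) (ε * a n))⁻¹ * P.real _ ≤ η at h1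
  rw [inv_mul_le_iff₀ (hG.pos _), mul_comm _ η] at h1
  exact h1

/-- The weight `(k+1)²` controlling the width of the continuous truncation. -/
noncomputable def sharpness (k : ℕ) : ℝ := ((k : ℝ) + 1) ^ 2

lemma sharpness_pos (k : ℕ) : 0 < sharpness k := by unfold sharpness; positivity

/-- The power function is differentiable at `ε`, so the gap is of order `(sharpness k)⁻¹ = (k +
1)⁻²` and beats the factor `k + 1` from the union bound over a window. A truncation of width `(k +
1)⁻¹` would not. -/
lemma tendsto_gap {ε : ℝ} (hε : 0 < ε) :
    Tendsto (fun k : ℕ => ((k : ℝ) + 1) * (ε ^ (-α) - (ε + (sharpness k)⁻¹) ^ (-α)))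
      atTop (𝓝 0) := by
  have hd := (Real.hasDerivAt_rpow_const (p := -α) (Or.inl hε.ne')).tendsto_slope_zero
  have h1 : Tendsto (fun k : ℕ => ((k : ℝ) + 1)⁻¹) atTop (𝓝 0) :=
    tendsto_inv_atTop_zero.comp (tendsto_atTop_add_const_right _ _ tendsto_natCast_atTop_atTop)
  have h2 : Tendsto (fun k : ℕ => (sharpness k)⁻¹) atTop (𝓝[≠] 0) := by
    refine tendsto_nhdsWithin_iff.mpr ⟨?_, Eventually.of_forall fun k =>
      (inv_pos.mpr (sharpness_pos k)).ne'⟩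
    have := h1.pow 2
    simpa [sharpness] using this
  have h3 := (hd.comp h2).mul h1
  rw [mul_zero] at h3
  have h4 := h3.neg
  rw [neg_zero] at h4
  refine h4.congr fun k => ?_
  have : ((k : ℝ) + 1) ≠ 0 := by positivity
  simp only [Function.comp, smul_eq_mul, sharpness, inv_inv]
  field_simp
  ring

lemma blocks_mul_le (n m : ℕ) : ((n / m : ℕ) : ℝ) * m ≤ n := by
  exact_mod_cast Nat.div_mul_le_self n m

lemma sub_blocks_mul_le {n m : ℕ} (hm : 0 < m) : (n : ℝ) - ((n / m : ℕ) : ℝ) * m ≤ m := by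
  have h := Nat.div_add_mod n m
  have h2 := (Nat.mod_lt n hm).le
  have : (n : ℝ) = m * ((n / m : ℕ) : ℝ) + (n % m : ℕ) := by exact_mod_cast h.symm
  have h3 : ((n % m : ℕ) : ℝ) ≤ m := by exact_mod_cast h2
  linarith

lemma norm_integral_jump_le (hX : ∀ t, Measurable (X t))
    {φ : EuclideanSpace ℝ (Fin d) → EuclideanSpace ℝ (Fin d)} {s : EuclideanSpace ℝ (Fin d)}
    {c : ℝ} (hc : ∀ x, ‖x‖ ≤ c → φ x = 0) (k : ℕ) :
    ‖∫ ω, jump φ s k (fun t => X t ω) ∂P‖ ≤ 2 * tail P (X 0) c := by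
  have hms : MeasurableSet {ω | c < ‖X 0 ω‖} := measurableSet_lt measurable_const (hX 0).norm
  have h1 : ∫ ω, {ω | c < ‖X 0 ω‖}.indicator (fun _ => (2 : ℝ)) ω ∂P = 2 * tail P (X 0) c := by
    rw [integral_indicator_const _ hms, smul_eq_mul, mul_comm]; rfl
  rw [← h1]
  refine norm_integral_le_of_norm_le ((integrable_const _).indicator hms) (ae_of_all _ fun ω => ?_)
  by_cases h : c < ‖X 0 ω‖
  · rw [indicator_of_mem (by exact h)]; exact norm_jump_le_two _ _
  · have h0 : φ (X ((0 : ℕ) : ℤ) ω) = 0 := hc _ (not_lt.mp h)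
    rw [indicator_of_notMem (by exact h), jump_eq_zero h0, norm_zero]

omit [MeasurableSpace Ω] in
lemma inner_upperSum_div {s : EuclideanSpace ℝ (Fin d)} {b : ℝ} (hb : 0 < b) (ε : ℝ) (j : ℕ)
    (ω : Ω) : ⟪s, upperSum X (ε * b) j ω⟫_ℝ / b
      = ⟪s, ∑ t ∈ Finset.range j, upperTrunc ε (b⁻¹ • X (t + 1) ω)⟫_ℝ := by
  have e : upperSum X (ε * b) j ω = ∑ t ∈ Finset.range j, upperTrunc (ε * b) (X (t + 1) ω) := by
    rw [upperSum]
    induction j with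
    | zero => simp
    | succ j ih => rw [Finset.sum_Icc_succ_top (by omega), Finset.sum_range_succ, ih]; simp
  simp only [upperTrunc_smul hb, ← Finset.smul_sum, inner_smul_right, e]
  rw [inv_mul_eq_div]

/-- Asymptotics of the characteristic function of the truncated sum over one block. -/
theorem AntiClustering.eventually_block_approx (hanti : AntiClustering P X a m)
    (hstat : IsStrictlyStationary P X)
    (hX : ∀ t, Measurable (X t)) (hG : IsRegVarTail P (X 0) α)
    (ha : Tendsto (fun n : ℕ => (n : ℝ) * tail P (X 0) (a n)) atTop (𝓝 1))
    (hm : Tendsto m atTop atTop)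
    (hmn : Tendsto (fun n : ℕ => (m n : ℝ) / (n : ℝ)) atTop (𝓝 0))
    (s : EuclideanSpace ℝ (Fin d)) {ε η : ℝ} (hε : 0 < ε) (hη : 0 < η) :
    ∀ᶠ k : ℕ in atTop, ∀ᶠ n : ℕ in atTop,
      ‖((n / m n : ℕ) : ℂ) *
          (∫ ω, cexpI (⟪s, upperSum X (ε * a n) (m n) ω⟫_ℝ / a n) ∂P - 1)
        - n * ∫ ω, jump (softTrunc ε (sharpness k)) s k (fun t => (a n)⁻¹ • X t ω) ∂P‖ ≤ η := by
  have hat := hG.tendsto_normalization ha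
  have hεα : 0 < ε ^ (-α) := by positivity
  -- Chosen so that `4 * η' * ε ^ (-α) = η / 4`. The truncation gap takes less than another quarter,
  -- and the other two errors vanish as `n → ∞`.
  set η' : ℝ := η / (16 * ε ^ (-α)) with hη'
  have hη'0 : 0 < η' := by positivity
  filter_upwards [(tendsto_add_atTop_nat 1).eventually (hanti.eventually_le hX hG hε hη'0),
    ((tendsto_gap (α := α) hε).const_mul 4).eventually_lt_const
      (show 4 * (0 : ℝ) < η / 4 by linarith)] with k hk hgap
  set κ := sharpness k with hκ
  have hκ0 : 0 < κ := sharpness_pos k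
  have hT := hG.tendsto_mul_tail ha hε
  have hT' := hG.tendsto_mul_tail ha (show 0 < ε + κ⁻¹ by positivity)
  have hminv : Tendsto (fun n => (m n : ℝ)⁻¹) atTop (𝓝 0) :=
    tendsto_inv_atTop_zero.comp (tendsto_natCast_atTop_atTop.comp hm)
  have hlim : Tendsto (fun n : ℕ =>
      4 * k * ((m n : ℝ)⁻¹ * (n * tail P (X 0) (ε * a n))) + 4 * η' * (n * tail P (X 0) (ε * a n))
        + 4 * ((k + 1) * (n * tail P (X 0) (ε * a n) - n * tail P (X 0) ((ε + κ⁻¹) * a n)))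
        + 2 * ((m n : ℝ) / n * (n * tail P (X 0) (ε * a n)))) atTop
      (𝓝 (4 * k * (0 * ε ^ (-α)) + 4 * η' * ε ^ (-α)
        + 4 * ((k + 1) * (ε ^ (-α) - (ε + κ⁻¹) ^ (-α))) + 2 * (0 * ε ^ (-α)))) :=
    ((((hminv.mul hT).const_mul _).add (hT.const_mul _)).add
      (((hT.sub hT').const_mul _).const_mul _)).add ((hmn.mul hT).const_mul _)
  have hlt : 4 * k * (0 * ε ^ (-α)) + 4 * η' * ε ^ (-α)
        + 4 * ((k + 1) * (ε ^ (-α) - (ε + κ⁻¹) ^ (-α))) + 2 * (0 * ε ^ (-α)) < η := by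
    have : 4 * η' * ε ^ (-α) = η / 4 := by rw [hη']; field_simp; norm_num
    rw [this]
    linarith
  filter_upwards [hk, hlim.eventually_lt_const hlt, hat.eventually_gt_atTop 0,
    hm.eventually_gt_atTop 0, eventually_gt_atTop 0] with n hkn hn han hmn0 hn0
  refine le_trans ?_ hn.le
  -- the truncations as functions of the original process
  have hφm : Measurable fun x : EuclideanSpace ℝ (Fin d) => upperTrunc ε ((a n)⁻¹ • x) :=
    (measurable_upperTrunc ε).comp (measurable_const_smul _)
  have hφm' : Measurable fun x : EuclideanSpace ℝ (Fin d) => softTrunc ε κ ((a n)⁻¹ • x) :=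
    (continuous_softTrunc ε κ).measurable.comp (measurable_const_smul _)
  have hnorm : ∀ x : EuclideanSpace ℝ (Fin d), ‖(a n)⁻¹ • x‖ = ‖x‖ / a n := fun x => by
    rw [norm_smul, norm_inv, Real.norm_of_nonneg han.le, inv_mul_eq_div]
  have hc : ∀ x : EuclideanSpace ℝ (Fin d), ‖x‖ ≤ ε * a n → upperTrunc ε ((a n)⁻¹ • x) = 0 :=
    fun x hx => by
      rw [upperTrunc, if_neg]
      rw [hnorm, not_lt, div_le_iff₀ han]; exact hx
  have hc' : ∀ x : EuclideanSpace ℝ (Fin d), ‖x‖ ≤ ε * a n → softTrunc ε κ ((a n)⁻¹ • x) = 0 :=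
    fun x hx => softTrunc_eq_zero hκ0.le (by rw [hnorm, div_le_iff₀ han]; exact hx)
  have hcc : ε * a n ≤ (ε + κ⁻¹) * a n := by
    have : 0 < κ⁻¹ := by positivity
    gcongr
    linarith
  have hagree : ∀ x : EuclideanSpace ℝ (Fin d), ¬ (ε * a n < ‖x‖ ∧ ‖x‖ ≤ (ε + κ⁻¹) * a n) →
      upperTrunc ε ((a n)⁻¹ • x) = softTrunc ε κ ((a n)⁻¹ • x) := fun x hx => by
    refine upperTrunc_eq_softTrunc hκ0 ?_
    rw [hnorm, lt_div_iff₀ han, div_le_iff₀ han]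
    exact hx
  have hb := hstat.norm_block_sub_le (s := s) hX hφm hc k (m n)
  have hs := hstat.norm_integral_jump_sub_le (s := s) hX hφm hφm' hcc hagree k
  have hj := norm_integral_jump_le (P := P) (s := s) hX hc' k
  have hjump : ∀ ω, jump (fun x => softTrunc ε κ ((a n)⁻¹ • x)) s k (fun t => X t ω)
      = jump (softTrunc ε κ) s k (fun t => (a n)⁻¹ • X t ω) := fun ω => rfl
  simp only [inner_upperSum_div han]
  simp only [hjump] at hs hj
  set Jh := ∫ ω, jump (fun x => upperTrunc ε ((a n)⁻¹ • x)) s k (fun t => X t ω) ∂P with hJh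
  set Js := ∫ ω, jump (softTrunc ε κ) s k (fun t => (a n)⁻¹ • X t ω) ∂P with hJs
  set c := ∫ ω, cexpI ⟪s, ∑ t ∈ Finset.range (m n), upperTrunc ε ((a n)⁻¹ • X (t + 1) ω)⟫_ℝ ∂P
  set K := n / m n with hK
  set p := P.real {ω | ε * a n < ‖X 0 ω‖ ∧
    ∃ i ∈ Finset.Icc (k + 1) (m n), ε * a n < ‖X (i : ℤ) ω‖} with hp
  set G := tail P (X 0) (ε * a n) with hGdef
  set G' := tail P (X 0) ((ε + κ⁻¹) * a n) with hGdef'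
  have hG0 : 0 ≤ G := tail_nonneg _
  have hGG : 0 ≤ G - G' := sub_nonneg.mpr (tail_antitone hcc)
  have hp0 : 0 ≤ p := measureReal_nonneg
  have hmR : (0 : ℝ) < m n := by exact_mod_cast hmn0
  have hnR : (0 : ℝ) < n := by exact_mod_cast hn0
  have hKm : (K : ℝ) * m n ≤ n := blocks_mul_le n (m n)
  have hKm2 : (n : ℝ) - K * m n ≤ m n := sub_blocks_mul_le hmn0
  have hKle : (K : ℝ) ≤ n * (m n : ℝ)⁻¹ := by
    rw [← div_eq_mul_inv, le_div_iff₀ hmR]; exact hKm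
  -- Three errors: freezing the window at `k` lags, passing from the sharp to the continuous
  -- truncation, and the at most `m_n` terms left over after `K` full blocks.
  have hdecomp : (K : ℂ) * (c - 1) - n * Js
      = K * (c - 1 - (m n : ℂ) * Jh) + (K * m n : ℂ) * (Jh - Js) - ((n : ℂ) - K * m n) * Js := by
    ring
  rw [hdecomp]
  have hnc : ‖(n : ℂ) - K * m n‖ ≤ m n := by
    have : (n : ℂ) - K * m n = (((n : ℝ) - K * m n : ℝ) : ℂ) := by push_cast; ring
    rw [this, Complex.norm_real, Real.norm_of_nonneg (by linarith)]
    exact hKm2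
  have hKc : ‖(K : ℂ) * m n‖ ≤ n := by
    rw [norm_mul, Complex.norm_natCast, Complex.norm_natCast]; exact hKm
  calc _ ≤ ‖(K : ℂ) * (c - 1 - (m n : ℂ) * Jh)‖ + ‖(K * m n : ℂ) * (Jh - Js)‖
        + ‖((n : ℂ) - K * m n) * Js‖ := (norm_sub_le _ _).trans (by gcongr; exact norm_add_le _ _)
    _ ≤ (n * (m n : ℝ)⁻¹) * (4 * (k * G + m n * (η' * G))) + n * (4 * ((k + 1) * (G - G')))
        + m n * (2 * G) := by
      rw [norm_mul (K : ℂ) (_ - _), norm_mul _ (Jh - Js), norm_mul _ Js, Complex.norm_natCast]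
      gcongr
      exact hb.trans (by gcongr)
    _ = _ := by field_simp

end BlockLimit

/-! ### Bounds and dominated convergence for the integrand of the exponent. -/

section StableExponent

variable {Ω' : Type*} [MeasurableSpace Ω'] {d : ℕ} {P' : Measure Ω'} {α : ℝ} {q : ℕ}

/-- `(e^{is'x} - 1) e^{is'z} - i q s'x`. -/
noncomputable def stabInt (q : ℕ) (s x z : EuclideanSpace ℝ (Fin d)) : ℂ :=
  cexpI ⟪s, z⟫_ℝ * (cexpI ⟪s, x⟫_ℝ - 1) - Complex.I * ((q * ⟪s, x⟫_ℝ : ℝ) : ℂ)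

/-- Taylor for `|u| ≤ 1`; otherwise the trivial bound `2 + |u|` is at most `3 * u ^ 2`. -/
lemma norm_cexpI_sub_one_sub_le (u : ℝ) : ‖cexpI u - 1 - Complex.I * (u : ℂ)‖ ≤ 3 * u ^ 2 := by
  have hn : ‖Complex.I * (u : ℂ)‖ = |u| := by simp
  rcases le_or_gt |u| 1 with h | h
  · have := Complex.norm_exp_sub_one_sub_id_le (x := Complex.I * (u : ℂ)) (by rw [hn]; exact h)
    rw [hn, sq_abs] at this
    refine this.trans ?_
    nlinarith [sq_nonneg u]
  · have h1 := norm_cexpI_sub_le_two u 0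
    rw [cexpI_zero] at h1
    refine (norm_sub_le _ _).trans ?_
    rw [hn]
    have : |u| ^ 2 = u ^ 2 := sq_abs u
    nlinarith

lemma powDom_nonneg {y : ℝ} (hy : 0 < y) : 0 ≤ powDom q y := by
  unfold powDom; split_ifs <;> positivity

/-- For `q = 1` and `y ≤ 1`, split the integrand as `e^{is'z} (e^{is'x} - 1 - is'x) + is'x (e^{is'z}
- 1)`: both parts are of order `y ^ 2`, and the second brings in `R` linearly. This is the only
place where `R` counts, hence the factor `q` before it and the need for a finite mean of `∑ |Θ_j|`
only when `α > 1`. A bound `σ` in place of `‖s‖` makes the estimate uniform near a given `s`. -/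
lemma norm_stabInt_le (hq : q = 0 ∨ q = 1) {s x z : EuclideanSpace ℝ (Fin d)} {y R σ : ℝ}
    (hy : 0 < y) (hR : 0 ≤ R) (hσ : ‖s‖ ≤ σ) (hx : ‖x‖ ≤ y) (hz : ‖z‖ ≤ y * R) :
    ‖stabInt q s x z‖ ≤ (2 + σ + q * (σ ^ 2 * (3 + R))) * powDom q y := by
  have hσ0 : 0 ≤ σ := (norm_nonneg s).trans hσ
  have hsx : |⟪s, x⟫_ℝ| ≤ σ * y := (abs_real_inner_le_norm s x).trans (by gcongr)
  have hsz : |⟪s, z⟫_ℝ| ≤ σ * (y * R) := (abs_real_inner_le_norm s z).trans (by gcongr)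
  have h2 : ‖cexpI ⟪s, x⟫_ℝ - 1‖ ≤ 2 := by simpa using norm_cexpI_sub_le_two ⟪s, x⟫_ℝ 0
  have h1 := norm_cexpI_sub_one_le ⟪s, x⟫_ℝ
  rcases hq with rfl | rfl
  · have e : ‖stabInt 0 s x z‖ = ‖cexpI ⟪s, x⟫_ℝ - 1‖ := by simp [stabInt]
    rw [e, powDom]
    split_ifs with h
    · simp only [Nat.cast_zero, zero_mul, add_zero, zero_add, pow_one]
      nlinarith
    · simp only [Nat.cast_zero, zero_mul, add_zero, pow_zero]
      linarith
  · rw [powDom]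
    split_ifs with h
    · have e : stabInt 1 s x z = cexpI ⟪s, z⟫_ℝ * (cexpI ⟪s, x⟫_ℝ - 1 - Complex.I * (⟪s, x⟫_ℝ : ℂ))
          + Complex.I * (⟪s, x⟫_ℝ : ℂ) * (cexpI ⟪s, z⟫_ℝ - 1) := by
        simp only [stabInt, Nat.cast_one, one_mul]; ring
      have h3 := norm_cexpI_sub_one_sub_le ⟪s, x⟫_ℝ
      have h4 := norm_cexpI_sub_one_le ⟪s, z⟫_ℝ
      have h5 : ⟪s, x⟫_ℝ ^ 2 ≤ (σ * y) ^ 2 := by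
        rw [← sq_abs]; gcongr
      calc ‖stabInt 1 s x z‖ ≤ 3 * ⟪s, x⟫_ℝ ^ 2 + |⟪s, x⟫_ℝ| * |⟪s, z⟫_ℝ| := by
            rw [e]
            refine (norm_add_le _ _).trans ?_
            rw [norm_mul, norm_mul, norm_mul, norm_cexpI, one_mul, Complex.norm_I, one_mul,
              Complex.norm_real, Real.norm_eq_abs]
            gcongr
        _ ≤ 3 * (σ * y) ^ 2 + (σ * y) * (σ * (y * R)) := by gcongr
        _ = (σ ^ 2 * (3 + R)) * y ^ 2 := by ring
        _ ≤ _ := by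
          simp only [Nat.cast_one, one_mul]
          gcongr
          linarith
    · have hy1 : 1 < y := not_le.mp h
      calc ‖stabInt 1 s x z‖ ≤ 2 + σ * y := by
            rw [stabInt]
            refine (norm_sub_le _ _).trans ?_
            rw [norm_mul, norm_mul, norm_cexpI, one_mul, Complex.norm_I, one_mul, Complex.norm_real,
              Real.norm_eq_abs, Nat.cast_one, one_mul]
            gcongr
        _ ≤ (2 + σ) * y := by nlinarith
        _ ≤ _ := by
          rw [pow_one, Nat.cast_one, one_mul]
          have : 0 ≤ σ ^ 2 * (3 + R) := by positivity
          exact mul_le_mul_of_nonneg_right (by linarith) hy.le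

lemma measurable_stabInt {β : Type*} [MeasurableSpace β] (s : EuclideanSpace ℝ (Fin d))
    {x z : β → EuclideanSpace ℝ (Fin d)} (hx : Measurable x) (hz : Measurable z) :
    Measurable fun p => stabInt q s (x p) (z p) := by
  have h1 : Measurable fun p => ⟪s, x p⟫_ℝ := measurable_const.inner hx
  have h2 : Measurable fun p => ⟪s, z p⟫_ℝ := measurable_const.inner hz
  exact ((continuous_cexpI.measurable.comp h2).mul
    ((continuous_cexpI.measurable.comp h1).sub measurable_const)).sub
    (measurable_const.mul (Complex.continuous_ofReal.measurable.comp (measurable_const.mul h1)))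

lemma tendsto_stabInt {ι : Type*} {l : Filter ι} {si x z : ι → EuclideanSpace ℝ (Fin d)}
    {s x' z' : EuclideanSpace ℝ (Fin d)} (hs : Tendsto si l (𝓝 s)) (hx : Tendsto x l (𝓝 x'))
    (hz : Tendsto z l (𝓝 z')) :
    Tendsto (fun i => stabInt q (si i) (x i) (z i)) l (𝓝 (stabInt q s x' z')) := by
  have h1 := hs.inner (𝕜 := ℝ) hx
  have h2 := hs.inner (𝕜 := ℝ) hz
  exact (((continuous_cexpI.tendsto _).comp h2).mul
    (((continuous_cexpI.tendsto _).comp h1).sub_const 1)).sub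
    (((Complex.continuous_ofReal.tendsto _).comp (h1.const_mul (q : ℝ))).const_mul Complex.I)

variable [IsProbabilityMeasure P']

/-- Integrability of iterated integrals from a product bound. -/
lemma integrable_iterated {G : Type*} [NormedAddCommGroup G] [NormedSpace ℝ G]
    [MeasurableSpace G] [BorelSpace G] [SecondCountableTopology G]
    (hα : 0 < α) (h1 : (q : ℝ) < α) (h2 : α < q + 1)
    {f : ℝ → Ω' → G} (hf : Measurable (Function.uncurry f)) {g : Ω' → ℝ} (hg : Integrable g P')
    (hb : ∀ y, 0 < y → ∀ᵐ ω ∂P', ‖f y ω‖ ≤ g ω * powDom q y) :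
    (∀ y, 0 < y → Integrable (f y) P') ∧
      Integrable (fun y => ∫ ω, f y ω ∂P') (powMeasure α) := by
  refine ⟨fun y hy => (hg.mul_const _).mono'
    (hf.comp (measurable_const.prodMk measurable_id)).aestronglyMeasurable (hb y hy), ?_⟩
  refine ((integrable_powDom hα h1 h2).const_mul (∫ ω, g ω ∂P')).mono'
    (hf.stronglyMeasurable.integral_prod_right).aestronglyMeasurable ?_
  filter_upwards [ae_powMeasure_pos] with y hy
  refine (norm_integral_le_of_norm_le (hg.mul_const _) (hb y hy)).trans_eq ?_
  rw [integral_mul_const]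

/-- Dominated convergence for iterated integrals of `stabInt`. -/
lemma tendsto_integral_stabInt {ι : Type*} {l : Filter ι} [l.IsCountablyGenerated]
    (hα : 0 < α) (hq : q = 0 ∨ q = 1) (h1 : (q : ℝ) < α) (h2 : α < q + 1)
    {x z : ι → ℝ → Ω' → EuclideanSpace ℝ (Fin d)} {x' z' : ℝ → Ω' → EuclideanSpace ℝ (Fin d)}
    {si : ι → EuclideanSpace ℝ (Fin d)} {s : EuclideanSpace ℝ (Fin d)} {R : Ω' → ℝ}
    (hxm : ∀ i, Measurable (Function.uncurry (x i)))
    (hzm : ∀ i, Measurable (Function.uncurry (z i)))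
    (hR : ∀ ω, 0 ≤ R ω) (hqR : Integrable (fun ω => q * R ω) P')
    (hx : ∀ i y, 0 < y → ∀ᵐ ω ∂P', ‖x i y ω‖ ≤ y)
    (hz : ∀ i y, 0 < y → ∀ᵐ ω ∂P', ‖z i y ω‖ ≤ y * R ω)
    (hs : Tendsto si l (𝓝 s))
    (hxt : ∀ y, 0 < y → ∀ᵐ ω ∂P', Tendsto (fun i => x i y ω) l (𝓝 (x' y ω)))
    (hzt : ∀ y, 0 < y → ∀ᵐ ω ∂P', Tendsto (fun i => z i y ω) l (𝓝 (z' y ω))) :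
    Tendsto (fun i => ∫ y, ∫ ω, stabInt q (si i) (x i y ω) (z i y ω) ∂P' ∂(powMeasure α)) l
      (𝓝 (∫ y, ∫ ω, stabInt q s (x' y ω) (z' y ω) ∂P' ∂(powMeasure α))) := by
  -- The extra 1 lets one dominating function serve all `si i` close to `s`.
  set σ := ‖s‖ + 1 with hσ
  set g : Ω' → ℝ := fun ω => 2 + σ + q * (σ ^ 2 * (3 + R ω)) with hg
  have hgi : Integrable g P' := by
    have e : g = fun ω => (2 + σ + q * (σ ^ 2 * 3)) + σ ^ 2 * (q * R ω) := by
      ext ω; simp only [hg]; ring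
    rw [e]
    exact (integrable_const _).add (hqR.const_mul _)
  have hsσ : ∀ᶠ i in l, ‖si i‖ ≤ σ :=
    hs.norm.eventually_le_const (by rw [hσ]; linarith)
  have hb : ∀ᶠ i in l, ∀ y, 0 < y →
      ∀ᵐ ω ∂P', ‖stabInt q (si i) (x i y ω) (z i y ω)‖ ≤ g ω * powDom q y := by
    filter_upwards [hsσ] with i hi y hy
    filter_upwards [hx i y hy, hz i y hy] with ω h3 h4
    exact norm_stabInt_le hq hy (hR ω) hi h3 h4
  have hm : ∀ i, Measurable (Function.uncurry fun y ω => stabInt q (si i) (x i y ω) (z i y ω)) :=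
    fun i => measurable_stabInt (si i) (hxm i) (hzm i)
  refine tendsto_integral_filter_of_dominated_convergence
    (fun y => (∫ ω, g ω ∂P') * powDom q y) ?_ ?_ ((integrable_powDom hα h1 h2).const_mul _) ?_
  · exact Eventually.of_forall fun i =>
      ((hm i).stronglyMeasurable.integral_prod_right).aestronglyMeasurable
  · filter_upwards [hb] with i hi
    filter_upwards [ae_powMeasure_pos] with y hy
    refine (norm_integral_le_of_norm_le (hgi.mul_const _) (hi y hy)).trans_eq ?_
    rw [integral_mul_const]
  · filter_upwards [ae_powMeasure_pos] with y hy
    refine tendsto_integral_filter_of_dominated_convergence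
      (fun ω => g ω * powDom q y) ?_ ?_ (hgi.mul_const _) ?_
    · exact Eventually.of_forall fun i =>
        ((hm i).comp (measurable_const.prodMk measurable_id)).aestronglyMeasurable
    · filter_upwards [hb] with i hi
      exact hi y hy
    · filter_upwards [hxt y hy, hzt y hy] with ω h3 h4
      exact tendsto_stabInt hs h3 h4

/-- At a fixed nonzero point the truncation is the identity as soon as `ε` and the width are each
below half the norm. The limit is joint in both parameters. -/
lemma tendsto_softTrunc (x : EuclideanSpace ℝ (Fin d)) :
    Tendsto (fun i : ℝ × ℕ => softTrunc i.1 (sharpness i.2) x) (𝓝[>] (0 : ℝ) ×ˢ atTop) (𝓝 x) := by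
  rcases eq_or_ne x 0 with rfl | hx
  · simp [softTrunc]
  · have hx0 : 0 < ‖x‖ / 2 := by positivity
    have h1 : ∀ᶠ ε : ℝ in 𝓝[>] 0, ε < ‖x‖ / 2 :=
      (eventually_lt_nhds hx0).filter_mono nhdsWithin_le_nhds
    have h2 : ∀ᶠ k : ℕ in atTop, (sharpness k)⁻¹ < ‖x‖ / 2 := by
      have h1 : Tendsto (fun k : ℕ => ((k : ℝ) + 1)⁻¹) atTop (𝓝 0) :=
        tendsto_inv_atTop_zero.comp (tendsto_atTop_add_const_right _ _ tendsto_natCast_atTop_atTop)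
      have := h1.pow 2
      refine Tendsto.eventually_lt_const hx0 ?_
      simpa [sharpness] using this
    refine tendsto_const_nhds.congr' ?_
    filter_upwards [h1.prod_mk h2] with i hi
    exact (softTrunc_eq_self (sharpness_pos _) (by linarith [hi.1, hi.2])).symm

variable {Θ : ℤ → Ω' → EuclideanSpace ℝ (Fin d)}

/-- Dominated convergence for series: truncation does not increase norms, so the terms are bounded
by `y * ‖θ t‖`. -/
lemma tendsto_sum_softTrunc {θ : ℕ → EuclideanSpace ℝ (Fin d)} (hθ : Summable fun t => ‖θ t‖)
    {y : ℝ} (hy : 0 < y) :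
    Tendsto (fun i : ℝ × ℕ => ∑ t ∈ Finset.range i.2, softTrunc i.1 (sharpness i.2) (y • θ t))
      (𝓝[>] (0 : ℝ) ×ˢ atTop) (𝓝 (y • ∑' t, θ t)) := by
  have e : ∀ i : ℝ × ℕ, ∑ t ∈ Finset.range i.2, softTrunc i.1 (sharpness i.2) (y • θ t)
      = ∑' t, if t < i.2 then softTrunc i.1 (sharpness i.2) (y • θ t) else 0 := fun i => by
    rw [tsum_eq_sum (s := Finset.range i.2) fun t ht => if_neg (by simpa using ht)]
    exact Finset.sum_congr rfl fun t ht => (if_pos (Finset.mem_range.mp ht)).symm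
  simp only [e]
  rw [← tsum_const_smul'' y]
  refine tendsto_tsum_of_dominated_convergence (hθ.mul_left y) (fun t => ?_)
    (Eventually.of_forall fun i t => ?_)
  · refine (tendsto_softTrunc (y • θ t)).congr' ?_
    filter_upwards [(eventually_gt_atTop t).prod_inr (𝓝[>] (0 : ℝ))] with i hi
    rw [if_pos hi]
  · split_ifs
    · refine (norm_softTrunc_le _ _ _).trans_eq ?_
      rw [norm_smul, Real.norm_of_nonneg hy.le]
    · rw [norm_zero]; positivity

end StableExponent

/-! ### The limiting exponent and its approximations. -/

section StableExponent

variable {Ω' : Type*} [MeasurableSpace Ω'] {d : ℕ} {P' : Measure Ω'} [IsProbabilityMeasure P']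
  {α : ℝ} {Θ : ℤ → Ω' → EuclideanSpace ℝ (Fin d)}

/-- The order of the compensator in the exponent of the `α`-stable law. -/
noncomputable def compOrder (α : ℝ) : ℕ := if α < 1 then 0 else 1

lemma compOrder_eq (α : ℝ) : compOrder α = 0 ∨ compOrder α = 1 := by
  unfold compOrder; split_ifs <;> simp

lemma compOrder_of_lt {α : ℝ} (h : α < 1) : compOrder α = 0 := if_pos h

lemma compOrder_of_gt {α : ℝ} (h : 1 < α) : compOrder α = 1 := if_neg (not_lt.mpr h.le)

lemma compOrder_lt (hα : α ∈ Ioo (0 : ℝ) 2) (hα1 : α ≠ 1) : (compOrder α : ℝ) < α := by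
  rcases lt_or_gt_of_ne hα1 with h | h
  · rw [compOrder_of_lt h]; simpa using hα.1
  · rw [compOrder_of_gt h]; simpa using h

lemma lt_compOrder_add_one (hα : α ∈ Ioo (0 : ℝ) 2) (hα1 : α ≠ 1) : α < compOrder α + 1 := by
  rcases lt_or_gt_of_ne hα1 with h | h
  · rw [compOrder_of_lt h]; simpa using h
  · rw [compOrder_of_gt h]; norm_num; exact hα.2

/-- `∑_{j ≥ 1} |Θ_j|`. -/
noncomputable def absTailSum (Θ : ℤ → Ω' → EuclideanSpace ℝ (Fin d)) (ω : Ω') : ℝ :=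
  ∑' t : ℕ, ‖Θ ((t : ℤ) + 1) ω‖

omit [MeasurableSpace Ω'] in
lemma absTailSum_nonneg (ω : Ω') : 0 ≤ absTailSum Θ ω :=
  tsum_nonneg fun _ => norm_nonneg _

/-- The properties of the spectral tail process that make the limiting exponent well defined. -/
structure IsSummableSpectral (P' : Measure Ω') (α : ℝ)
    (Θ : ℤ → Ω' → EuclideanSpace ℝ (Fin d)) : Prop where
  measurable : ∀ t, Measurable (Θ t)
  index_mem : α ∈ Ioo (0 : ℝ) 2
  index_ne : α ≠ 1
  norm_eq_one : ∀ᵐ ω ∂P', ‖Θ 0 ω‖ = 1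
  summable : ∀ᵐ ω ∂P', Summable fun t : ℕ => ‖Θ ((t : ℤ) + 1) ω‖
  integrable : Integrable (fun ω => compOrder α * absTailSum Θ ω) P'

omit [IsProbabilityMeasure P'] in
-- The series converges only almost everywhere, so its sum is a priori only a.e. measurable; `S` is
-- a measurable version used for the product measurability of the integrand.
lemma IsSummableSpectral.exists_measurable (h : IsSummableSpectral P' α Θ) :
    ∃ S : Ω' → EuclideanSpace ℝ (Fin d), Measurable S ∧
      ∀ᵐ ω ∂P', ∑' t : ℕ, Θ ((t : ℤ) + 1) ω = S ω := by
  have hm : AEMeasurable (fun ω => ∑' t : ℕ, Θ ((t : ℤ) + 1) ω) P' := by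
    refine aemeasurable_of_tendsto_metrizable_ae atTop
      (f := fun n ω => ∑ t ∈ Finset.range n, Θ ((t : ℤ) + 1) ω)
      (fun n => (Finset.measurable_sum _ fun t _ => h.measurable _).aemeasurable) ?_
    filter_upwards [h.summable] with ω hω
    exact hω.of_norm.hasSum.tendsto_sum_nat
  exact ⟨hm.mk _, hm.measurable_mk, hm.ae_eq_mk⟩

/-- The exponent of the limiting stable characteristic function. -/
noncomputable def stabExponent (P' : Measure Ω') (α : ℝ) (Θ : ℤ → Ω' → EuclideanSpace ℝ (Fin d))
    (s : EuclideanSpace ℝ (Fin d)) : ℂ :=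
  ∫ y, (∫ ω, stableIntegrand α Θ s y ω ∂P') ∂(powMeasure α)

/-- The exponent at truncation level `ε`, with `k` terms. -/
noncomputable def softExponent (P' : Measure Ω') (α : ℝ)
    (Θ : ℤ → Ω' → EuclideanSpace ℝ (Fin d)) (s : EuclideanSpace ℝ (Fin d)) (ε : ℝ) (k : ℕ) : ℂ :=
  ∫ y : ℝ, ∫ ω, jump (softTrunc ε (sharpness k)) s k (fun t => y • Θ t ω) ∂P' ∂(powMeasure α)
    - Complex.I * ((compOrder α * ∫ y : ℝ, ∫ ω,
      ⟪s, softTrunc ε (sharpness k) (y • Θ 0 ω)⟫_ℝ ∂P' ∂(powMeasure α) : ℝ) : ℂ)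

namespace IsSummableSpectral

variable (h : IsSummableSpectral P' α Θ) {S : Ω' → EuclideanSpace ℝ (Fin d)}
  (hS : Measurable S) (hSe : ∀ᵐ ω ∂P', ∑' t : ℕ, Θ ((t : ℤ) + 1) ω = S ω)

include h

omit [IsProbabilityMeasure P'] in
lemma pos : 0 < α := h.index_mem.1

omit [IsProbabilityMeasure P'] in
lemma lt : (compOrder α : ℝ) < α := compOrder_lt h.index_mem h.index_ne

omit [IsProbabilityMeasure P'] in
lemma lt_add_one : α < compOrder α + 1 := lt_compOrder_add_one h.index_mem h.index_ne

omit [IsProbabilityMeasure P'] in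
lemma ae_summable : ∀ᵐ ω ∂P', Summable fun j : ℕ => Θ (j : ℤ) ω := by
  filter_upwards [h.summable] with ω hω
  rw [← summable_nat_add_iff 1]
  simpa using hω.of_norm

omit [IsProbabilityMeasure P'] in
lemma norm_smul_zero_le {y : ℝ} (hy : 0 < y) : ∀ᵐ ω ∂P', ‖y • Θ 0 ω‖ = y := by
  filter_upwards [h.norm_eq_one] with ω hω
  rw [norm_smul, hω, mul_one, Real.norm_of_nonneg hy.le]

include hSe

omit [IsProbabilityMeasure P'] in
lemma norm_smul_tailSum_le {y : ℝ} (hy : 0 < y) :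
    ∀ᵐ ω ∂P', ‖y • S ω‖ ≤ y * absTailSum Θ ω := by
  filter_upwards [h.summable, hSe] with ω hω hωS
  rw [norm_smul, Real.norm_of_nonneg hy.le, ← hωS]
  gcongr
  exact norm_tsum_le_tsum_norm hω

omit [IsProbabilityMeasure P'] in
-- Where the series converges, its sum from 0 is `Θ 0` plus the rest, so the difference of
-- exponentials factors. The exceptional null set does not depend on `s` or `y`.
lemma stableIntegrand_ae_eq : ∀ᵐ ω ∂P', ∀ s y, stableIntegrand α Θ s y ω
    = stabInt (compOrder α) s (y • Θ 0 ω) (y • S ω) := by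
  filter_upwards [h.ae_summable, hSe] with ω hω hωS s y
  have e : ∑' j : ℕ, Θ (j : ℤ) ω = Θ 0 ω + S ω := by
    rw [hω.tsum_eq_zero_add, ← hωS]; simp
  have ec : y * ⟪s, if α < 1 then 0 else Θ 0 ω⟫_ℝ = compOrder α * ⟪s, y • Θ 0 ω⟫_ℝ := by
    unfold compOrder
    split_ifs <;> simp [inner_smul_right]
  change cexpI _ - cexpI _ - Complex.I * ((y * ⟪s, if α < 1 then 0 else Θ 0 ω⟫_ℝ : ℝ) : ℂ) = _
  rw [ec, e, hωS, stabInt, inner_add_right, mul_add, cexpI_add, inner_smul_right, inner_smul_right]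
  ring

include hS

omit hSe in
omit [IsProbabilityMeasure P'] in
lemma measurable_uncurry (s : EuclideanSpace ℝ (Fin d)) :
    Measurable (Function.uncurry fun (y : ℝ) ω =>
      stabInt (compOrder α) s (y • Θ 0 ω) (y • S ω)) :=
  measurable_stabInt s (measurable_fst.smul ((h.measurable 0).comp measurable_snd))
    (measurable_fst.smul (hS.comp measurable_snd))

lemma integrable_stabInt (s : EuclideanSpace ℝ (Fin d)) :
    (∀ y : ℝ, 0 < y → Integrable (fun ω => stabInt (compOrder α) s (y • Θ 0 ω) (y • S ω)) P') ∧
      Integrable (fun y : ℝ => ∫ ω, stabInt (compOrder α) s (y • Θ 0 ω) (y • S ω) ∂P')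
        (powMeasure α) := by
  refine integrable_iterated h.pos h.lt h.lt_add_one (h.measurable_uncurry hS s)
    (g := fun ω => 2 + ‖s‖ + compOrder α * (‖s‖ ^ 2 * (3 + absTailSum Θ ω))) ?_ ?_
  · have e : (fun ω => 2 + ‖s‖ + compOrder α * (‖s‖ ^ 2 * (3 + absTailSum Θ ω)))
        = fun ω => (2 + ‖s‖ + compOrder α * (‖s‖ ^ 2 * 3))
          + ‖s‖ ^ 2 * (compOrder α * absTailSum Θ ω) := by
      ext ω; ring
    rw [e]
    exact (integrable_const _).add (h.integrable.const_mul _)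
  · intro y hy
    filter_upwards [h.norm_smul_zero_le hy, h.norm_smul_tailSum_le hSe hy] with ω h1 h2
    exact norm_stabInt_le (compOrder_eq α) hy (absTailSum_nonneg ω) le_rfl h1.le h2

omit hS [IsProbabilityMeasure P'] in
lemma stabExponent_eq (s : EuclideanSpace ℝ (Fin d)) : stabExponent P' α Θ s
    = ∫ y : ℝ, ∫ ω, stabInt (compOrder α) s (y • Θ 0 ω) (y • S ω) ∂P' ∂(powMeasure α) := by
  refine integral_congr_ae (ae_of_all _ fun y => integral_congr_ae ?_)
  filter_upwards [h.stableIntegrand_ae_eq hSe] with ω hω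
  exact hω s y

omit hS hSe

lemma integrable_stableIntegrand (s : EuclideanSpace ℝ (Fin d)) :
    (∀ y : ℝ, 0 < y → Integrable (stableIntegrand α Θ s y) P') ∧
      Integrable (fun y : ℝ => ∫ ω, stableIntegrand α Θ s y ω ∂P') (powMeasure α) := by
  obtain ⟨S, hS, hSe⟩ := h.exists_measurable
  obtain ⟨h1, h2⟩ := h.integrable_stabInt hS hSe s
  have he := h.stableIntegrand_ae_eq hSe
  refine ⟨fun y hy => (h1 y hy).congr ?_, h2.congr (ae_of_all _ fun y => integral_congr_ae ?_)⟩
  · filter_upwards [he] with ω hω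
    exact (hω s y).symm
  · filter_upwards [he] with ω hω
    exact (hω s y).symm

/-- Needed at 0 for Lévy's theorem. -/
lemma continuous_stabExponent : Continuous (stabExponent P' α Θ) := by
  obtain ⟨S, hS, hSe⟩ := h.exists_measurable
  rw [continuous_iff_continuousAt]
  intro s
  have := tendsto_integral_stabInt (l := 𝓝 s) (P' := P') h.pos (compOrder_eq α) h.lt h.lt_add_one
    (x := fun _ y ω => y • Θ 0 ω) (z := fun _ y ω => y • S ω) (x' := fun y ω => y • Θ 0 ω)
    (z' := fun y ω => y • S ω) (si := id) (R := absTailSum Θ)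
    (fun _ => measurable_fst.smul ((h.measurable 0).comp measurable_snd))
    (fun _ => measurable_fst.smul (hS.comp measurable_snd)) absTailSum_nonneg h.integrable
    (fun _ y hy => (h.norm_smul_zero_le hy).mono fun ω hω => hω.le)
    (fun _ y hy => h.norm_smul_tailSum_le hSe hy) tendsto_id
    (fun y hy => ae_of_all _ fun ω => tendsto_const_nhds)
    (fun y hy => ae_of_all _ fun ω => tendsto_const_nhds)
  rw [funext (h.stabExponent_eq hSe)]
  exact this

omit [IsProbabilityMeasure P'] in
-- A factor on `s` can be moved to `y`, where it is absorbed by the scaling of the measure; this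
-- works because the compensator is exactly linear, without a cut-off.
lemma stabExponent_smul {b : ℝ} (hb : 0 < b) (s : EuclideanSpace ℝ (Fin d)) :
    stabExponent P' α Θ (b • s) = (b ^ α : ℝ) * stabExponent P' α Θ s := by
  obtain ⟨S, hS, hSe⟩ := h.exists_measurable
  rw [h.stabExponent_eq hSe, h.stabExponent_eq hSe]
  have e : ∀ (y : ℝ) ω, stabInt (compOrder α) (b • s) (y • Θ 0 ω) (y • S ω)
      = stabInt (compOrder α) s ((b * y) • Θ 0 ω) ((b * y) • S ω) := fun y ω => by
    simp only [stabInt, real_inner_smul_left, inner_smul_right]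
    ring_nf
  simp only [e]
  rw [integral_powMeasure_comp_mul h.pos
    (fun y => ∫ ω, stabInt (compOrder α) s (y • Θ 0 ω) (y • S ω) ∂P') hb, Complex.real_smul]

/-- Jump and compensator may be integrated separately here, since both vanish for `y ≤ ε`; without
truncation only their difference is controlled near 0. Merging them prepares the passage to the
limit. -/
lemma softExponent_eq (s : EuclideanSpace ℝ (Fin d)) {ε : ℝ} (hε : 0 < ε) (k : ℕ) :
    softExponent P' α Θ s ε k = ∫ y : ℝ, ∫ ω, stabInt (compOrder α) s
      (softTrunc ε (sharpness k) (y • Θ 0 ω))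
      (∑ t ∈ Finset.range k, softTrunc ε (sharpness k) (y • Θ ((t : ℤ) + 1) ω)) ∂P'
        ∂(powMeasure α) := by
  have hj : ∀ (y : ℝ) ω, stabInt (compOrder α) s (softTrunc ε (sharpness k) (y • Θ 0 ω))
      (∑ t ∈ Finset.range k, softTrunc ε (sharpness k) (y • Θ ((t : ℤ) + 1) ω))
      = jump (softTrunc ε (sharpness k)) s k (fun t => y • Θ t ω)
        - Complex.I * ((compOrder α * ⟪s, softTrunc ε (sharpness k) (y • Θ 0 ω)⟫_ℝ : ℝ) : ℂ) := by
    intro y ω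
    rw [jump_eq_mul, stabInt]
    simp
  rw [softExponent]
  simp only [hj]
  rcases compOrder_eq α with hq | hq
  · simp [hq]
  have hα : (compOrder α : ℝ) = 1 := by rw [hq]; simp
  have hl1 := h.lt
  have hl2 := h.lt_add_one
  rw [hα] at hl1 hl2
  simp only [hα, one_mul]
  have hinv : 0 < ε⁻¹ := by positivity
  -- Beyond `ε` one has `1 ≤ (1 + ε⁻¹) * y`. Squaring it compensates for the `y ^ 2` of `powDom 1`
  -- on `(0, 1]`.
  have hdom : ∀ y : ℝ, 0 < y → ε < y →
      1 ≤ (1 + ε⁻¹) ^ 2 * powDom 1 y ∧ y ≤ (1 + ε⁻¹) ^ 2 * powDom 1 y := by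
    intro y hy hyε
    have h1 : 1 ≤ (1 + ε⁻¹) * y := by
      have : 1 ≤ ε⁻¹ * y := by rw [inv_mul_eq_div, one_le_div hε]; exact hyε.le
      nlinarith
    have h2 : 1 ≤ 1 + ε⁻¹ := by linarith
    have h3 : 1 ≤ (1 + ε⁻¹) ^ 2 := one_le_pow₀ h2
    unfold powDom
    split_ifs with hy1
    · have h4 : y ≤ (1 + ε⁻¹) * y * y := by nlinarith
      have h5 : 1 ≤ ((1 + ε⁻¹) * y) ^ 2 := one_le_pow₀ h1
      constructor
      · simp only [Nat.reduceAdd]; nlinarith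
      · simp only [Nat.reduceAdd]
        calc y ≤ 1 * ((1 + ε⁻¹) * y * y) := by linarith
          _ ≤ (1 + ε⁻¹) * ((1 + ε⁻¹) * y * y) := by gcongr
          _ = _ := by ring
    · have : 1 < y := not_le.mp hy1
      rw [pow_one]
      constructor <;> nlinarith
  have hjm : Measurable (Function.uncurry fun (y : ℝ) ω =>
      jump (softTrunc ε (sharpness k)) s k (fun t => y • Θ t ω)) :=
    (measurable_jump (continuous_softTrunc _ _).measurable k).comp
      (measurable_pi_lambda (fun (p : ℝ × Ω') (t : ℕ) => p.1 • Θ t p.2) fun t =>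
        measurable_fst.smul ((h.measurable t).comp measurable_snd))
  have hlm : Measurable (Function.uncurry fun (y : ℝ) ω =>
      ⟪s, softTrunc ε (sharpness k) (y • Θ 0 ω)⟫_ℝ) :=
    measurable_const.inner ((continuous_softTrunc _ _).measurable.comp
      (measurable_fst.smul ((h.measurable 0).comp measurable_snd)))
  have hj0 : ∀ y, 0 < y → ∀ᵐ ω ∂P', ‖jump (softTrunc ε (sharpness k)) s k (fun t => y • Θ t ω)‖
      ≤ 2 * (1 + ε⁻¹) ^ 2 * powDom 1 y := by
    intro y hy
    filter_upwards [h.norm_smul_zero_le hy] with ω hω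
    rcases le_or_gt y ε with h1 | h1
    · have h0 : softTrunc ε (sharpness k) (y • Θ ((0 : ℕ) : ℤ) ω) = 0 :=
        softTrunc_eq_zero (sharpness_pos k).le (by rw [Nat.cast_zero, hω]; exact h1)
      rw [jump_eq_zero h0, norm_zero]
      have := powDom_nonneg (q := 1) hy
      positivity
    · refine (norm_jump_le_two _ _).trans ?_
      linarith [(hdom y hy h1).1]
  have hl0 : ∀ y, 0 < y → ∀ᵐ ω ∂P', ‖⟪s, softTrunc ε (sharpness k) (y • Θ 0 ω)⟫_ℝ‖
      ≤ ‖s‖ * (1 + ε⁻¹) ^ 2 * powDom 1 y := by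
    intro y hy
    filter_upwards [h.norm_smul_zero_le hy] with ω hω
    rcases le_or_gt y ε with h1 | h1
    · rw [softTrunc_eq_zero (sharpness_pos k).le (by rw [hω]; exact h1), inner_zero_right, norm_zero]
      have := powDom_nonneg (q := 1) hy
      positivity
    · calc _ ≤ ‖s‖ * ‖softTrunc ε (sharpness k) (y • Θ 0 ω)‖ := norm_inner_le_norm _ _
        _ ≤ ‖s‖ * y := by gcongr; exact (norm_softTrunc_le _ _ _).trans_eq hω
        _ ≤ ‖s‖ * ((1 + ε⁻¹) ^ 2 * powDom 1 y) := by gcongr; exact (hdom y hy h1).2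
        _ = _ := by ring
  obtain ⟨hj1, hj2⟩ := integrable_iterated (q := 1) h.pos (by simpa using hl1)
    (by simpa using hl2) hjm (integrable_const _) hj0
  obtain ⟨hk1, hk2⟩ := integrable_iterated (q := 1) h.pos (by simpa using hl1)
    (by simpa using hl2) hlm (integrable_const _) hl0
  have e1 : Complex.I * ((∫ y : ℝ, ∫ ω, ⟪s, softTrunc ε (sharpness k) (y • Θ 0 ω)⟫_ℝ ∂P'
      ∂(powMeasure α) : ℝ) : ℂ) = ∫ y : ℝ, Complex.I * ((∫ ω, ⟪s, softTrunc ε (sharpness k)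
        (y • Θ 0 ω)⟫_ℝ ∂P' : ℝ) : ℂ) ∂(powMeasure α) := by
    rw [integral_const_mul]
    congr 1
    exact (integral_ofReal (𝕜 := ℂ)).symm
  have hk1' : ∀ y : ℝ, 0 < y → Integrable (fun ω => Complex.I *
      ((⟪s, softTrunc ε (sharpness k) (y • Θ 0 ω)⟫_ℝ : ℝ) : ℂ)) P' := fun y hy =>
    ((hk1 y hy).ofReal (𝕜 := ℂ)).const_mul Complex.I
  have hk2' : Integrable (fun y : ℝ => Complex.I * ((∫ ω, ⟪s, softTrunc ε (sharpness k)
      (y • Θ 0 ω)⟫_ℝ ∂P' : ℝ) : ℂ)) (powMeasure α) := (hk2.ofReal (𝕜 := ℂ)).const_mul Complex.I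
  rw [e1, ← integral_sub hj2 hk2']
  refine integral_congr_ae ?_
  filter_upwards [ae_powMeasure_pos] with y hy
  rw [integral_sub (hj1 y hy) (hk1' y hy), integral_const_mul]
  congr 2
  exact (integral_ofReal (𝕜 := ℂ)).symm

/-- Truncation contracts norms, so the approximating integrands obey the same bound as the limit,
with `R = ∑_{j ≥ 1} |Θ_j|`, uniformly in `(ε, k)`. -/
theorem tendsto_softExponent (s : EuclideanSpace ℝ (Fin d)) :
    Tendsto (fun i : ℝ × ℕ => softExponent P' α Θ s i.1 i.2) (𝓝[>] (0 : ℝ) ×ˢ atTop)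
      (𝓝 (stabExponent P' α Θ s)) := by
  obtain ⟨S, hS, hSe⟩ := h.exists_measurable
  rw [h.stabExponent_eq hSe]
  have hlim := tendsto_integral_stabInt (l := 𝓝[>] (0 : ℝ) ×ˢ (atTop : Filter ℕ)) (P' := P')
    h.pos (compOrder_eq α) h.lt h.lt_add_one
    (x := fun i y ω => softTrunc i.1 (sharpness i.2) (y • Θ 0 ω))
    (z := fun i y ω => ∑ t ∈ Finset.range i.2,
      softTrunc i.1 (sharpness i.2) (y • Θ ((t : ℤ) + 1) ω))
    (x' := fun y ω => y • Θ 0 ω) (z' := fun y ω => y • S ω) (si := fun _ => s)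
    (R := absTailSum Θ)
    (fun i => (continuous_softTrunc _ _).measurable.comp
      (measurable_fst.smul ((h.measurable 0).comp measurable_snd)))
    (fun i => Finset.measurable_sum _ fun t _ => (continuous_softTrunc _ _).measurable.comp
      (measurable_fst.smul ((h.measurable _).comp measurable_snd)))
    absTailSum_nonneg h.integrable
    (fun i y hy => (h.norm_smul_zero_le hy).mono fun ω hω => (norm_softTrunc_le _ _ _).trans hω.le)
    (fun i y hy => ?_) tendsto_const_nhds
    (fun y hy => ae_of_all _ fun ω => tendsto_softTrunc _) (fun y hy => ?_)
  · refine hlim.congr' ?_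
    have hpos : ∀ᶠ i in 𝓝[>] (0 : ℝ) ×ˢ (atTop : Filter ℕ), 0 < i.1 :=
      (eventually_mem_nhdsWithin (a := (0 : ℝ)) (s := Ioi 0)).prod_inl (atTop : Filter ℕ)
    filter_upwards [hpos] with i hi
    exact (h.softExponent_eq s hi i.2).symm
  · filter_upwards [h.summable] with ω hω
    calc _ ≤ ∑ t ∈ Finset.range i.2, y * ‖Θ ((t : ℤ) + 1) ω‖ := by
          refine norm_sum_le_of_le _ fun t _ => (norm_softTrunc_le _ _ _).trans_eq ?_
          rw [norm_smul, Real.norm_of_nonneg hy.le]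
      _ = y * ∑ t ∈ Finset.range i.2, ‖Θ ((t : ℤ) + 1) ω‖ := by rw [Finset.mul_sum]
      _ ≤ y * absTailSum Θ ω := by
          gcongr
          exact hω.sum_le_tsum _ fun _ _ => norm_nonneg _
  · filter_upwards [h.summable, hSe] with ω hω hωS
    rw [← hωS]
    exact tendsto_sum_softTrunc hω hy

end IsSummableSpectral

end StableExponent

/-! ### Summability of the spectral tail process for `α < 1`. -/

section Counting

variable {Ω Ω' : Type*} [MeasurableSpace Ω] [MeasurableSpace Ω'] {d : ℕ}
  {P : Measure Ω} [IsProbabilityMeasure P] {P' : Measure Ω'} [IsProbabilityMeasure P']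
  {X : ℤ → Ω → EuclideanSpace ℝ (Fin d)} {Θ : ℤ → Ω' → EuclideanSpace ℝ (Fin d)} {α : ℝ}

/-- A finite set of naturals in which no two elements are at distance `K` or more has at most
`K` elements. -/
lemma card_le_of_forall_lt_add {J : Finset ℕ} {K : ℕ} (h : ∀ i ∈ J, ∀ j ∈ J, j < i + K) :
    J.card ≤ K := by
  rcases J.eq_empty_or_nonempty with rfl | hJ
  · simp
  · have hsub : J ⊆ Finset.Ico (J.min' hJ) (J.min' hJ + K) := fun j hj =>
      Finset.mem_Ico.mpr ⟨J.min'_le j hj, h _ (J.min'_mem hJ) j hj⟩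
    simpa using Finset.card_le_card hsub

/-- Comparison of the number of large clusters in a block with the total mass of the block. -/
lemma IsStrictlyStationary.mul_cluster_le (hstat : IsStrictlyStationary P X)
    (hX : ∀ t, Measurable (X t)) (c r : ℝ) (k K m : ℕ) :
    ((m - k : ℕ) : ℝ) * P.real {ω | c < ‖X 0 ω‖ ∧ r < ∑ t ∈ Finset.range (k + 1), ‖X (t : ℤ) ω‖}
      ≤ m * P.real {ω | c < ‖X 0 ω‖ ∧ ∃ i ∈ Finset.Icc K m, c < ‖X (i : ℤ) ω‖}
        + K * P.real {ω | r < ∑ t ∈ Finset.range m, ‖X ((t : ℤ) + 1) ω‖} := by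
  let SB : Set (ℤ → EuclideanSpace ℝ (Fin d)) :=
    {z | c < ‖z 0‖ ∧ r < ∑ t ∈ Finset.range (k + 1), ‖z (t : ℤ)‖}
  let SD : Set (ℤ → EuclideanSpace ℝ (Fin d)) :=
    {z | c < ‖z 0‖ ∧ ∃ i ∈ Finset.Icc K m, c < ‖z (i : ℤ)‖}
  have hSc : ∀ t : ℤ, MeasurableSet {z : ℤ → EuclideanSpace ℝ (Fin d) | c < ‖z t‖} := fun t =>
    measurableSet_lt measurable_const (measurable_pi_apply t).norm
  have hSr : MeasurableSet {z : ℤ → EuclideanSpace ℝ (Fin d) |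
      r < ∑ t ∈ Finset.range (k + 1), ‖z (t : ℤ)‖} := measurableSet_lt measurable_const
    (Finset.measurable_sum _ fun t _ => (measurable_pi_apply (t : ℤ)).norm)
  have hSB : MeasurableSet SB := (hSc 0).inter hSr
  have hSD : MeasurableSet SD := by
    have : SD = {z | c < ‖z 0‖} ∩ ⋃ i ∈ Finset.Icc K m, {z | c < ‖z (i : ℤ)‖} := by
      ext z; simp [SD]
    rw [this]
    exact (hSc 0).inter (Finset.measurableSet_biUnion _ fun i _ => hSc i)
  have hsh : ∀ j : ℕ, Measurable fun ω (t : ℤ) => X (t + (j + 1)) ω := fun j =>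
    measurable_pi_lambda _ fun t => hX _
  -- The cluster starts at time `j + 1`; with `j < m - k` its `k + 1` terms stay within times `1, …,
  -- m`.
  let B : ℕ → Set Ω := fun j => {ω | (fun t : ℤ => X (t + (j + 1)) ω) ∈ SB}
  let D : ℕ → Set Ω := fun j => {ω | (fun t : ℤ => X (t + (j + 1)) ω) ∈ SD}
  have hB : ∀ j, MeasurableSet (B j) := fun j => hsh j hSB
  have hD : ∀ j, MeasurableSet (D j) := fun j => hsh j hSD
  have hPB : ∀ j, P.real (B j)
      = P.real {ω | c < ‖X 0 ω‖ ∧ r < ∑ t ∈ Finset.range (k + 1), ‖X (t : ℤ) ω‖} := fun j =>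
    hstat.measureReal_shift hX _ hSB
  have hPD : ∀ j, P.real (D j)
      = P.real {ω | c < ‖X 0 ω‖ ∧ ∃ i ∈ Finset.Icc K m, c < ‖X (i : ℤ) ω‖} := fun j =>
    hstat.measureReal_shift hX _ hSD
  set E : Set Ω := {ω | r < ∑ t ∈ Finset.range m, ‖X ((t : ℤ) + 1) ω‖} with hE
  have hEm : MeasurableSet E := measurableSet_lt measurable_const
    (Finset.measurable_sum _ fun t _ => (hX _).norm)
  -- Pointwise count: if `j` and `j + K` or later both start a cluster, the former belongs to `D`.
  -- So at most `K` indices lie in some `B j \ D j`, and there are none outside `E`, because a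
  -- cluster is part of the block.
  have hcount : ∑ j ∈ Finset.range (m - k), P.real (B j \ D j) ≤ K * P.real E := by
    have e1 : ∀ A : Set Ω, MeasurableSet A → P.real A = ∫ ω, A.indicator (fun _ => (1 : ℝ)) ω ∂P :=
      fun A hA => by rw [integral_indicator_const _ hA, smul_eq_mul, mul_one]
    have hi : ∀ A : Set Ω, MeasurableSet A →
        Integrable (fun ω => A.indicator (fun _ => (1 : ℝ)) ω) P :=
      fun A hA => (integrable_const _).indicator hA
    rw [Finset.sum_congr rfl fun j _ => e1 _ ((hB j).diff (hD j)), e1 E hEm,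
      ← integral_finsetSum _ fun j _ => hi _ ((hB j).diff (hD j)), ← integral_const_mul]
    refine integral_mono (integrable_finsetSum _ fun j _ => hi _ ((hB j).diff (hD j)))
      ((hi E hEm).const_mul _) fun ω => ?_
    classical
    set J := {j ∈ Finset.range (m - k) | ω ∈ B j \ D j} with hJ
    have hsum : ∑ j ∈ Finset.range (m - k), (B j \ D j).indicator (fun _ => (1 : ℝ)) ω = J.card := by
      simp only [indicator_apply]
      rw [← Finset.sum_filter]
      simp [hJ]
    have hcard : J.card ≤ K := by
      refine card_le_of_forall_lt_add fun i hi j hj => ?_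
      by_contra hij
      rw [hJ, Finset.mem_filter, Finset.mem_range] at hi hj
      refine hi.2.2 ⟨hi.2.1.1, j - i, Finset.mem_Icc.mpr ⟨by omega, by omega⟩, ?_⟩
      have hcj : c < ‖X (0 + (j + 1)) ω‖ := hj.2.1.1
      have : (((j - i : ℕ) : ℤ) + (i + 1)) = 0 + (j + 1) := by omega
      change c < ‖X (((j - i : ℕ) : ℤ) + (i + 1)) ω‖
      rw [this]
      exact hcj
    simp only [hsum]
    by_cases hω : ω ∈ E
    · rw [indicator_of_mem hω, mul_one]
      exact_mod_cast hcard
    · have : J = ∅ := by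
        refine Finset.eq_empty_of_forall_notMem fun j hj => hω ?_
        rw [hJ, Finset.mem_filter, Finset.mem_range] at hj
        refine lt_of_lt_of_le hj.2.1.2 ?_
        have e : ∑ t ∈ Finset.range (k + 1), ‖X ((t : ℤ) + (j + 1)) ω‖
            = ∑ t ∈ Finset.Ico j (j + (k + 1)), ‖X ((t : ℤ) + 1) ω‖ := by
          rw [Finset.sum_Ico_eq_sum_range, Nat.add_sub_cancel_left]
          refine Finset.sum_congr rfl fun t _ => ?_
          have : (t : ℤ) + (j + 1) = ((j + t : ℕ) : ℤ) + 1 := by push_cast; ring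
          rw [this]
        change ∑ t ∈ Finset.range (k + 1), ‖X ((t : ℤ) + (j + 1)) ω‖ ≤ _
        rw [e]
        refine Finset.sum_le_sum_of_subset_of_nonneg (fun t ht => ?_) fun _ _ _ => norm_nonneg _
        rw [Finset.mem_Ico] at ht
        rw [Finset.mem_range]
        omega
      rw [this, indicator_of_notMem hω]
      simp
  calc _ = ∑ j ∈ Finset.range (m - k), P.real (B j) := by
        rw [Finset.sum_congr rfl fun j _ => hPB j]; simp
    _ ≤ ∑ j ∈ Finset.range (m - k), (P.real (D j) + P.real (B j \ D j)) := by
        refine Finset.sum_le_sum fun j _ => ?_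
        refine (measureReal_mono fun ω hω => ?_).trans (measureReal_union_le _ _)
        by_cases h : ω ∈ D j
        · exact Or.inl h
        · exact Or.inr ⟨hω, h⟩
    _ = ((m - k : ℕ) : ℝ) * P.real {ω | c < ‖X 0 ω‖ ∧ ∃ i ∈ Finset.Icc K m, c < ‖X (i : ℤ) ω‖}
        + ∑ j ∈ Finset.range (m - k), P.real (B j \ D j) := by
        rw [Finset.sum_add_distrib, Finset.sum_congr rfl fun j _ => hPD j]; simp
    _ ≤ _ := by
        gcongr
        exact Nat.sub_le _ _

/-- Truncation bound for the total mass of a block. -/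
lemma IsStrictlyStationary.measure_sum_norm_gt_le (hstat : IsStrictlyStationary P X)
    (hX : ∀ t, Measurable (X t)) {r : ℝ} (hr : 0 < r) (m : ℕ) :
    P.real {ω | r < ∑ t ∈ Finset.range m, ‖X ((t : ℤ) + 1) ω‖}
      ≤ m * (tail P (X 0) r + r⁻¹ * ∫ ω in {ω | ‖X 0 ω‖ ≤ r}, ‖X 0 ω‖ ∂P) := by
  have hms : ∀ t, MeasurableSet {ω | ‖X t ω‖ ≤ r} := fun t =>
    measurableSet_le (hX t).norm measurable_const
  let g : EuclideanSpace ℝ (Fin d) → ℝ := fun x => if ‖x‖ ≤ r then ‖x‖ else 0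
  have hg : Measurable g :=
    Measurable.ite (measurableSet_le measurable_norm measurable_const) measurable_norm
      measurable_const
  have hg0 : ∀ x, 0 ≤ g x := fun x => by simp only [g]; split_ifs <;> positivity
  have hgr : ∀ x, g x ≤ r := fun x => by
    simp only [g]
    split_ifs with h
    · exact h
    · exact hr.le
  have hgi : ∀ t : ℤ, Integrable (fun ω => g (X t ω)) P := fun t =>
    Integrable.of_bound (hg.comp (hX t)).aestronglyMeasurable r
      (ae_of_all _ fun ω => by rw [Real.norm_of_nonneg (hg0 _)]; exact hgr _)
  have hgint : ∀ t : ℤ, ∫ ω, g (X t ω) ∂P = ∫ ω in {ω | ‖X 0 ω‖ ≤ r}, ‖X 0 ω‖ ∂P := fun t => by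
    have h1 := hstat.integral_shift hX t
      (F := fun z : ℤ → EuclideanSpace ℝ (Fin d) => g (z 0)) (hg.comp (measurable_pi_apply 0))
    simp only [zero_add] at h1
    rw [h1, ← integral_indicator (hms 0)]
    congr 1
  -- The sum can exceed `r` only if a single term does (`U`, union bound) or if the terms truncated
  -- at `r` already reach `r` (`W`, Markov's inequality).
  set U : Set Ω := ⋃ t ∈ Finset.range m, {ω | r < ‖X ((t : ℤ) + 1) ω‖} with hU
  set W : Set Ω := {ω | r ≤ ∑ t ∈ Finset.range m, g (X ((t : ℤ) + 1) ω)} with hW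
  have hsub : {ω | r < ∑ t ∈ Finset.range m, ‖X ((t : ℤ) + 1) ω‖} ⊆ U ∪ W := by
    intro ω hω
    have hω : r < ∑ t ∈ Finset.range m, ‖X ((t : ℤ) + 1) ω‖ := hω
    by_cases hu : ω ∈ U
    · exact Or.inl hu
    · refine Or.inr (hω.le.trans_eq (Finset.sum_congr rfl fun t ht => ?_))
      have : ‖X ((t : ℤ) + 1) ω‖ ≤ r := by
        by_contra h
        exact hu (mem_biUnion (Finset.mem_coe.mpr ht) (not_le.mp h))
      simp only [g, if_pos this]
  have hPU : P.real U ≤ m * tail P (X 0) r := by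
    refine (measureReal_biUnion_finset_le _ _).trans_eq ?_
    have : ∀ t : ℕ, P.real {ω | r < ‖X ((t : ℤ) + 1) ω‖} = tail P (X 0) r := fun t =>
      hstat.tail_eq hX _ r
    simp [this]
  have hPW : P.real W ≤ r⁻¹ * (m * ∫ ω in {ω | ‖X 0 ω‖ ≤ r}, ‖X 0 ω‖ ∂P) := by
    have hmk := mul_meas_ge_le_integral_of_nonneg (μ := P)
      (f := fun ω => ∑ t ∈ Finset.range m, g (X ((t : ℤ) + 1) ω))
      (ae_of_all _ fun ω => Finset.sum_nonneg fun t _ => hg0 _)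
      (integrable_finsetSum _ fun t _ => hgi _) r
    rw [integral_finsetSum _ fun t _ => hgi _] at hmk
    simp only [hgint, Finset.sum_const, Finset.card_range, nsmul_eq_mul] at hmk
    rw [inv_mul_eq_div, le_div_iff₀ hr, mul_comm]
    exact hmk
  calc _ ≤ P.real (U ∪ W) := measureReal_mono hsub
    _ ≤ P.real U + P.real W := measureReal_union_le _ _
    _ ≤ _ := by
      refine (add_le_add hPU hPW).trans_eq ?_
      ring

/-- A large sum of `|Θ_t|` means that an exceedance of `a_n` starts a cluster of mass above `x a_n`.
Up to the anti-clustering error `η`, a block holds at most `K` such clusters, and a block of mass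
above `x a_n` has probability at most of order `(m_n / n) x ^ (-α)` by Karamata. What matters is
that `K` depends on `η` alone, not on `k` or `x`. -/
lemma IsSpectralTailProcess.measure_sum_le (hspec : IsSpectralTailProcess P X P' Θ)
    (hX : ∀ t, Measurable (X t)) (hΘ : ∀ t, Measurable (Θ t))
    (hstat : IsStrictlyStationary P X) (hG : IsRegVarTail P (X 0) α) (hα1 : α < 1)
    {a : ℕ → ℝ} {m : ℕ → ℕ}
    (ha : Tendsto (fun n : ℕ => (n : ℝ) * tail P (X 0) (a n)) atTop (𝓝 1))
    (hm : Tendsto m atTop atTop) (hanti : AntiClustering P X a m) :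
    ∃ C : ℝ, ∀ η : ℝ, 0 < η → ∃ K : ℕ, ∀ (k : ℕ) (x : ℝ), 0 < x →
      P'.real {ω | x + 1 ≤ ∑ t ∈ Finset.range (k + 1), ‖Θ (t : ℤ) ω‖} ≤ η + K * (C * x ^ (-α)) := by
  have hat := hG.tendsto_normalization ha
  obtain ⟨C, hC0, hC⟩ := hG.exists_lower_bound_scaled (hX 0) hα1 ha
  refine ⟨1 + C, fun η hη => ?_⟩
  obtain ⟨K, hK⟩ := (hanti.eventually_le hX hG one_pos hη).exists
  simp only [one_mul] at hK
  refine ⟨K, fun k x hx => ?_⟩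
  have hmem : ∀ i : Fin (k + 1), ((i : ℕ) : ℤ) ∈ Finset.Icc (-(k : ℤ)) (k : ℤ) := fun i => by
    rw [Finset.mem_Icc]; omega
  let g : (Finset.Icc (-(k : ℤ)) (k : ℤ) → EuclideanSpace ℝ (Fin d)) → ℝ :=
    fun z => ramp (∑ i : Fin (k + 1), ‖z ⟨_, hmem i⟩‖ - x)
  let f := BoundedContinuousFunction.ofNormedAddCommGroup g (by fun_prop) 1 (fun z => by
    rw [Real.norm_of_nonneg (ramp_nonneg _)]; exact ramp_le_one _)
  have hfX : ∀ (Y : ℤ → EuclideanSpace ℝ (Fin d)), f (fun t => Y t)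
      = ramp (∑ t ∈ Finset.range (k + 1), ‖Y (t : ℤ)‖ - x) := fun Y => by
    rw [Finset.sum_range]; rfl
  have hlim := (hspec k f).comp hat
  have hΘm : ∀ t : ℤ, Measurable fun ω => ‖Θ t ω‖ := fun t => (hΘ t).norm
  have hle : P'.real {ω | x + 1 ≤ ∑ t ∈ Finset.range (k + 1), ‖Θ (t : ℤ) ω‖}
      ≤ ∫ ω, f (fun t => Θ t ω) ∂P' := by
    have hms : MeasurableSet {ω | x + 1 ≤ ∑ t ∈ Finset.range (k + 1), ‖Θ (t : ℤ) ω‖} :=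
      measurableSet_le measurable_const (Finset.measurable_sum _ fun t _ => hΘm _)
    have e1 : P'.real {ω | x + 1 ≤ ∑ t ∈ Finset.range (k + 1), ‖Θ (t : ℤ) ω‖}
        = ∫ ω, {ω | x + 1 ≤ ∑ t ∈ Finset.range (k + 1), ‖Θ (t : ℤ) ω‖}.indicator
          (fun _ => (1 : ℝ)) ω ∂P' := by
      rw [integral_indicator_const _ hms, smul_eq_mul, mul_one]
    rw [e1]
    have e2 : ∀ ω, f (fun t => Θ t ω) = ramp (∑ t ∈ Finset.range (k + 1), ‖Θ (t : ℤ) ω‖ - x) :=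
      fun ω => hfX fun t => Θ t ω
    simp only [e2]
    refine integral_mono ((integrable_const _).indicator hms) ?_ fun ω => ?_
    · refine Integrable.of_bound (Measurable.aestronglyMeasurable ?_) 1 (ae_of_all _ fun ω => ?_)
      · exact continuous_ramp.measurable.comp
          ((Finset.measurable_sum _ fun t _ => hΘm _).sub_const x)
      · rw [Real.norm_of_nonneg (ramp_nonneg _)]; exact ramp_le_one _
    · by_cases h : x + 1 ≤ ∑ t ∈ Finset.range (k + 1), ‖Θ (t : ℤ) ω‖
      · rw [indicator_of_mem (by exact h)]
        simp only
        rw [ramp_of_one_le (by linarith)]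
      · rw [indicator_of_notMem (by exact h)]
        exact ramp_nonneg _
  refine hle.trans ?_
  -- bound along the sequence
  set p : ℕ → ℝ := fun n => P.real {ω | a n < ‖X 0 ω‖ ∧
    x * a n < ∑ t ∈ Finset.range (k + 1), ‖X (t : ℤ) ω‖} with hp
  -- Given `|X_0| > a_n`, a normalized sum above `x` forces an unnormalized one above `x a_n`. The
  -- test function rises from 0 to 1 between `x` and `x + 1`, whence the shift by 1 in the
  -- statement.
  have hcond : ∀ᶠ n in atTop, n * tail P (X 0) (a n) * (∫ ω, f (fun t => ‖X 0 ω‖⁻¹ • X t ω)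
      ∂(ProbabilityTheory.cond P {ω | a n < ‖X 0 ω‖})) ≤ n * p n := by
    filter_upwards [hat.eventually_gt_atTop 0] with n hn
    have hms : MeasurableSet {ω | a n < ‖X 0 ω‖} := measurableSet_lt measurable_const (hX 0).norm
    have hms2 : MeasurableSet {ω | a n < ‖X 0 ω‖ ∧
        x * a n < ∑ t ∈ Finset.range (k + 1), ‖X (t : ℤ) ω‖} :=
      hms.inter (measurableSet_lt measurable_const (Finset.measurable_sum _ fun t _ => (hX _).norm))
    rw [integral_cond_eq, mul_assoc]
    gcongr
    have ht : P.real {ω | a n < ‖X 0 ω‖} = tail P (X 0) (a n) := rfl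
    rw [ht, smul_eq_mul, mul_inv_cancel_left₀ (hG.pos _).ne', ← integral_indicator hms]
    have e1 : p n = ∫ ω, {ω | a n < ‖X 0 ω‖ ∧ x * a n < ∑ t ∈ Finset.range (k + 1),
        ‖X (t : ℤ) ω‖}.indicator (fun _ => (1 : ℝ)) ω ∂P := by
      rw [integral_indicator_const _ hms2, smul_eq_mul, mul_one]
    rw [e1]
    refine integral_mono_of_nonneg (ae_of_all _ fun ω => indicator_nonneg (fun ω _ => ?_) ω)
      ((integrable_const _).indicator hms2) (ae_of_all _ fun ω => ?_)
    · rw [hfX fun t => ‖X 0 ω‖⁻¹ • X t ω]; exact ramp_nonneg _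
    · by_cases h1 : a n < ‖X 0 ω‖
      · rw [indicator_of_mem (by exact h1), hfX fun t => ‖X 0 ω‖⁻¹ • X t ω]
        by_cases h2 : x * a n < ∑ t ∈ Finset.range (k + 1), ‖X (t : ℤ) ω‖
        · rw [indicator_of_mem (by exact ⟨h1, h2⟩)]
          exact ramp_le_one _
        · rw [indicator_of_notMem (by exact fun h => h2 h.2), ramp_of_nonpos]
          have hpos : 0 < ‖X 0 ω‖ := hn.trans h1
          simp only [norm_smul, norm_inv, norm_norm, ← Finset.mul_sum]
          rw [sub_nonpos, inv_mul_le_iff₀ hpos, mul_comm]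
          exact (not_lt.mp h2).trans (by gcongr)
      · rw [indicator_of_notMem (by exact h1), indicator_of_notMem (by exact fun h => h1 h.1)]
  -- The counting inequality for one block multiplied by `n / m_n`; the prefactor on the left
  -- accounts for the `k` excluded starting points and tends to 1.
  have hcnt : ∀ᶠ n in atTop, (1 - k * (m n : ℝ)⁻¹) * (n * p n)
      ≤ η * (n * tail P (X 0) (a n)) + K * (n * tail P (X 0) (x * a n) + C * x ^ (-α)) := by
    filter_upwards [hK, hC x hx, hat.eventually_gt_atTop 0, hm.eventually_gt_atTop 0] with
      n h1 h2 h3 h4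
    have hmR : (0 : ℝ) < m n := by exact_mod_cast h4
    have h5 := hstat.mul_cluster_le hX (a n) (x * a n) k K (m n)
    have h6 := hstat.measure_sum_norm_gt_le hX (show 0 < x * a n by positivity) (m n)
    have h7 : (m n : ℝ) - k ≤ ((m n - k : ℕ) : ℝ) := by
      rw [sub_le_iff_le_add]; exact_mod_cast (by omega : m n ≤ m n - k + k)
    have hp0 : 0 ≤ p n := measureReal_nonneg
    set I := ∫ ω in {ω | ‖X 0 ω‖ ≤ x * a n}, ‖X 0 ω‖ ∂P with hI
    have h8 : ((m n : ℝ) - k) * p n ≤ m n * (η * tail P (X 0) (a n))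
        + K * (m n * (tail P (X 0) (x * a n) + (x * a n)⁻¹ * I)) := by
      refine (mul_le_mul_of_nonneg_right h7 hp0).trans (h5.trans ?_)
      gcongr
    have h9 : n * ((x * a n)⁻¹ * I) ≤ C * x ^ (-α) := by
      have e : n * ((x * a n)⁻¹ * I) = x⁻¹ * (n * ((a n)⁻¹ * I)) := by
        field_simp
      have e2 : C * x ^ (-α) = x⁻¹ * (C * x ^ (1 - α)) := by
        rw [sub_eq_add_neg, Real.rpow_add hx, Real.rpow_one]; field_simp
      rw [e, e2]
      gcongr
    calc (1 - k * (m n : ℝ)⁻¹) * (n * p n) = n * (m n : ℝ)⁻¹ * (((m n : ℝ) - k) * p n) := by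
          field_simp
      _ ≤ n * (m n : ℝ)⁻¹ * (m n * (η * tail P (X 0) (a n))
        + K * (m n * (tail P (X 0) (x * a n) + (x * a n)⁻¹ * I))) := by gcongr
      _ = η * (n * tail P (X 0) (a n)) + K * (n * tail P (X 0) (x * a n)
        + n * ((x * a n)⁻¹ * I)) := by
          field_simp
      _ ≤ _ := by gcongr
  have hminv : Tendsto (fun n => (m n : ℝ)⁻¹) atTop (𝓝 0) :=
    tendsto_inv_atTop_zero.comp (tendsto_natCast_atTop_atTop.comp hm)
  have hL : Tendsto (fun n : ℕ => (1 - k * (m n : ℝ)⁻¹) * (n * tail P (X 0) (a n) *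
      (∫ ω, f (fun t => ‖X 0 ω‖⁻¹ • X t ω)
        ∂(ProbabilityTheory.cond P {ω | a n < ‖X 0 ω‖})))) atTop
      (𝓝 ((1 - k * 0) * (1 * ∫ ω, f (fun t => Θ t ω) ∂P'))) :=
    ((hminv.const_mul _).const_sub 1).mul (ha.mul hlim)
  have hRt : Tendsto (fun n : ℕ => η * (n * tail P (X 0) (a n))
      + K * (n * tail P (X 0) (x * a n) + C * x ^ (-α))) atTop
      (𝓝 (η * 1 + K * (x ^ (-α) + C * x ^ (-α)))) :=
    (ha.const_mul _).add (((hG.tendsto_mul_tail ha hx).add_const _).const_mul _)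
  have hfin := le_of_tendsto_of_tendsto hL hRt (by
    have hk1 : ∀ᶠ n in atTop, 0 ≤ 1 - k * (m n : ℝ)⁻¹ := by
      have h0 : Tendsto (fun n => 1 - k * (m n : ℝ)⁻¹) atTop (𝓝 (1 - k * 0)) :=
        (hminv.const_mul _).const_sub 1
      filter_upwards [h0.eventually_const_lt (show (0 : ℝ) < 1 - k * 0 by simp)] with n hn
      exact hn.le
    filter_upwards [hcond, hcnt, hk1] with n h1 h2 h3
    exact (mul_le_mul_of_nonneg_left h1 h3).trans h2)
  calc _ = (1 - k * 0) * (1 * ∫ ω, f (fun t => Θ t ω) ∂P') := by ring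
    _ ≤ _ := hfin
    _ = _ := by ring

/-- For `α < 1` the anti-clustering condition makes the spectral tail process summable. -/
theorem IsSpectralTailProcess.ae_summable_norm (hspec : IsSpectralTailProcess P X P' Θ)
    (hX : ∀ t, Measurable (X t)) (hΘ : ∀ t, Measurable (Θ t))
    (hstat : IsStrictlyStationary P X) (hG : IsRegVarTail P (X 0) α) (hα : 0 < α) (hα1 : α < 1)
    {a : ℕ → ℝ} {m : ℕ → ℕ}
    (ha : Tendsto (fun n : ℕ => (n : ℝ) * tail P (X 0) (a n)) atTop (𝓝 1))
    (hm : Tendsto m atTop atTop) (hanti : AntiClustering P X a m) :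
    ∀ᵐ ω ∂P', Summable fun t : ℕ => ‖Θ (t : ℤ) ω‖ := by
  obtain ⟨C, hC⟩ := hspec.measure_sum_le hX hΘ hstat hG hα1 ha hm hanti
  rw [ae_iff, ← measureReal_eq_zero_iff]
  refine le_antisymm (le_of_forall_pos_le_add fun η hη => ?_) measureReal_nonneg
  rw [zero_add]
  obtain ⟨K, hK⟩ := hC η hη
  have hx : ∀ x : ℝ, 0 < x →
      P'.real {ω | ¬ Summable fun t : ℕ => ‖Θ (t : ℤ) ω‖} ≤ η + K * (C * x ^ (-α)) := by
    intro x hx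
    set A : ℕ → Set Ω' := fun k => {ω | x + 1 ≤ ∑ t ∈ Finset.range (k + 1), ‖Θ (t : ℤ) ω‖} with hA
    have hmono : Monotone A := fun i j hij ω hω => by
      refine le_trans (show x + 1 ≤ _ from hω) ?_
      exact Finset.sum_le_sum_of_subset_of_nonneg (Finset.range_mono (by omega))
        fun _ _ _ => norm_nonneg _
    have hsub : {ω | ¬ Summable fun t : ℕ => ‖Θ (t : ℤ) ω‖} ⊆ ⋃ k, A k := by
      intro ω hω
      have h1 := (not_summable_iff_tendsto_nat_atTop_of_nonneg fun t => norm_nonneg _).mp hω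
      obtain ⟨k, hk⟩ := ((h1.comp (tendsto_add_atTop_nat 1)).eventually_ge_atTop (x + 1)).exists
      exact mem_iUnion.mpr ⟨k, hk⟩
    refine (measureReal_mono hsub).trans ?_
    have hlim : Tendsto (fun k => P'.real (A k)) atTop (𝓝 (P'.real (⋃ k, A k))) :=
      (ENNReal.tendsto_toReal (measure_ne_top _ _)).comp (tendsto_measure_iUnion_atTop hmono)
    exact le_of_tendsto hlim (Eventually.of_forall fun k => hK k x hx)
  have hlim : Tendsto (fun x : ℝ => η + K * (C * x ^ (-α))) atTop (𝓝 (η + K * (C * 0))) :=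
    (((tendsto_rpow_neg_atTop hα).const_mul C).const_mul _).const_add _
  have := ge_of_tendsto hlim ((eventually_gt_atTop 0).mono fun x h => hx x h)
  simpa using this

end Counting

/-! ### Elementary estimates for powers and exponentials. -/

section ExpEstimates

lemma norm_pow_sub_pow_le_of_norm_le_one {x y : ℂ} (hx : ‖x‖ ≤ 1) (hy : ‖y‖ ≤ 1) (n : ℕ) :
    ‖x ^ n - y ^ n‖ ≤ n * ‖x - y‖ := by
  induction n with
  | zero => simp
  | succ n ih =>
    have e : x ^ (n + 1) - y ^ (n + 1) = (x ^ n - y ^ n) * x + y ^ n * (x - y) := by ring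
    have h1 : ‖x ^ n - y ^ n‖ * ‖x‖ ≤ n * ‖x - y‖ :=
      (mul_le_of_le_one_right (norm_nonneg _) hx).trans ih
    have h2 : ‖y ^ n‖ * ‖x - y‖ ≤ ‖x - y‖ := by
      rw [norm_pow]
      exact mul_le_of_le_one_left (norm_nonneg _) (pow_le_one₀ (norm_nonneg _) hy)
    rw [e]
    refine (norm_add_le _ _).trans ?_
    rw [norm_mul, norm_mul]
    push_cast
    linarith

lemma norm_exp_le_one {z : ℂ} (hz : z.re ≤ 0) : ‖Complex.exp z‖ ≤ 1 := by
  rw [Complex.norm_exp]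
  exact Real.exp_le_one_iff.mpr hz

lemma re_sub_one_nonpos {c : ℂ} (hc : ‖c‖ ≤ 1) : (c - 1).re ≤ 0 := by
  have := (Complex.re_le_norm c).trans hc
  simpa using this

/-- Compares the `n`-th powers of `c` and `e^{c-1}`, both in the unit disc, where each factor costs
`‖c - 1‖ ^ 2`. -/
lemma norm_pow_sub_exp_le {c : ℂ} (hc : ‖c‖ ≤ 1) (hc1 : ‖c - 1‖ ≤ 1) (n : ℕ) :
    ‖c ^ n - Complex.exp (n * (c - 1))‖ ≤ n * ‖c - 1‖ ^ 2 := by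
  rw [Complex.exp_nat_mul]
  refine (norm_pow_sub_pow_le_of_norm_le_one hc (norm_exp_le_one (re_sub_one_nonpos hc)) n).trans ?_
  gcongr
  rw [norm_sub_rev]
  have := Complex.norm_exp_sub_one_sub_id_le hc1
  rwa [show Complex.exp (c - 1) - 1 - (c - 1) = Complex.exp (c - 1) - c by ring] at this

lemma norm_exp_sub_exp_le {z w : ℂ} (hz : z.re ≤ 0) (h : ‖z - w‖ ≤ 1) :
    ‖Complex.exp z - Complex.exp w‖ ≤ 2 * ‖z - w‖ := by
  have e : Complex.exp z - Complex.exp w = -(Complex.exp z * (Complex.exp (w - z) - 1)) := by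
    rw [mul_sub, ← Complex.exp_add]; ring_nf
  rw [norm_sub_rev] at h
  rw [e, norm_neg, norm_mul, norm_sub_rev z]
  exact (mul_le_of_le_one_left (norm_nonneg _) (norm_exp_le_one hz)).trans
    (Complex.norm_exp_sub_one_le h)

variable {Ω : Type*} [MeasurableSpace Ω] {P : Measure Ω} [IsProbabilityMeasure P]

lemma integrable_cexpI {f : Ω → ℝ} (hf : Measurable f) : Integrable (fun ω => cexpI (f ω)) P :=
  Integrable.of_bound (continuous_cexpI.measurable.comp hf).aestronglyMeasurable 1
    (ae_of_all _ fun _ => (norm_cexpI _).le)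

lemma norm_integral_cexpI_le (f : Ω → ℝ) : ‖∫ ω, cexpI (f ω) ∂P‖ ≤ 1 := by
  simpa using norm_integral_le_of_norm_le_const (μ := P) (C := 1)
    (ae_of_all _ fun ω => (norm_cexpI (f ω)).le)

/-- Perturbation of a characteristic function by a shift and a small remainder. -/
lemma norm_integral_cexpI_add_sub_le {f g : Ω → ℝ} (hf : Measurable f) (hg : Measurable g) (c : ℝ) :
    ‖∫ ω, cexpI (f ω + g ω + c) ∂P - cexpI c * ∫ ω, cexpI (g ω) ∂P‖
      ≤ ∫ ω, ‖cexpI (f ω) - 1‖ ∂P := by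
  rw [← integral_const_mul, ← integral_sub (integrable_cexpI (by fun_prop))
    ((integrable_cexpI hg).const_mul _)]
  refine (norm_integral_le_integral_norm _).trans_eq (integral_congr_ae (ae_of_all _ fun ω => ?_))
  simp only [cexpI_add]
  rw [show cexpI (f ω) * cexpI (g ω) * cexpI c - cexpI c * cexpI (g ω)
    = (cexpI c * cexpI (g ω)) * (cexpI (f ω) - 1) by ring]
  simp

lemma integrable_norm_cexpI_sub_one {f : Ω → ℝ} (hf : Measurable f) :
    Integrable (fun ω => ‖cexpI (f ω) - 1‖) P :=
  ((integrable_cexpI hf).sub (integrable_const _)).norm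

lemma integral_norm_cexpI_sub_one_le {f : Ω → ℝ} (hf : Measurable f) {b : ℝ} (hb : 0 ≤ b) :
    ∫ ω, ‖cexpI (f ω) - 1‖ ∂P ≤ b + 2 * P.real {ω | b < |f ω|} := by
  have hms : MeasurableSet {ω | b < |f ω|} :=
    measurableSet_lt measurable_const (continuous_abs.measurable.comp hf)
  have e : b + 2 * P.real {ω | b < |f ω|}
      = ∫ ω, (b + {ω | b < |f ω|}.indicator (fun _ => (2 : ℝ)) ω) ∂P := by
    rw [integral_add (integrable_const _) ((integrable_const _).indicator hms),
      integral_indicator_const _ hms]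
    simp [mul_comm]
  rw [e]
  refine integral_mono (integrable_norm_cexpI_sub_one hf)
    ((integrable_const _).add ((integrable_const _).indicator hms)) fun ω => ?_
  by_cases h : b < |f ω|
  · have := norm_cexpI_sub_le_two (f ω) 0
    rw [cexpI_zero] at this
    simp only [indicator_of_mem (show ω ∈ {ω | b < |f ω|} from h)]
    linarith
  · simp only [indicator_of_notMem (show ω ∉ {ω | b < |f ω|} from h), add_zero]
    exact (norm_cexpI_sub_one_le _).trans (not_lt.mp h)

end ExpEstimates

/-! ### Removal of the small values. -/

section Sums

variable {Ω : Type*} [MeasurableSpace Ω] {d : ℕ} {P : Measure Ω}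
  {X : ℤ → Ω → EuclideanSpace ℝ (Fin d)}

omit [MeasurableSpace Ω] in
lemma lowerTrunc_add_upperTrunc (c : ℝ) (x : EuclideanSpace ℝ (Fin d)) :
    lowerTrunc c x + upperTrunc c x = x := by
  unfold lowerTrunc upperTrunc
  by_cases h : ‖x‖ ≤ c
  · simp [h, not_lt.mpr h]
  · simp [h, not_le.mp h]

omit [MeasurableSpace Ω] in
lemma lowerSum_add_upperSum (c : ℝ) (n : ℕ) (ω : Ω) :
    lowerSum X c n ω + upperSum X c n ω = partialSum X n ω := by
  simp only [lowerSum, upperSum, partialSum, ← Finset.sum_add_distrib, lowerTrunc_add_upperTrunc]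

lemma measurable_lowerSum (hX : ∀ t, Measurable (X t)) (c : ℝ) (n : ℕ) :
    Measurable (lowerSum X c n) :=
  Finset.measurable_sum _ fun t _ => (measurable_lowerTrunc c).comp (hX t)

lemma measurable_upperSum (hX : ∀ t, Measurable (X t)) (c : ℝ) (n : ℕ) :
    Measurable (upperSum X c n) :=
  Finset.measurable_sum _ fun t _ => (measurable_upperTrunc c).comp (hX t)

lemma measurable_partialSum (hX : ∀ t, Measurable (X t)) (n : ℕ) : Measurable (partialSum X n) :=
  Finset.measurable_sum _ fun t _ => hX t

lemma IsStrictlyStationary.integral_comp_eq (hstat : IsStrictlyStationary P X)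
    (hX : ∀ t, Measurable (X t)) {G : Type*} [NormedAddCommGroup G] [NormedSpace ℝ G]
    [MeasurableSpace G] [BorelSpace G] [SecondCountableTopology G]
    {g : EuclideanSpace ℝ (Fin d) → G} (hg : Measurable g) (t : ℤ) :
    ∫ ω, g (X t ω) ∂P = ∫ ω, g (X 0 ω) ∂P := by
  simpa using hstat.integral_shift hX t (F := fun z => g (z 0)) (hg.comp (measurable_pi_apply 0))

lemma IsStrictlyStationary.integrable (hstat : IsStrictlyStationary P X)
    (hX : ∀ t, Measurable (X t)) (h0 : Integrable (X 0) P) (t : ℤ) : Integrable (X t) P := by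
  have hid : IdentDistrib (X t) (X 0) P P := by
    refine ⟨(hX t).aemeasurable, (hX 0).aemeasurable, ?_⟩
    have h1 : Measurable fun ω s => X (s + t) ω := measurable_pi_lambda _ fun s => hX _
    have h2 : Measurable fun ω s => X s ω := measurable_pi_lambda _ fun s => hX _
    have := congrArg (Measure.map fun z : ℤ → EuclideanSpace ℝ (Fin d) => z 0) (hstat t)
    rw [Measure.map_map (measurable_pi_apply 0) h1, Measure.map_map (measurable_pi_apply 0) h2]
      at this
    simpa [Function.comp_def] using this
  exact hid.integrable_iff.mpr h0

variable [IsProbabilityMeasure P]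

/-- Small values are negligible in mean when `α < 1`. -/
lemma IsStrictlyStationary.integral_norm_lowerSum_le (hstat : IsStrictlyStationary P X)
    (hX : ∀ t, Measurable (X t)) (c : ℝ) (n : ℕ) :
    Integrable (fun ω => ‖lowerSum X c n ω‖) P ∧
    ∫ ω, ‖lowerSum X c n ω‖ ∂P ≤ n * ∫ ω in {ω | ‖X 0 ω‖ ≤ c}, ‖X 0 ω‖ ∂P := by
  have hm : Measurable fun x : EuclideanSpace ℝ (Fin d) => ‖lowerTrunc c x‖ :=
    (measurable_lowerTrunc c).norm
  have hi : ∀ t : ℤ, Integrable (fun ω => ‖lowerTrunc c (X t ω)‖) P := fun t =>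
    Integrable.of_bound (hm.comp (hX t)).aestronglyMeasurable |c| (ae_of_all _ fun ω => by
      rw [norm_norm, lowerTrunc]
      split_ifs with h
      · exact h.trans (le_abs_self c)
      · simp)
  have h0 : ∫ ω in {ω | ‖X 0 ω‖ ≤ c}, ‖X 0 ω‖ ∂P = ∫ ω, ‖lowerTrunc c (X 0 ω)‖ ∂P := by
    rw [← integral_indicator (measurableSet_le (hX 0).norm measurable_const)]
    refine integral_congr_ae (ae_of_all _ fun ω => ?_)
    by_cases h : ‖X 0 ω‖ ≤ c
    · simp [lowerTrunc, h]
    · simp [lowerTrunc, h]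
  have hsum : Integrable (fun ω => ∑ t ∈ Finset.Icc 1 n, ‖lowerTrunc c (X (t : ℤ) ω)‖) P :=
    integrable_finsetSum _ fun t _ => hi t
  have hle : ∀ ω, ‖lowerSum X c n ω‖ ≤ ∑ t ∈ Finset.Icc 1 n, ‖lowerTrunc c (X (t : ℤ) ω)‖ :=
    fun ω => norm_sum_le _ _
  have hint : Integrable (fun ω => ‖lowerSum X c n ω‖) P :=
    hsum.mono' (measurable_lowerSum hX c n).norm.aestronglyMeasurable
      (ae_of_all _ fun ω => by rw [norm_norm]; exact hle ω)
  refine ⟨hint, (integral_mono hint hsum hle).trans_eq ?_⟩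
  rw [integral_finsetSum _ fun (t : ℕ) _ => hi t, Finset.sum_congr rfl fun (t : ℕ) _ =>
    hstat.integral_comp_eq hX hm t, h0]
  simp

variable {α : ℝ} {a : ℕ → ℝ}

/-- Removal of the small values, with the centering of the large ones when `α > 1`. -/
theorem IsStrictlyStationary.eventually_charFun_approx (hstat : IsStrictlyStationary P X)
    (hX : ∀ t, Measurable (X t)) (hG : IsRegVarTail P (X 0) α) (hα1 : α ≠ 1)
    (ha : Tendsto (fun n : ℕ => (n : ℝ) * tail P (X 0) (a n)) atTop (𝓝 1))
    (hmean : 1 < α → ∫ ω, X 0 ω ∂P = 0) (hvanish : 1 < α → VanishingSmallValues P X a)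
    (s : EuclideanSpace ℝ (Fin d)) {η : ℝ} (hη : 0 < η) :
    ∀ᶠ ε : ℝ in 𝓝[>] 0, ∀ᶠ n : ℕ in atTop,
      ‖∫ ω, cexpI ⟪s, (a n)⁻¹ • partialSum X n ω⟫_ℝ ∂P
        - cexpI (-(compOrder α * (n * ∫ ω, ⟪s, upperTrunc ε ((a n)⁻¹ • X 0 ω)⟫_ℝ ∂P)))
          * ∫ ω, cexpI (⟪s, upperSum X (ε * a n) n ω⟫_ℝ / a n) ∂P‖ ≤ η := by
  have hat := hG.tendsto_normalization ha
  have hlow : ∀ c n, Measurable (lowerSum X c n) := measurable_lowerSum hX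
  have hup : ∀ c n, Measurable (upperSum X c n) := measurable_upperSum hX
  rcases lt_or_gt_of_ne hα1 with h1 | h1
  · obtain ⟨C, hC0, hC⟩ := hG.exists_lower_bound_scaled (hX 0) h1 ha
    have hlim : Tendsto (fun ε : ℝ => ‖s‖ * (C * ε ^ (1 - α))) (𝓝[>] 0) (𝓝 (‖s‖ * (C * 0))) := by
      refine ((tendsto_nhdsWithin_of_tendsto_nhds ?_).const_mul C).const_mul ‖s‖
      have := (Real.continuousAt_rpow_const 0 (1 - α) (Or.inr (by linarith))).tendsto
      rwa [Real.zero_rpow (by linarith)] at this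
    simp only [mul_zero] at hlim
    filter_upwards [hlim.eventually_lt_const hη, self_mem_nhdsWithin] with ε hε hε0
    filter_upwards [hC ε hε0, hat.eventually_gt_atTop 0] with n hn han
    have hS : ∀ ω, ⟪s, (a n)⁻¹ • partialSum X n ω⟫_ℝ = ⟪s, (a n)⁻¹ • lowerSum X (ε * a n) n ω⟫_ℝ
        + ⟪s, upperSum X (ε * a n) n ω⟫_ℝ / a n + 0 := fun ω => by
      rw [← lowerSum_add_upperSum (ε * a n), smul_add, inner_add_right, add_zero, inner_smul_right,
        inner_smul_right, inv_mul_eq_div, inv_mul_eq_div]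
    simp only [hS, compOrder_of_lt h1, Nat.cast_zero, zero_mul, neg_zero]
    have hf : Measurable fun ω => ⟪s, (a n)⁻¹ • lowerSum X (ε * a n) n ω⟫_ℝ :=
      measurable_const.inner ((hlow _ _).const_smul (a n)⁻¹)
    have hg : Measurable fun ω => ⟪s, upperSum X (ε * a n) n ω⟫_ℝ / a n :=
      (measurable_const.inner (hup _ _)).div_const _
    refine (norm_integral_cexpI_add_sub_le hf hg 0).trans ?_
    obtain ⟨hi, hle⟩ := hstat.integral_norm_lowerSum_le hX (ε * a n) n
    calc ∫ ω, ‖cexpI ⟪s, (a n)⁻¹ • lowerSum X (ε * a n) n ω⟫_ℝ - 1‖ ∂P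
        ≤ ∫ ω, ‖s‖ * ((a n)⁻¹ * ‖lowerSum X (ε * a n) n ω‖) ∂P := by
          refine integral_mono (integrable_norm_cexpI_sub_one hf) ((hi.const_mul _).const_mul _)
            fun ω => (norm_cexpI_sub_one_le _).trans ((abs_real_inner_le_norm _ _).trans_eq ?_)
          rw [norm_smul, norm_inv, Real.norm_of_nonneg han.le]
      _ = ‖s‖ * ((a n)⁻¹ * ∫ ω, ‖lowerSum X (ε * a n) n ω‖ ∂P) := by
          rw [integral_const_mul, integral_const_mul]
      _ ≤ ‖s‖ * ((a n)⁻¹ * (n * ∫ ω in {ω | ‖X 0 ω‖ ≤ ε * a n}, ‖X 0 ω‖ ∂P)) := by gcongr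
      _ ≤ ‖s‖ * (C * ε ^ (1 - α)) := by
          rw [mul_left_comm (a n)⁻¹]; gcongr
      _ ≤ η := hε.le
  · have h0 : Integrable (X 0) P :=
      (integrable_norm_iff (hX 0).aestronglyMeasurable).mp (hG.integrable (hX 0) h1)
    have hXi := hstat.integrable hX h0
    have hupi : ∀ (c : ℝ) (t : ℤ), Integrable (fun ω => upperTrunc c (X t ω)) P := fun c t =>
      (hXi t).mono ((measurable_upperTrunc c).comp (hX t)).aestronglyMeasurable
        (ae_of_all _ fun ω => by unfold upperTrunc; split_ifs <;> simp)
    have hlowi : ∀ (c : ℝ) (t : ℤ), Integrable (fun ω => lowerTrunc c (X t ω)) P := fun c t =>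
      (hXi t).mono ((measurable_lowerTrunc c).comp (hX t)).aestronglyMeasurable
        (ae_of_all _ fun ω => by unfold lowerTrunc; split_ifs <;> simp)
    -- Zero mean turns the centering of the small values into one of the large values; this is the
    -- origin of the compensator in the exponent.
    have hElow : ∀ (c : ℝ) (n : ℕ), ∫ ω, lowerSum X c n ω ∂P
        = -((n : ℝ) • ∫ ω, upperTrunc c (X 0 ω) ∂P) := fun c n => by
      have e0 : ∫ ω, lowerTrunc c (X 0 ω) ∂P + ∫ ω, upperTrunc c (X 0 ω) ∂P = 0 := by
        rw [← integral_add (hlowi c 0) (hupi c 0), ← hmean h1]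
        simp only [lowerTrunc_add_upperTrunc]
      simp only [lowerSum]
      rw [integral_finsetSum _ fun (t : ℕ) _ => hlowi c t, Finset.sum_congr rfl fun (t : ℕ) _ =>
        hstat.integral_comp_eq hX (measurable_lowerTrunc c) t, Finset.sum_const, Nat.card_Icc,
        eq_neg_of_add_eq_zero_left e0, smul_neg, Nat.add_sub_cancel, Nat.cast_smul_eq_nsmul]
    -- Budget: `‖s‖ * δ ≤ η / 2`, plus twice an exceptional probability of at most `η / 4`. The
    -- added 1 avoids dividing by zero at `s = 0`.
    set δ : ℝ := η / (2 * (‖s‖ + 1)) with hδ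
    have hs0 : 0 ≤ ‖s‖ := norm_nonneg s
    have hδ0 : 0 < δ := by positivity
    have hsδ : ‖s‖ * δ ≤ η / 2 := by
      rw [hδ, mul_div_assoc', div_le_div_iff₀ (by positivity) two_pos]
      nlinarith
    filter_upwards [(hvanish h1 δ hδ0).eventually_lt_const
      (ENNReal.ofReal_pos.mpr (show 0 < η / 4 by positivity))] with ε hε
    filter_upwards [eventually_lt_of_limsup_lt hε, hat.eventually_gt_atTop 0] with n hn han
    set e : EuclideanSpace ℝ (Fin d) := ∫ ω, lowerSum X (ε * a n) n ω ∂P with he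
    have hcen : -(compOrder α * (n * ∫ ω, ⟪s, upperTrunc ε ((a n)⁻¹ • X 0 ω)⟫_ℝ ∂P))
        = ⟪s, (a n)⁻¹ • e⟫_ℝ := by
      rw [compOrder_of_gt h1, he, hElow]
      simp only [upperTrunc_smul han, inner_smul_right, inner_neg_right, smul_neg]
      rw [integral_const_mul, integral_inner (hupi _ 0)]
      push_cast
      ring
    have hS : ∀ ω, ⟪s, (a n)⁻¹ • partialSum X n ω⟫_ℝ
        = ⟪s, (a n)⁻¹ • (lowerSum X (ε * a n) n ω - e)⟫_ℝ
        + ⟪s, upperSum X (ε * a n) n ω⟫_ℝ / a n + ⟪s, (a n)⁻¹ • e⟫_ℝ := fun ω => by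
      rw [← lowerSum_add_upperSum (ε * a n)]
      simp only [inner_smul_right, inner_add_right, inner_sub_right]
      ring
    rw [hcen]
    simp only [hS]
    have hf : Measurable fun ω => ⟪s, (a n)⁻¹ • (lowerSum X (ε * a n) n ω - e)⟫_ℝ :=
      measurable_const.inner (((hlow _ _).sub_const e).const_smul (a n)⁻¹)
    have hg : Measurable fun ω => ⟪s, upperSum X (ε * a n) n ω⟫_ℝ / a n :=
      (measurable_const.inner (hup _ _)).div_const _
    refine (norm_integral_cexpI_add_sub_le hf hg _).trans
      ((integral_norm_cexpI_sub_one_le hf (show 0 ≤ ‖s‖ * δ by positivity)).trans ?_)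
    have hsub : P.real {ω | ‖s‖ * δ < |⟪s, (a n)⁻¹ • (lowerSum X (ε * a n) n ω - e)⟫_ℝ|}
        ≤ η / 4 := by
      refine ENNReal.toReal_le_of_le_ofReal (by positivity) (le_trans (measure_mono ?_) hn.le)
      intro ω hω
      rw [mem_ofPred_eq] at hω ⊢
      have h2 := hω.trans_le (abs_real_inner_le_norm _ _)
      rw [norm_smul, norm_inv, Real.norm_of_nonneg han.le] at h2
      exact lt_of_mul_lt_mul_left h2 hs0
    linarith

end Sums

/-! ### Exponential approximation and convergence of the characteristic functions. -/

section Limit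

variable {Ω Ω' : Type*} [MeasurableSpace Ω] [MeasurableSpace Ω'] {d : ℕ} {P : Measure Ω}
  [IsProbabilityMeasure P] {P' : Measure Ω'} [IsProbabilityMeasure P']
  {X : ℤ → Ω → EuclideanSpace ℝ (Fin d)} {Θ : ℤ → Ω' → EuclideanSpace ℝ (Fin d)}
  {α : ℝ} {a : ℕ → ℝ} {m : ℕ → ℕ}

/-- The product of block characteristic functions is asymptotically compound Poisson. -/
lemma IsStrictlyStationary.tendsto_block_pow_sub_exp (hstat : IsStrictlyStationary P X)
    (hX : ∀ t, Measurable (X t)) (hG : IsRegVarTail P (X 0) α)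
    (ha : Tendsto (fun n : ℕ => (n : ℝ) * tail P (X 0) (a n)) atTop (𝓝 1))
    (hmn : Tendsto (fun n : ℕ => (m n : ℝ) / (n : ℝ)) atTop (𝓝 0))
    (s : EuclideanSpace ℝ (Fin d)) {ε : ℝ} (hε : 0 < ε) :
    Tendsto (fun n : ℕ =>
      (∫ ω, cexpI (⟪s, upperSum X (ε * a n) (m n) ω⟫_ℝ / a n) ∂P) ^ (n / m n)
        - Complex.exp (((n / m n : ℕ) : ℂ)
          * (∫ ω, cexpI (⟪s, upperSum X (ε * a n) (m n) ω⟫_ℝ / a n) ∂P - 1))) atTop (𝓝 0) := by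
  have hat := hG.tendsto_normalization ha
  have hT := hG.tendsto_mul_tail ha hε
  set c : ℕ → ℂ := fun n => ∫ ω, cexpI (⟪s, upperSum X (ε * a n) (m n) ω⟫_ℝ / a n) ∂P with hc
  -- The block estimate with window `k = 0` and no use of anti-clustering is enough: the 6 is 4 for
  -- its error plus 2 for the jump. It makes `(n / m_n) ‖c - 1‖ ^ 2` a bounded factor times one that
  -- vanishes since `m_n = o(n)`.
  have hbound : ∀ᶠ n : ℕ in atTop, ‖c n - 1‖ ≤ 6 * (m n * tail P (X 0) (ε * a n)) := by
    filter_upwards [hat.eventually_gt_atTop 0] with n han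
    have hφm : Measurable fun x : EuclideanSpace ℝ (Fin d) => upperTrunc ε ((a n)⁻¹ • x) :=
      (measurable_upperTrunc ε).comp (measurable_const_smul _)
    have hφ : ∀ x : EuclideanSpace ℝ (Fin d), ‖x‖ ≤ ε * a n → upperTrunc ε ((a n)⁻¹ • x) = 0 :=
      fun x hx => by
        rw [upperTrunc_smul han, upperTrunc, if_neg (not_lt.mpr hx), smul_zero]
    have h1 := hstat.norm_block_sub_le hX (s := s) hφm hφ 0 (m n)
    have h2 := norm_integral_jump_le (P := P) hX (s := s) hφ 0
    have h3 : P.real {ω | ε * a n < ‖X 0 ω‖ ∧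
        ∃ i ∈ Finset.Icc (0 + 1) (m n), ε * a n < ‖X (i : ℤ) ω‖} ≤ tail P (X 0) (ε * a n) :=
      measureReal_mono fun ω hω => hω.1
    simp only [← inner_upperSum_div han] at h1
    set J := ∫ ω, jump (fun x : EuclideanSpace ℝ (Fin d) => upperTrunc ε ((a n)⁻¹ • x)) s 0
      (fun t => X t ω) ∂P with hJ
    calc ‖c n - 1‖ = ‖(c n - 1 - m n * J) + m n * J‖ := by rw [sub_add_cancel]
      _ ≤ ‖c n - 1 - m n * J‖ + ‖(m n : ℂ) * J‖ := norm_add_le _ _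
      _ ≤ 4 * (m n * tail P (X 0) (ε * a n)) + m n * (2 * tail P (X 0) (ε * a n)) := by
          rw [norm_mul, Complex.norm_natCast]
          refine add_le_add (h1.trans ?_) (by gcongr)
          rw [Nat.cast_zero, zero_mul, zero_add]
          gcongr
      _ = 6 * (m n * tail P (X 0) (ε * a n)) := by ring
  have hsmall : Tendsto (fun n : ℕ => 6 * (m n * tail P (X 0) (ε * a n))) atTop (𝓝 0) := by
    have h := (hmn.mul hT).const_mul 6
    rw [zero_mul, mul_zero] at h
    refine h.congr' ?_
    filter_upwards [eventually_gt_atTop 0] with n hn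
    have : (n : ℝ) ≠ 0 := by exact_mod_cast hn.ne'
    field_simp
  have hprod := (hT.const_mul 6).mul hsmall
  rw [mul_zero] at hprod
  refine squeeze_zero_norm' ?_ hprod
  filter_upwards [hbound, hsmall.eventually_lt_const one_pos] with n h1 h2
  refine (norm_pow_sub_exp_le (norm_integral_cexpI_le _) (h1.trans h2.le) _).trans ?_
  have h3 := blocks_mul_le n (m n)
  have ht : 0 ≤ tail P (X 0) (ε * a n) := measureReal_nonneg
  calc ((n / m n : ℕ) : ℝ) * ‖c n - 1‖ ^ 2
      ≤ ((n / m n : ℕ) : ℝ) * (6 * (m n * tail P (X 0) (ε * a n))) ^ 2 := by gcongr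
    _ = 6 * ((((n / m n : ℕ) : ℝ) * m n) * tail P (X 0) (ε * a n))
          * (6 * (m n * tail P (X 0) (ε * a n))) := by ring
    _ ≤ 6 * (n * tail P (X 0) (ε * a n)) * (6 * (m n * tail P (X 0) (ε * a n))) := by gcongr

/-- The sharp and the continuous truncation have asymptotically the same mean. -/
lemma IsRegVarTail.eventually_centering_approx (hG : IsRegVarTail P (X 0) α)
    (hX : Measurable (X 0)) (hα1 : 1 < α)
    (ha : Tendsto (fun n : ℕ => (n : ℝ) * tail P (X 0) (a n)) atTop (𝓝 1))
    (s : EuclideanSpace ℝ (Fin d)) {ε η : ℝ} (hε : 0 < ε) (hη : 0 < η) :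
    ∀ᶠ k : ℕ in atTop, ∀ᶠ n : ℕ in atTop,
      |n * ∫ ω, ⟪s, upperTrunc ε ((a n)⁻¹ • X 0 ω)⟫_ℝ ∂P
        - n * ∫ ω, ⟪s, softTrunc ε (sharpness k) ((a n)⁻¹ • X 0 ω)⟫_ℝ ∂P| ≤ η := by
  have hat := hG.tendsto_normalization ha
  have h0 := hG.integrable hX hα1
  filter_upwards [((tendsto_gap (α := α) hε).const_mul (‖s‖ * (ε + 1))).eventually_lt_const
      (show ‖s‖ * (ε + 1) * (0 : ℝ) < η by linarith)] with k hk
  set κ := sharpness k with hκ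
  have hκ0 : 0 < κ := sharpness_pos k
  have hκ1 : 1 ≤ κ := one_le_pow₀ (by linarith [Nat.cast_nonneg (α := ℝ) k])
  have hκi : 0 < κ⁻¹ := by positivity
  have hκ2 : κ⁻¹ ≤ 1 := inv_le_one_of_one_le₀ hκ1
  have hT := hG.tendsto_mul_tail ha hε
  have hT' := hG.tendsto_mul_tail ha (show 0 < ε + κ⁻¹ by positivity)
  have hgap : 0 ≤ ε ^ (-α) - (ε + κ⁻¹) ^ (-α) :=
    sub_nonneg.mpr (Real.rpow_le_rpow_of_nonpos hε (by linarith) (by linarith))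
  have hlt : ‖s‖ * (ε + 1) * (ε ^ (-α) - (ε + κ⁻¹) ^ (-α)) < η := by
    refine lt_of_le_of_lt ?_ hk
    gcongr
    exact le_mul_of_one_le_left hgap (by linarith [Nat.cast_nonneg (α := ℝ) k])
  filter_upwards [((hT.sub hT').const_mul (‖s‖ * (ε + 1))).eventually_lt_const hlt,
    hat.eventually_gt_atTop 0] with n hn han
  have hnorm : ∀ x : EuclideanSpace ℝ (Fin d), ‖(a n)⁻¹ • x‖ = ‖x‖ / a n := fun x => by
    rw [norm_smul, norm_inv, Real.norm_of_nonneg han.le, inv_mul_eq_div]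
  have hXn : Measurable fun ω => (a n)⁻¹ • X 0 ω := hX.const_smul (a n)⁻¹
  have hXi : Integrable (fun ω => ‖s‖ * ‖(a n)⁻¹ • X 0 ω‖) P := by
    simp only [hnorm]; exact (h0.div_const _).const_mul _
  have hu : Measurable fun ω => ⟪s, upperTrunc ε ((a n)⁻¹ • X 0 ω)⟫_ℝ :=
    measurable_const.inner ((measurable_upperTrunc ε).comp hXn)
  have hv : Measurable fun ω => ⟪s, softTrunc ε κ ((a n)⁻¹ • X 0 ω)⟫_ℝ :=
    measurable_const.inner ((continuous_softTrunc ε κ).measurable.comp hXn)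
  have hui : Integrable (fun ω => ⟪s, upperTrunc ε ((a n)⁻¹ • X 0 ω)⟫_ℝ) P :=
    hXi.mono' hu.aestronglyMeasurable (ae_of_all _ fun ω => (norm_inner_le_norm _ _).trans (by
      gcongr; unfold upperTrunc; split_ifs <;> simp))
  have hvi : Integrable (fun ω => ⟪s, softTrunc ε κ ((a n)⁻¹ • X 0 ω)⟫_ℝ) P :=
    hXi.mono' hv.aestronglyMeasurable (ae_of_all _ fun ω => (norm_inner_le_norm _ _).trans (by
      gcongr; exact norm_softTrunc_le _ _ _))
  have hms : ∀ x, MeasurableSet {ω | x < ‖X 0 ω‖} := fun x =>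
    measurableSet_lt measurable_const hX.norm
  have hcc : ε * a n ≤ (ε + κ⁻¹) * a n := by gcongr; linarith
  set A : Set Ω := {ω | ε * a n < ‖X 0 ω‖} \ {ω | (ε + κ⁻¹) * a n < ‖X 0 ω‖} with hA
  have hAm : MeasurableSet A := (hms _).diff (hms _)
  have hPA : P.real A = tail P (X 0) (ε * a n) - tail P (X 0) ((ε + κ⁻¹) * a n) :=
    measureReal_sdiff (fun ω hω => hcc.trans_lt hω) (hms _)
  -- The truncations differ only on the shell between `ε` and `ε + κ⁻¹`, where the argument has norm
  -- at most `ε + 1`.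
  have hpt : ∀ ω, ‖⟪s, upperTrunc ε ((a n)⁻¹ • X 0 ω)⟫_ℝ - ⟪s, softTrunc ε κ ((a n)⁻¹ • X 0 ω)⟫_ℝ‖
      ≤ A.indicator (fun _ => ‖s‖ * (ε + 1)) ω := fun ω => by
    by_cases h : ω ∈ A
    · rw [indicator_of_mem h, ← inner_sub_right]
      refine (norm_inner_le_norm _ _).trans ?_
      gcongr
      have h1 : ε < ‖(a n)⁻¹ • X 0 ω‖ := by rw [hnorm, lt_div_iff₀ han]; exact h.1
      have h2 : ‖(a n)⁻¹ • X 0 ω‖ ≤ ε + κ⁻¹ := by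
        rw [hnorm, div_le_iff₀ han]; exact not_lt.mp h.2
      rw [upperTrunc, if_pos h1, softTrunc]
      set x := (a n)⁻¹ • X 0 ω
      have h3 : x - ramp ((‖x‖ - ε) * κ) • x = (1 - ramp ((‖x‖ - ε) * κ)) • x := by
        rw [sub_smul, one_smul]
      rw [h3, norm_smul, Real.norm_of_nonneg (sub_nonneg.mpr (ramp_le_one _))]
      refine (mul_le_of_le_one_left (norm_nonneg _) ?_).trans (h2.trans (by linarith))
      linarith [ramp_nonneg ((‖x‖ - ε) * κ)]
    · rw [indicator_of_notMem h, upperTrunc_eq_softTrunc hκ0, sub_self, norm_zero]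
      rintro ⟨h1, h2⟩
      rw [hnorm, lt_div_iff₀ han] at h1
      rw [hnorm, div_le_iff₀ han] at h2
      exact h ⟨h1, not_lt.mpr h2⟩
  rw [← mul_sub, ← integral_sub hui hvi, abs_mul, Nat.abs_cast]
  calc (n : ℝ) * |∫ ω, (⟪s, upperTrunc ε ((a n)⁻¹ • X 0 ω)⟫_ℝ
          - ⟪s, softTrunc ε κ ((a n)⁻¹ • X 0 ω)⟫_ℝ) ∂P|
      ≤ n * ∫ ω, A.indicator (fun _ => ‖s‖ * (ε + 1)) ω ∂P := by
        gcongr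
        exact norm_integral_le_of_norm_le ((integrable_const _).indicator hAm) (ae_of_all _ hpt)
    _ = ‖s‖ * (ε + 1) * (n * tail P (X 0) (ε * a n) - n * tail P (X 0) ((ε + κ⁻¹) * a n)) := by
        rw [integral_indicator_const _ hAm, hPA, smul_eq_mul]; ring
    _ ≤ η := hn.le

/-- The limit `n → ∞` at fixed `ε` and `k`. The jump is a bounded continuous function of the
coordinates up to `k` that vanishes when the first is small; the centering grows linearly and needs
the extension available for `α > 1`. -/
lemma IsSpectralTailProcess.tendsto_softExponent (hspec : IsSpectralTailProcess P X P' Θ)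
    (hX : ∀ t, Measurable (X t)) (hΘ : ∀ t, Measurable (Θ t)) (hα : α ∈ Ioo (0 : ℝ) 2)
    (hα1 : α ≠ 1) (hG : IsRegVarTail P (X 0) α)
    (ha : Tendsto (fun n : ℕ => (n : ℝ) * tail P (X 0) (a n)) atTop (𝓝 1))
    (s : EuclideanSpace ℝ (Fin d)) {ε : ℝ} (hε : 0 < ε) (k : ℕ) :
    Tendsto (fun n : ℕ =>
      n * ∫ ω, jump (softTrunc ε (sharpness k)) s k (fun t => (a n)⁻¹ • X t ω) ∂P
        - Complex.I * ((compOrder α *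
          (n * ∫ ω, ⟪s, softTrunc ε (sharpness k) ((a n)⁻¹ • X 0 ω)⟫_ℝ ∂P) : ℝ) : ℂ))
      atTop (𝓝 (softExponent P' α Θ s ε k)) := by
  have h1 := hspec.tendsto_vague_complex hX hΘ hα.1 hG ha hε k
    (F := jump (softTrunc ε (sharpness k)) s k) (continuous_jump (continuous_softTrunc _ _) k)
    (B := 2) (norm_jump_le_two k)
    (fun x y h => by
      simp only [jump]
      rw [Finset.sum_congr rfl fun t ht => by
          rw [h t (Nat.lt_succ_iff.mp (Finset.mem_range.mp ht))],
        Finset.sum_congr (s₁ := Finset.range k) rfl fun t ht => by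
          rw [h (t + 1) (Finset.mem_range.mp ht)]])
    (fun x h => jump_eq_zero (softTrunc_eq_zero (sharpness_pos k).le h))
  refine h1.sub (((Complex.continuous_ofReal.tendsto _).comp ?_).const_mul Complex.I)
  rcases lt_or_gt_of_ne hα1 with h | h
  · simp [compOrder_of_lt h]
  · exact (hspec.tendsto_vague_linear hX hΘ h hα.2 hG ha hε
      (g := fun x => ⟪s, softTrunc ε (sharpness k) x⟫_ℝ) (by fun_prop) (c := ‖s‖)
      (fun x => (abs_real_inner_le_norm _ _).trans (by
        gcongr; exact norm_softTrunc_le _ _ _))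
      (fun x hx => by rw [softTrunc_eq_zero (sharpness_pos k).le hx, inner_zero_right])).const_mul _

/-- Convergence of the characteristic functions of the normalized partial sums. -/
theorem IsSpectralTailProcess.tendsto_integral_cexpI_partialSum
    (hspec : IsSpectralTailProcess P X P' Θ) (hΘs : IsSummableSpectral P' α Θ)
    (hX : ∀ t, Measurable (X t)) (hstat : IsStrictlyStationary P X)
    (hG : IsRegVarTail P (X 0) α)
    (ha : Tendsto (fun n : ℕ => (n : ℝ) * tail P (X 0) (a n)) atTop (𝓝 1))
    (hm : Tendsto m atTop atTop)
    (hmn : Tendsto (fun n : ℕ => (m n : ℝ) / (n : ℝ)) atTop (𝓝 0))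
    (hmix : MixingCondition P X a m) (hanti : AntiClustering P X a m)
    (hmean : 1 < α → ∫ ω, X 0 ω ∂P = 0) (hvanish : 1 < α → VanishingSmallValues P X a)
    (s : EuclideanSpace ℝ (Fin d)) :
    Tendsto (fun n : ℕ => ∫ ω, cexpI ⟪s, (a n)⁻¹ • partialSum X n ω⟫_ℝ ∂P) atTop
      (𝓝 (Complex.exp (stabExponent P' α Θ s))) := by
  have hα := hΘs.index_mem
  have hα1 := hΘs.index_ne
  -- The curried filter encodes the order of limits: `ε` first, then `k` large depending on `ε`,
  -- then `n` large depending on both. It is finer than the product filter along which the exponents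
  -- converge.
  have : ((𝓝[>] (0 : ℝ)).curry (atTop : Filter ℕ)).NeBot := by
    rw [neBot_iff, Ne, ← empty_mem_iff_bot, mem_curry_iff]
    intro h
    obtain ⟨ε, hε⟩ := h.exists
    obtain ⟨k, hk⟩ := hε.exists
    exact hk
  refine tendsto_of_approx (l := (𝓝[>] (0 : ℝ)).curry (atTop : Filter ℕ))
    (b := fun i n => Complex.exp
      (n * ∫ ω, jump (softTrunc i.1 (sharpness i.2)) s i.2 (fun t => (a n)⁻¹ • X t ω) ∂P
        - Complex.I * ((compOrder α *
          (n * ∫ ω, ⟪s, softTrunc i.1 (sharpness i.2) ((a n)⁻¹ • X 0 ω)⟫_ℝ ∂P) : ℝ) : ℂ)))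
    (L := fun i => Complex.exp (softExponent P' α Θ s i.1 i.2)) (fun η hη => ?_) ?_
    ((Complex.continuous_exp.tendsto _).comp ((hΘs.tendsto_softExponent s).mono_left curry_le_prod))
  swap
  · rw [eventually_curry_iff]
    filter_upwards [self_mem_nhdsWithin] with ε hε
    exact Eventually.of_forall fun k => (Complex.continuous_exp.tendsto _).comp
      (hspec.tendsto_softExponent hX hΘs.measurable hα hα1 hG ha s hε k)
  rw [eventually_curry_iff]
  -- The errors add up to `7 * ρ`: one for the small values, two for mixing and exponential
  -- approximation, four for comparing exponents. The bound `1 / 2` keeps the exponents within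
  -- distance 1, as `norm_exp_sub_exp_le` requires.
  set ρ : ℝ := min (η / 16) (1 / 2) with hρ
  have hρ0 : 0 < ρ := by positivity
  have hρη : ρ ≤ η / 16 := min_le_left _ _
  have hρ1 : ρ ≤ 1 / 2 := min_le_right _ _
  filter_upwards [hstat.eventually_charFun_approx hX hG hα1 ha hmean hvanish s hρ0, hmix,
    self_mem_nhdsWithin] with ε h1 h2 hε
  have h3 := (h2 s).norm.eventually_lt_const (show ‖(0 : ℂ)‖ < ρ by simpa)
  have h4 := (hstat.tendsto_block_pow_sub_exp hX hG ha hmn s hε).norm.eventually_lt_const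
    (show ‖(0 : ℂ)‖ < ρ by simpa)
  have h5 : ∀ᶠ k : ℕ in atTop, ∀ᶠ n : ℕ in atTop,
      |compOrder α * (n * ∫ ω, ⟪s, upperTrunc ε ((a n)⁻¹ • X 0 ω)⟫_ℝ ∂P)
        - compOrder α * (n * ∫ ω, ⟪s, softTrunc ε (sharpness k) ((a n)⁻¹ • X 0 ω)⟫_ℝ ∂P)|
          ≤ ρ := by
    rcases lt_or_gt_of_ne hα1 with h | h
    · simp [compOrder_of_lt h, hρ0.le]
    · simpa only [compOrder_of_gt h, Nat.cast_one, one_mul] using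
        hG.eventually_centering_approx (hX 0) h ha s hε hρ0
  filter_upwards [hanti.eventually_block_approx hstat hX hG ha hm hmn s hε hρ0, h5] with k h6 h7
  filter_upwards [h1, h3, h4, h6, h7] with n h1 h3 h4 h6 h7
  change ‖(∫ ω, cexpI (⟪s, upperSum X (ε * a n) n ω⟫_ℝ / a n) ∂P)
    - (∫ ω, cexpI (⟪s, upperSum X (ε * a n) (m n) ω⟫_ℝ / a n) ∂P) ^ (n / m n)‖ < ρ at h3
  set U := ∫ ω, cexpI (⟪s, upperSum X (ε * a n) n ω⟫_ℝ / a n) ∂P with hU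
  set c := ∫ ω, cexpI (⟪s, upperSum X (ε * a n) (m n) ω⟫_ℝ / a n) ∂P with hc
  set q : ℝ := compOrder α * (n * ∫ ω, ⟪s, upperTrunc ε ((a n)⁻¹ • X 0 ω)⟫_ℝ ∂P) with hq
  set q' : ℝ := compOrder α *
    (n * ∫ ω, ⟪s, softTrunc ε (sharpness k) ((a n)⁻¹ • X 0 ω)⟫_ℝ ∂P) with hq'
  set J : ℂ := n * ∫ ω, jump (softTrunc ε (sharpness k)) s k (fun t => (a n)⁻¹ • X t ω) ∂P with hJ
  set z : ℂ := ((n / m n : ℕ) : ℂ) * (c - 1) with hz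
  have hc1 : ‖c‖ ≤ 1 := norm_integral_cexpI_le _
  -- Holds because `‖c‖ ≤ 1` and the centering is purely imaginary; it keeps the exponential from
  -- magnifying the error.
  have hre : (z - Complex.I * (q : ℂ)).re ≤ 0 := by
    have h8 := re_sub_one_nonpos hc1
    have e : (z - Complex.I * (q : ℂ)).re = ((n / m n : ℕ) : ℝ) * (c - 1).re := by
      rw [hz, Complex.sub_re, Complex.re_mul_ofReal, Complex.I_re, zero_mul, sub_zero,
        ← Complex.ofReal_natCast, Complex.re_ofReal_mul]
    rw [e]
    exact mul_nonpos_of_nonneg_of_nonpos (Nat.cast_nonneg _) h8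
  have hdist : ‖z - Complex.I * (q : ℂ) - (J - Complex.I * (q' : ℂ))‖ ≤ 2 * ρ := by
    have e : z - Complex.I * (q : ℂ) - (J - Complex.I * (q' : ℂ))
        = (z - J) - Complex.I * ((q - q' : ℝ) : ℂ) := by push_cast; ring
    rw [e]
    refine (norm_sub_le _ _).trans ?_
    rw [norm_mul, Complex.norm_I, one_mul, Complex.norm_real, Real.norm_eq_abs]
    linarith
  have h9 := norm_exp_sub_exp_le hre (hdist.trans (by linarith))
  have h10 : Complex.exp (z - Complex.I * (q : ℂ)) = cexpI (-q) * Complex.exp z := by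
    rw [cexpI, ← Complex.exp_add]
    congr 1
    push_cast
    ring
  have h11 : ‖cexpI (-q) * U - Complex.exp (z - Complex.I * (q : ℂ))‖ ≤ 2 * ρ := by
    rw [h10, ← mul_sub, norm_mul, norm_cexpI, one_mul]
    calc ‖U - Complex.exp z‖ ≤ ‖U - c ^ (n / m n)‖ + ‖c ^ (n / m n) - Complex.exp z‖ :=
          norm_sub_le_norm_sub_add_norm_sub _ _ _
      _ ≤ 2 * ρ := by linarith
  have h12 := norm_sub_le_norm_sub_add_norm_sub
    (∫ ω, cexpI ⟪s, (a n)⁻¹ • partialSum X n ω⟫_ℝ ∂P) (cexpI (-q) * U)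
    (Complex.exp (J - Complex.I * (q' : ℂ)))
  have h13 := norm_sub_le_norm_sub_add_norm_sub (cexpI (-q) * U)
    (Complex.exp (z - Complex.I * (q : ℂ))) (Complex.exp (J - Complex.I * (q' : ℂ)))
  linarith

end Limit

/-! ### Lévy's continuity theorem and stability from homogeneity. -/

section Levy

/-- **Lévy's continuity theorem**: a pointwise limit of characteristic functions which is continuous
at `0` is the characteristic function of a probability measure. -/
lemma exists_charFun_eq_of_tendsto {E : Type*} [NormedAddCommGroup E] [InnerProductSpace ℝ E]
    [FiniteDimensional ℝ E] [MeasurableSpace E] [BorelSpace E] {μ : ℕ → ProbabilityMeasure E}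
    {f : E → ℂ} (hf : ContinuousAt f 0)
    (h : ∀ t, Tendsto (fun n => charFun (μ n : Measure E) t) atTop (𝓝 (f t))) :
    ∃ ν : ProbabilityMeasure E, (∀ t, charFun (ν : Measure E) t = f t) ∧
      Tendsto μ atTop (𝓝 ν) := by
  have htight : IsTightMeasureSet (Set.range fun n => (μ n : Measure E)) :=
    isTightMeasureSet_of_tendsto_charFun hf h
  have hcomp : IsCompact (closure (Set.range μ)) := by
    refine isCompact_closure_of_isTightMeasureSet (htight.subset ?_)
    rintro _ ⟨_, ⟨n, rfl⟩, rfl⟩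
    exact ⟨n, rfl⟩
  obtain ⟨ν, -, φ, hφ, hν⟩ := hcomp.tendsto_subseq fun n => subset_closure ⟨n, rfl⟩
  have hchar : ∀ t, charFun (ν : Measure E) t = f t := fun t =>
    tendsto_nhds_unique (ProbabilityMeasure.tendsto_iff_tendsto_charFun.mp hν t)
      ((h t).comp hφ.tendsto_atTop)
  exact ⟨ν, hchar, ProbabilityMeasure.tendsto_of_tendsto_charFun fun t => by
    rw [hchar t]; exact h t⟩

variable {d : ℕ} {α : ℝ}

/-- A law whose characteristic exponent is homogeneous of degree `α` is `α`-stable. -/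
lemma isAlphaStable_of_charFun_eq (hα : 0 < α) {ν : Measure (EuclideanSpace ℝ (Fin d))}
    [IsProbabilityMeasure ν] {ψ : EuclideanSpace ℝ (Fin d) → ℂ}
    (hν : ∀ s, charFun ν s = Complex.exp (ψ s))
    (hψ : ∀ b : ℝ, 0 < b → ∀ s, ψ (b • s) = (b ^ α : ℝ) * ψ s) : IsAlphaStable α ν := by
  intro b c hb hc
  -- No shift is needed: exact homogeneity of the exponent gives strict stability.
  refine ⟨0, ?_⟩
  have hbc : 0 < b ^ α + c ^ α := by positivity
  have hmap : ∀ r : ℝ, IsProbabilityMeasure (ν.map fun x => r • x) := fun r =>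
    Measure.isProbabilityMeasure_map (by fun_prop)
  have := hmap b
  have := hmap c
  have := hmap ((b ^ α + c ^ α) ^ (1 / α))
  simp only [add_zero]
  refine Measure.ext_of_charFun (funext fun s => ?_)
  rw [charFun_conv, charFun_map_smul, charFun_map_smul, charFun_map_smul, hν, hν, hν, hψ b hb,
    hψ c hc, hψ _ (by positivity), ← Complex.exp_add, ← Real.rpow_mul hbc.le,
    one_div_mul_cancel hα.ne', Real.rpow_one]
  congr 1
  push_cast
  ring

end Levy

/-! ### Well-definedness of the limiting exponent. -/

section Spectral

variable {Ω Ω' : Type*} [MeasurableSpace Ω] [MeasurableSpace Ω'] {d : ℕ} {P : Measure Ω}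
  [IsProbabilityMeasure P] {P' : Measure Ω'} [IsProbabilityMeasure P']
  {X : ℤ → Ω → EuclideanSpace ℝ (Fin d)} {Θ : ℤ → Ω' → EuclideanSpace ℝ (Fin d)}
  {α : ℝ} {a : ℕ → ℝ} {m : ℕ → ℕ}

/-- For `α < 1` the counting argument gives summability, and no moment is required because
`compOrder α = 0`. For `α > 1` Tonelli turns the summed means into an integrable sum. -/
lemma IsSpectralTailProcess.isSummableSpectral (hspec : IsSpectralTailProcess P X P' Θ)
    (hX : ∀ t, Measurable (X t)) (hΘ : ∀ t, Measurable (Θ t)) (hα : α ∈ Ioo (0 : ℝ) 2)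
    (hα1 : α ≠ 1) (hstat : IsStrictlyStationary P X) (hG : IsRegVarTail P (X 0) α)
    (ha : Tendsto (fun n : ℕ => (n : ℝ) * tail P (X 0) (a n)) atTop (𝓝 1))
    (hm : Tendsto m atTop atTop) (hanti : AntiClustering P X a m)
    (hsum : 1 < α → ∑' j : ℕ, ∫⁻ ω, ‖Θ ((j : ℤ) + 1) ω‖ₑ ∂P' < ∞) :
    IsSummableSpectral P' α Θ := by
  have h0 := hspec.norm_zero_eq_one hΘ
  rcases lt_or_gt_of_ne hα1 with h | h
  · refine ⟨hΘ, hα, hα1, h0, ?_, ?_⟩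
    · filter_upwards [hspec.ae_summable_norm hX hΘ hstat hG hα.1 h ha hm hanti] with ω hω
      exact_mod_cast (summable_nat_add_iff 1).mpr hω
    · simp [compOrder_of_lt h]
  · have hme : ∀ j : ℕ, Measurable fun ω => ‖Θ ((j : ℤ) + 1) ω‖ₑ := fun j => (hΘ _).enorm
    have hfin : ∫⁻ ω, ∑' j : ℕ, ‖Θ ((j : ℤ) + 1) ω‖ₑ ∂P' < ∞ := by
      rw [lintegral_tsum fun j => (hme j).aemeasurable]; exact hsum h
    have hS : ∀ᵐ ω ∂P', Summable fun t : ℕ => ‖Θ ((t : ℤ) + 1) ω‖ := by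
      filter_upwards [ae_lt_top (Measurable.tsum hme) hfin.ne] with ω hω
      simpa using ENNReal.summable_toReal hω.ne
    have he : (fun ω => (∑' j : ℕ, ‖Θ ((j : ℤ) + 1) ω‖ₑ).toReal) = absTailSum Θ := by
      funext ω
      rw [absTailSum, ENNReal.tsum_toReal_eq fun j => enorm_ne_top]
      simp
    refine ⟨hΘ, hα, hα1, h0, hS, ?_⟩
    rw [← he]
    exact (integrable_toReal_of_lintegral_ne_top (Measurable.tsum hme).aemeasurable
      hfin.ne).const_mul _

end Spectral

end HeavyTail

theorem theorem4p2 {Ω Ω' : Type*} [MeasurableSpace Ω] [MeasurableSpace Ω'] {d : ℕ}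
    (P : Measure Ω) [IsProbabilityMeasure P] (P' : Measure Ω') [IsProbabilityMeasure P']
    (X : ℤ → Ω → EuclideanSpace ℝ (Fin d)) (hX : ∀ t, Measurable (X t))
    (Θ : ℤ → Ω' → EuclideanSpace ℝ (Fin d)) (hΘ : ∀ t, Measurable (Θ t))
    (α : ℝ) (hα : α ∈ Ioo (0 : ℝ) 2) (hα1 : α ≠ 1)
    (a : ℕ → ℝ) (m : ℕ → ℕ)
    -- `(X_t)` is strictly stationary, regularly varying, with spectral tail process `(Θ_t)`
    (hstat : HeavyTail.IsStrictlyStationary P X)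
    (hRV : HeavyTail.IsRegVarSequence P X α)
    (hspec : HeavyTail.IsSpectralTailProcess P X P' Θ)
    -- normalization `n P(|X_0| > a_n) → 1`, and block lengths `m_n → ∞`, `m_n = o(n)`
    (ha : Tendsto (fun n : ℕ => (n : ℝ) * P.real {ω | a n < ‖X 0 ω‖}) atTop (𝓝 1))
    (hm : Tendsto m atTop atTop)
    (hmn : Tendsto (fun n : ℕ => (m n : ℝ) / (n : ℝ)) atTop (𝓝 0))
    (hmix : HeavyTail.MixingCondition P X a m)
    (hanti : HeavyTail.AntiClustering P X a m)
    -- additional assumptions for `α ∈ (1, 2)`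
    (hmean : 1 < α → ∫ ω, X 0 ω ∂P = 0)
    (hvanish : 1 < α → HeavyTail.VanishingSmallValues P X a)
    (hsum : 1 < α → ∑' j : ℕ, ∫⁻ ω, ‖Θ ((j : ℤ) + 1) ω‖ₑ ∂P' < ∞) :
    -- the limiting expression is well defined
    (∀ᵐ ω ∂P', Summable fun j : ℕ => Θ (j : ℤ) ω) ∧
    (∀ (s : EuclideanSpace ℝ (Fin d)) (y : ℝ), 0 < y →
      Integrable (HeavyTail.stableIntegrand α Θ s y) P') ∧
    (∀ s : EuclideanSpace ℝ (Fin d),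
      Integrable (fun y : ℝ => ∫ ω, HeavyTail.stableIntegrand α Θ s y ω ∂P')
        (HeavyTail.powMeasure α)) ∧
    -- convergence in distribution to the stable law
    ∃ ν : ProbabilityMeasure (EuclideanSpace ℝ (Fin d)),
      HeavyTail.IsAlphaStable α (ν : Measure (EuclideanSpace ℝ (Fin d))) ∧
      (∀ s : EuclideanSpace ℝ (Fin d),
        charFun (ν : Measure (EuclideanSpace ℝ (Fin d))) s
          = Complex.exp
            (∫ y, (∫ ω, HeavyTail.stableIntegrand α Θ s y ω ∂P') ∂(HeavyTail.powMeasure α))) ∧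
      TendstoInDistribution (fun (n : ℕ) (ω : Ω) => (a n)⁻¹ • HeavyTail.partialSum X n ω) atTop id
        (fun _ => P) (ν : Measure (EuclideanSpace ℝ (Fin d))) := by
  have hG := hRV.isRegVarTail hstat hX
  have hΘs := hspec.isSummableSpectral hX hΘ hα hα1 hstat hG ha hm hanti hsum
  refine ⟨hΘs.ae_summable, fun s => (hΘs.integrable_stableIntegrand s).1,
    fun s => (hΘs.integrable_stableIntegrand s).2, ?_⟩
  have hS : ∀ n, Measurable fun ω => (a n)⁻¹ • HeavyTail.partialSum X n ω := fun n =>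
    (HeavyTail.measurable_partialSum hX n).const_smul (a n)⁻¹
  let μ : ℕ → ProbabilityMeasure (EuclideanSpace ℝ (Fin d)) := fun n =>
    ⟨P.map fun ω => (a n)⁻¹ • HeavyTail.partialSum X n ω,
      Measure.isProbabilityMeasure_map (hS n).aemeasurable⟩
  have hμ : ∀ s, Tendsto (fun n => charFun (μ n : Measure (EuclideanSpace ℝ (Fin d))) s) atTop
      (𝓝 (Complex.exp (HeavyTail.stabExponent P' α Θ s))) := fun s => by
    refine (hspec.tendsto_integral_cexpI_partialSum hΘs hX hstat hG ha hm hmn hmix hanti hmean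
      hvanish s).congr fun n => ?_
    simp only [μ, ProbabilityMeasure.coe_mk]
    rw [charFun_apply, integral_map (hS n).aemeasurable (by fun_prop)]
    refine integral_congr_ae (ae_of_all _ fun ω => ?_)
    simp only [HeavyTail.cexpI]
    rw [real_inner_comm, mul_comm]
  -- Continuity of the limit at 0 provides tightness, so no mass escapes and the limit is a genuine
  -- characteristic function.
  obtain ⟨ν, hν, hlim⟩ := HeavyTail.exists_charFun_eq_of_tendsto
    (Complex.continuous_exp.comp hΘs.continuous_stabExponent).continuousAt hμ
  refine ⟨ν, HeavyTail.isAlphaStable_of_charFun_eq hα.1 hν fun b hb s =>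
    hΘs.stabExponent_smul hb s, hν, ⟨fun n => (hS n).aemeasurable, aemeasurable_id, ?_⟩⟩
  simp only [Measure.map_id]
  exact hlim
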